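/- **Setting.** For each $n$ let $\mathcal D_n=(d_1,\dots,d_n)$ be a sequence of non-negative integers such that, for all sufficiently large $n$, every $d_v\ge 1$ and there is at least one simple graph on $V=[n]$ in which every vertex $v$ has degree $d(v)=d_v$. Let $G(\mathcal D_n)$ be a uniformly random simple graph on $[n]$ with these degrees, and for $p=p(n)\in[0,1]$ let $G(\mathcal D_n)_p$ be obtained from it by keeping each edge independently with probability $p$. Let $L_1(H)$ be the order of a largest connected component of a graph $H$. For $d=d(n)\in\mathbb N$ let $S_n(d)=\{v\in[n]: d(v)\ge d\}$, write $d(U)=\sum_{v\in U}d(v)$ for $U\subseteq [n]$, and for $k=k(n)\in\mathbb R$ let $$N_k(d,p)=\sum_{v\notin S_n(d)}\mathbb P(\mathrm{Bin}(d(v),p)\ge k).$$ For non-negative functions, $f\ll g$ (equivalently $g\gg f$) means that for every $\varepsilon>0$ one has $f(n)\le\varepsilon g(n)$ for all large $n$. Asymptotics are as $n\to\infty$, and an $o(1)$ inside an event denotes some deterministic sequence tending to $0$. **Theorem 6 (Sublinear size threshold for dense cores).** Let $(\mathcal D_n)$ and $d=d(n)$ be as above. (a) If $|S_n(d)|\to\infty$,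 then for any $p=p(n)\in[0,1]$, $$\mathbb P\big[L_1(G(\mathcal D_n)_p)\le(1+o(1))\,(|S_n(d)|+N_1(d,p))\big]=1-o(1).$$ (b) If $d(n)\ge 1$ for all large $n$ and $d(S_n(d))\gg d(V\setminus S_n(d))$, then for any $p=p(n)\in[0,1]$ with $p\gg 1/d$ and any $\omega=\omega(n)\to\infty$, $$\mathbb P\big[L_1(G(\mathcal D_n)_p)\ge(1-o(1))\,(|S_n(d)|+N_\omega(d,p))\big]=1-o(1).$$ -/

import Mathlib

open MeasureTheory ProbabilityTheory Filter Topology Asymptotics unitInterval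

namespace DensePercolation

/-- The set of simple graphs on the vertex set `Fin n` in which vertex `v` has degree `δ v`
for every `v`. The degree sequence `δ` is feasible when this set is nonempty. -/
def graphsWithDegrees {n : ℕ} (δ : Fin n → ℕ) : Set (SimpleGraph (Fin n)) :=
  {G | ∀ v, (G.neighborSet v).ncard = δ v}

/-- The law of the `p`-bond-percolation `G_p` of a fixed graph `G`: every edge of `G` is kept
independently with probability `p`. -/
noncomputable def percolation {V : Type*} (G : SimpleGraph V) (p : I) :
    Measure (SimpleGraph V) :=
  (setBernoulli G.edgeSet p).map SimpleGraph.fromEdgeSet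

/-- The law of `G(δ)_p`: first choose `G(δ)` uniformly at random among all simple graphs with
degree sequence `δ`, then percolate it with probability `p`. -/
noncomputable def percolatedLaw {n : ℕ} (δ : Fin n → ℕ) (p : I) :
    Measure (SimpleGraph (Fin n)) :=
  (uniformOn (graphsWithDegrees δ)).bind fun G => percolation G p

/-- The order of a largest connected component of a graph on `Fin n`. -/
noncomputable def largestComponent {n : ℕ} (H : SimpleGraph (Fin n)) : ℕ :=
  ⨆ c : H.ConnectedComponent, c.supp.ncard

/-- The set of vertices of degree at least `d`. -/
def core {n : ℕ} (δ : Fin n → ℕ) (d : ℕ) : Finset (Fin n) :=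
  Finset.univ.filter fun v => d ≤ δ v

/-- The sum of the degrees of the vertices in `U`. -/
def degreeSum {n : ℕ} (δ : Fin n → ℕ) (U : Finset (Fin n)) : ℕ :=
  ∑ v ∈ U, δ v

/-- `N_k(d, p)`, the sum of `P(Bin(δ v, p) ≥ k)` over the vertices `v` of degree less
than `d`. -/
noncomputable def expectedAttached {n : ℕ} (δ : Fin n → ℕ) (d : ℕ) (p : I) (k : ℝ) : ℝ :=
  ∑ v ∈ (core δ d)ᶜ, (binomial (δ v) p).real {j : ℕ | k ≤ (j : ℝ)}

end DensePercolation

open DensePercolation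

/-! Part (a) uses no randomness of the graph. A component with at least two vertices contains no
isolated vertex, so its order is at most the size of the core plus the number of non-isolated
vertices outside it. For each fixed graph with the given degrees that number has mean N_1 and, by
Efron–Stein, variance at most 2 N_1. Chebyshev's inequality finishes (`bern_large_component_le`).

For part (b) it suffices to find a constant k such that a vertex, given that it keeps at least k
edges, lies in one giant component with probability close to 1 (`sum_not_inBig_le`). The expected
number of exceptional vertices is then small compared with |S| + N_k, and the number of vertices
keeping at least k edges is concentrated (`sum_small_component_le`). Eventually ω ≥ k, so N_ω ≤ N_k.

The random graph is accessed only through switchings, which replace edges ab, cd by ad, cb and keep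
all degrees. Counting switchings in both directions compares a bad family of graphs with the family
of all graphs. This is used in two ways.

Expansion: a graph with a sparse balanced cut of the core has at least twice as many switchings that
enlarge the cut as its images have switchings back. Allowing two more edges across the cut therefore
doubles the family, and iterating beats the 2^|S| choices of the cut (`card_not_cutExpanding_le`).
Since all balanced cuts are then large, a first round of percolation leaves a component with three
quarters of the core (`giant_spec`).

Attachment: few graphs have a vertex with few neighbours in a set C that spans many edges, while
many of its neighbours have few neighbours in C themselves (`attachment`). With nothing exposed,
this gives vertices many neighbours in the set T of high-degree vertices. Applied conditionally on
the percolated subgraph F, given which the graph is uniform among those containing F, it shows that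
vertices of T have many short routes to the giant. A second round of percolation then joins them to
it (`sum_not_inGiant_le`).

A general vertex v is treated by deleting it: given its neighbourhood, the rest is again uniform for
a slightly changed degree sequence, and the giant of the rest is independent of the percolation on
the edges at v. So v misses the giant only if its kept edges avoid a sizeable set of its edges. -/

namespace DensePercolation

set_option linter.unusedSectionVars false

/-- The real-valued indicator of a proposition. -/
noncomputable def ind (P : Prop) : ℝ := by classical exact if P then 1 else 0

lemma ind_true {P : Prop} (h : P) : ind P = 1 := by simp [ind, h]

lemma ind_false {P : Prop} (h : ¬ P) : ind P = 0 := by simp [ind, h]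

lemma ind_nonneg (P : Prop) : 0 ≤ ind P := by
  unfold ind; split_ifs <;> norm_num

lemma ind_le_one (P : Prop) : ind P ≤ 1 := by
  unfold ind; split_ifs <;> norm_num

lemma ind_mono {P Q : Prop} (h : P → Q) : ind P ≤ ind Q := by
  by_cases hP : P
  · rw [ind_true hP, ind_true (h hP)]
  · rw [ind_false hP]; exact ind_nonneg _

lemma ind_and (P Q : Prop) : ind (P ∧ Q) = ind P * ind Q := by
  by_cases hP : P <;> by_cases hQ : Q <;> simp [ind, hP, hQ]

lemma ind_or_le {P Q R : Prop} (h : P → Q ∨ R) : ind P ≤ ind Q + ind R := by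
  by_cases hP : P
  · rcases h hP with h | h
    · rw [ind_true h]; linarith [ind_le_one P, ind_nonneg R]
    · rw [ind_true h]; linarith [ind_le_one P, ind_nonneg Q]
  · rw [ind_false hP]; linarith [ind_nonneg Q, ind_nonneg R]

lemma ind_not (P : Prop) : ind (¬ P) = 1 - ind P := by
  by_cases hP : P <;> simp [ind, hP]

lemma card_filter_eq_sum_ind {ι : Type*} (s : Finset ι) (P : ι → Prop) [DecidablePred P] :
    ((s.filter P).card : ℝ) = ∑ i ∈ s, ind (P i) := by
  rw [Finset.card_filter]
  push_cast
  refine Finset.sum_congr rfl fun i _ => ?_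
  by_cases h : P i <;> simp [ind, h]

/-! ### Expectations over independent random subsets of a finite set. -/

section Bernoulli

variable {α : Type*} [DecidableEq α]

/-- The expectation of `f F`, where `F` is the random subset of `E` that contains every element
of `E` independently with probability `p`. -/
noncomputable def bern (E : Finset α) (p : ℝ) (f : Finset α → ℝ) : ℝ :=
  ∑ F ∈ E.powerset, p ^ F.card * (1 - p) ^ (E \ F).card * f F

lemma bern_empty (p : ℝ) (f : Finset α → ℝ) : bern ∅ p f = f ∅ := by
  simp [bern]

/-- Conditioning on one element. The product-measure facts below are proved from this recursion by
induction on `E`. -/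
lemma bern_insert {e : α} {E : Finset α} (he : e ∉ E) (p : ℝ) (f : Finset α → ℝ) :
    bern (insert e E) p f = p * bern E p (fun F => f (insert e F)) + (1 - p) * bern E p f := by
  unfold bern
  rw [Finset.sum_powerset_insert he, add_comm, Finset.mul_sum, Finset.mul_sum]
  congr 1
  · refine Finset.sum_congr rfl fun F hF => ?_
    have hF' := Finset.mem_powerset.1 hF
    have heF : e ∉ F := fun h => he (hF' h)
    rw [Finset.card_insert_of_notMem heF]
    have : insert e E \ insert e F = E \ F := by
      ext x; simp only [Finset.mem_sdiff, Finset.mem_insert]; grind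
    rw [this]; ring
  · refine Finset.sum_congr rfl fun F hF => ?_
    have hF' := Finset.mem_powerset.1 hF
    have heF : e ∉ F := fun h => he (hF' h)
    rw [Finset.insert_sdiff_of_notMem _ heF, Finset.card_insert_of_notMem (by grind)]
    ring

lemma bern_congr {E : Finset α} {p : ℝ} {f g : Finset α → ℝ} (h : ∀ F ⊆ E, f F = g F) :
    bern E p f = bern E p g :=
  Finset.sum_congr rfl fun F hF => by rw [h F (Finset.mem_powerset.1 hF)]

lemma bern_mono {E : Finset α} {p : ℝ} (h0 : 0 ≤ p) (h1 : p ≤ 1) {f g : Finset α → ℝ}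
    (h : ∀ F ⊆ E, f F ≤ g F) : bern E p f ≤ bern E p g :=
  Finset.sum_le_sum fun F hF => mul_le_mul_of_nonneg_left (h F (Finset.mem_powerset.1 hF))
    (mul_nonneg (pow_nonneg h0 _) (pow_nonneg (sub_nonneg.2 h1) _))

lemma bern_add (E : Finset α) (p : ℝ) (f g : Finset α → ℝ) :
    bern E p (fun F => f F + g F) = bern E p f + bern E p g := by
  simp only [bern, mul_add, Finset.sum_add_distrib]

lemma bern_mul_left (E : Finset α) (p c : ℝ) (f : Finset α → ℝ) :
    bern E p (fun F => c * f F) = c * bern E p f := by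
  simp only [bern, Finset.mul_sum]
  exact Finset.sum_congr rfl fun F _ => by ring

lemma bern_mul_right (E : Finset α) (p c : ℝ) (f : Finset α → ℝ) :
    bern E p (fun F => f F * c) = bern E p f * c := by
  simp only [bern, Finset.sum_mul]
  exact Finset.sum_congr rfl fun F _ => by ring

lemma bern_sub (E : Finset α) (p : ℝ) (f g : Finset α → ℝ) :
    bern E p (fun F => f F - g F) = bern E p f - bern E p g := by
  simp only [bern, mul_sub, Finset.sum_sub_distrib]

lemma bern_sum {ι : Type*} (s : Finset ι) (E : Finset α) (p : ℝ) (f : ι → Finset α → ℝ) :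
    bern E p (fun F => ∑ i ∈ s, f i F) = ∑ i ∈ s, bern E p (f i) := by
  simp only [bern, Finset.mul_sum]
  exact Finset.sum_comm

lemma bern_pow_card (E : Finset α) (p x : ℝ) :
    bern E p (fun F => x ^ F.card) = (1 - p + p * x) ^ E.card := by
  induction E using Finset.induction_on with
  | empty => simp [bern_empty]
  | insert e E he ih =>
    rw [bern_insert he, Finset.card_insert_of_notMem he, pow_succ, ih]
    have : bern E p (fun F => x ^ (insert e F).card) = bern E p (fun F => x * x ^ F.card) := by
      refine bern_congr fun F hF => ?_
      rw [Finset.card_insert_of_notMem fun h => he (hF h), pow_succ]; ring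
    rw [this, bern_mul_left, ih]; ring

lemma bern_const (E : Finset α) (p c : ℝ) : bern E p (fun _ => c) = c := by
  have := bern_pow_card E p 1
  simp only [one_pow] at this
  have h2 := bern_mul_left E p c (fun _ => 1)
  simp only [mul_one] at h2
  rw [h2, this]; norm_num

lemma bern_nonneg {E : Finset α} {p : ℝ} (h0 : 0 ≤ p) (h1 : p ≤ 1) {f : Finset α → ℝ}
    (h : ∀ F ⊆ E, 0 ≤ f F) : 0 ≤ bern E p f := by
  rw [← bern_const E p 0]; exact bern_mono h0 h1 h

lemma bern_le_const {E : Finset α} {p : ℝ} (h0 : 0 ≤ p) (h1 : p ≤ 1) {f : Finset α → ℝ} {c : ℝ}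
    (h : ∀ F ⊆ E, f F ≤ c) : bern E p f ≤ c := by
  rw [← bern_const E p c]; exact bern_mono h0 h1 h

lemma bern_union {E₁ E₂ : Finset α} (h : Disjoint E₁ E₂) (p : ℝ) (f : Finset α → ℝ) :
    bern (E₁ ∪ E₂) p f = bern E₁ p (fun F₁ => bern E₂ p (fun F₂ => f (F₁ ∪ F₂))) := by
  induction E₁ using Finset.induction_on generalizing f with
  | empty => simp [bern_empty]
  | insert e E he ih =>
    rw [Finset.disjoint_insert_left] at h
    rw [Finset.insert_union, bern_insert (by simp [he, h.1]), bern_insert he, ih h.2, ih h.2]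
    simp only [Finset.insert_union]

/-- Percolation with parameter `p` is the union of two independent percolations. -/
lemma bern_sprinkle {p p₁ p₂ : ℝ} (hp : 1 - p = (1 - p₁) * (1 - p₂)) (E : Finset α)
    (f : Finset α → ℝ) :
    bern E p f = bern E p₁ (fun F₁ => bern E p₂ (fun F₂ => f (F₁ ∪ F₂))) := by
  induction E using Finset.induction_on generalizing f with
  | empty => simp [bern_empty]
  | insert e E he ih =>
    rw [bern_insert he, bern_insert he, ih, ih]
    simp only [bern_insert he, Finset.insert_union, Finset.union_insert, Finset.insert_idem,
      bern_add, bern_mul_left]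
    set x := bern E p₁ fun F₁ => bern E p₂ fun F₂ => f (insert e (F₁ ∪ F₂))
    set y := bern E p₁ fun F₁ => bern E p₂ fun F₂ => f (F₁ ∪ F₂)
    rw [hp]
    have : p = 1 - (1 - p₁) * (1 - p₂) := by linarith
    rw [this]; ring

lemma bern_inter {E E' : Finset α} (h : E' ⊆ E) (p : ℝ) (g : Finset α → ℝ) :
    bern E p (fun F => g (F ∩ E')) = bern E' p g := by
  have hE : E = E' ∪ E \ E' := by rw [Finset.union_sdiff_of_subset h]
  conv_lhs => rw [hE]
  rw [bern_union Finset.disjoint_sdiff]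
  refine bern_congr fun F₁ h₁ => ?_
  rw [← bern_const (E \ E') p (g F₁)]
  refine bern_congr fun F₂ h₂ => ?_
  congr 1
  ext x; simp only [Finset.mem_inter, Finset.mem_union]
  have := @h₁ x
  have := @h₂ x
  simp only [Finset.mem_sdiff] at this
  tauto

lemma bern_indep {E E₁ E₂ : Finset α} (h₁ : E₁ ⊆ E) (h₂ : E₂ ⊆ E) (h : Disjoint E₁ E₂) (p : ℝ)
    (f g : Finset α → ℝ) :
    bern E p (fun F => f (F ∩ E₁) * g (F ∩ E₂)) = bern E₁ p f * bern E₂ p g := by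
  have key := bern_inter (Finset.union_subset h₁ h₂) p (fun F => f (F ∩ E₁) * g (F ∩ E₂))
  have e1 : ∀ F : Finset α, F ∩ (E₁ ∪ E₂) ∩ E₁ = F ∩ E₁ := by intro F; ext; grind
  have e2 : ∀ F : Finset α, F ∩ (E₁ ∪ E₂) ∩ E₂ = F ∩ E₂ := by intro F; ext; grind
  simp only [e1, e2] at key
  rw [key, bern_union h, ← bern_mul_right]
  refine bern_congr fun F₁ hF₁ => ?_
  rw [← bern_mul_left]
  refine bern_congr fun F₂ hF₂ => ?_
  have a1 : (F₁ ∪ F₂) ∩ E₁ = F₁ := by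
    rw [Finset.union_inter_distrib_right, Finset.inter_eq_left.2 hF₁,
      Finset.disjoint_iff_inter_eq_empty.1 (h.symm.mono_left hF₂), Finset.union_empty]
  have a2 : (F₁ ∪ F₂) ∩ E₂ = F₂ := by
    rw [Finset.union_inter_distrib_right, Finset.inter_eq_left.2 hF₂,
      Finset.disjoint_iff_inter_eq_empty.1 (h.mono_left hF₁), Finset.empty_union]
  rw [a1, a2]

lemma bern_void {E E' : Finset α} (h : E' ⊆ E) (p : ℝ) :
    bern E p (fun F => ind (F ∩ E' = ∅)) = (1 - p) ^ E'.card := by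
  rw [bern_inter h p (fun F => ind (F = ∅))]
  have := bern_pow_card E' p 0
  rw [mul_zero, add_zero] at this
  rw [← this]
  refine bern_congr fun F _ => ?_
  by_cases hF : F = ∅
  · simp [ind, hF]
  · rw [ind_false hF, zero_pow (by simpa using hF)]

/-- A random subset of density at most one half misses an eighth of the elements, except with
exponentially small probability. -/
lemma bern_few_missed {E : Finset α} {p : ℝ} (h0 : 0 ≤ p) (h1 : p ≤ 1 / 2) :
    bern E p (fun F => ind (8 * (E \ F).card ≤ E.card)) ≤ (4 / 5 : ℝ) ^ E.card := by
  have key : bern E p (fun F => (1 / 16 : ℝ) ^ (E \ F).card) = (p + (1 - p) / 16) ^ E.card := by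
    have : bern E p (fun F => (1 / 16 : ℝ) ^ (E \ F).card)
        = bern E p (fun F => (1 / 16 : ℝ) ^ E.card * 16 ^ F.card) := by
      refine bern_congr fun F hF => ?_
      have : E.card = (E \ F).card + F.card := by
        rw [Finset.card_sdiff_add_card_eq_card hF]
      rw [this, pow_add, mul_assoc, ← mul_pow]; norm_num
    rw [this, bern_mul_left, bern_pow_card, ← mul_pow]; congr 1; ring
  -- Exponential Markov with weight 1/16 per missed element. The factor 3/2 is chosen so that
  -- (3/2)^8 ≥ 16, while (3/2)(p + (1 - p)/16) ≤ 4/5 for p ≤ 1/2.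
  have hle : bern E p (fun F => ind (8 * (E \ F).card ≤ E.card))
      ≤ bern E p (fun F => (3 / 2 : ℝ) ^ E.card * (1 / 16 : ℝ) ^ (E \ F).card) := by
    refine bern_mono h0 (by linarith) fun F _ => ?_
    by_cases h : 8 * (E \ F).card ≤ E.card
    · rw [ind_true h]
      calc (1 : ℝ) ≤ ((3 / 2) ^ 8 * (1 / 16)) ^ (E \ F).card := one_le_pow₀ (by norm_num)
        _ = (3 / 2 : ℝ) ^ (8 * (E \ F).card) * (1 / 16) ^ (E \ F).card := by
          rw [mul_pow, pow_mul]
        _ ≤ _ := by gcongr; norm_num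
    · rw [ind_false h]; positivity
  rw [bern_mul_left, key, ← mul_pow] at hle
  refine hle.trans (pow_le_pow_left₀ (by nlinarith) (by nlinarith) _)

lemma bern_markov {E : Finset α} {p : ℝ} (h0 : 0 ≤ p) (h1 : p ≤ 1) {f : Finset α → ℝ}
    (hf : ∀ F ⊆ E, 0 ≤ f F) {c : ℝ} (hc : 0 < c) :
    bern E p (fun F => ind (c ≤ f F)) ≤ bern E p f / c := by
  rw [le_div_iff₀ hc, ← bern_mul_right]
  refine bern_mono h0 h1 fun F hF => ?_
  by_cases h : c ≤ f F
  · rw [ind_true h]; linarith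
  · rw [ind_false h]; simpa using hf F hF

/-- The variance of `f`. -/
noncomputable def bernVar (E : Finset α) (p : ℝ) (f : Finset α → ℝ) : ℝ :=
  bern E p (fun F => f F ^ 2) - bern E p f ^ 2

/-- The law of total variance, conditioning on whether `e` is chosen: the last term is the variance
of the conditional expectation. -/
lemma bernVar_insert {e : α} {E : Finset α} (he : e ∉ E) (p : ℝ) (f : Finset α → ℝ) :
    bernVar (insert e E) p f = p * bernVar E p (fun F => f (insert e F)) +
      (1 - p) * bernVar E p f +
      p * (1 - p) * bern E p (fun F => f (insert e F) - f F) ^ 2 := by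
  unfold bernVar
  rw [bern_insert he, bern_insert he, bern_sub]
  ring

lemma bern_sq_le {E : Finset α} {p : ℝ} (h0 : 0 ≤ p) (h1 : p ≤ 1) (f : Finset α → ℝ) :
    bern E p f ^ 2 ≤ bern E p (fun F => f F ^ 2) := by
  have : 0 ≤ bern E p (fun F => (f F - bern E p f) ^ 2) :=
    bern_nonneg h0 h1 fun F _ => sq_nonneg _
  have h2 : bern E p (fun F => (f F - bern E p f) ^ 2)
      = bern E p (fun F => f F ^ 2) - bern E p f ^ 2 := by
    have : ∀ F, (f F - bern E p f) ^ 2 = f F ^ 2 - (2 * bern E p f) * f F + bern E p f ^ 2 :=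
      fun F => by ring
    simp only [this]
    rw [bern_add, bern_sub, bern_mul_left, bern_const]; ring
  linarith

/-- The Efron–Stein inequality for independent Bernoulli variables. -/
lemma bernVar_le {p : ℝ} (h0 : 0 ≤ p) (h1 : p ≤ 1) (E : Finset α) (f : Finset α → ℝ) :
    bernVar E p f ≤ p * (1 - p) *
      ∑ e ∈ E, bern E p (fun F => (f (insert e F) - f (F.erase e)) ^ 2) := by
  induction E using Finset.induction_on generalizing f with
  | empty => simp [bernVar, bern_empty]
  | insert e E he ih =>
    rw [bernVar_insert he, Finset.sum_insert he]
    have hnn : 0 ≤ p * (1 - p) := mul_nonneg h0 (by linarith)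
    -- Jensen's inequality. The discrete derivative at `e` does not depend on whether `e` belongs to
    -- the set, so both branches of `bern_insert` agree.
    have h3 : bern E p (fun F => f (insert e F) - f F) ^ 2 ≤
        bern (insert e E) p (fun F => (f (insert e F) - f (F.erase e)) ^ 2) := by
      refine (bern_sq_le h0 h1 _).trans (le_of_eq ?_)
      rw [bern_insert he]
      have e1 : bern E p (fun F => (f (insert e (insert e F)) - f ((insert e F).erase e)) ^ 2)
          = bern E p (fun F => (f (insert e F) - f F) ^ 2) := by
        refine bern_congr fun F hF => ?_
        rw [Finset.insert_idem, Finset.erase_insert fun h => he (hF h)]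
      have e2 : bern E p (fun F => (f (insert e F) - f (F.erase e)) ^ 2)
          = bern E p (fun F => (f (insert e F) - f F) ^ 2) := by
        refine bern_congr fun F hF => ?_
        rw [Finset.erase_eq_of_notMem fun h => he (hF h)]
      rw [e1, e2]; ring
    have h4 : ∑ a ∈ E, bern (insert e E) p (fun F => (f (insert a F) - f (F.erase a)) ^ 2)
        = p * ∑ a ∈ E, bern E p (fun F => (f (insert e (insert a F)) - f (insert e (F.erase a))) ^ 2)
          + (1 - p) * ∑ a ∈ E, bern E p (fun F => (f (insert a F) - f (F.erase a)) ^ 2) := by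
      rw [Finset.mul_sum, Finset.mul_sum, ← Finset.sum_add_distrib]
      refine Finset.sum_congr rfl fun a ha => ?_
      rw [bern_insert he]
      have hae : a ≠ e := fun h => he (h ▸ ha)
      congr 2
      refine bern_congr fun F _ => ?_
      rw [Finset.insert_comm, Finset.erase_insert_of_ne hae.symm]
    have i1 := ih (fun F => f (insert e F))
    have i2 := ih f
    rw [h4]
    nlinarith [mul_le_mul_of_nonneg_left i1 h0, mul_le_mul_of_nonneg_left i2 (sub_nonneg.2 h1),
      mul_le_mul_of_nonneg_left h3 hnn]

lemma bern_chebyshev {E : Finset α} {p : ℝ} (h0 : 0 ≤ p) (h1 : p ≤ 1) (f : Finset α → ℝ)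
    {t : ℝ} (ht : 0 < t) :
    bern E p (fun F => ind (t ≤ |f F - bern E p f|)) ≤ bernVar E p f / t ^ 2 := by
  have h2 : bern E p (fun F => (f F - bern E p f) ^ 2) = bernVar E p f := by
    have : ∀ F, (f F - bern E p f) ^ 2 = f F ^ 2 - (2 * bern E p f) * f F + bern E p f ^ 2 :=
      fun F => by ring
    simp only [this]
    rw [bern_add, bern_sub, bern_mul_left, bern_const, bernVar]; ring
  rw [← h2]
  refine le_trans (bern_mono h0 h1 fun F _ => ?_)
    (bern_markov h0 h1 (fun F _ => sq_nonneg _) (by positivity))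
  refine ind_mono fun h => ?_
  rw [← sq_abs (f F - _)]
  exact pow_le_pow_left₀ ht.le h 2

/-- The probability that a binomial random variable with parameters `m` and `p` is at least `k`. -/
noncomputable def binTail (m : ℕ) (p : ℝ) (k : ℕ) : ℝ :=
  ∑ j ∈ Finset.range (m + 1), (m.choose j : ℝ) * (p ^ j * (1 - p) ^ (m - j) * ind (k ≤ j))

lemma bern_card_tail (E : Finset α) (p : ℝ) (k : ℕ) :
    bern E p (fun F => ind (k ≤ F.card)) = binTail E.card p k := by
  have := Finset.sum_powerset_apply_card
    (fun j => p ^ j * (1 - p) ^ (E.card - j) * ind (k ≤ j)) (x := E)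
  simp only [nsmul_eq_mul] at this
  rw [binTail, ← this]
  refine Finset.sum_congr rfl fun F hF => ?_
  rw [Finset.card_sdiff_of_subset (Finset.mem_powerset.1 hF)]

lemma binTail_nonneg {p : ℝ} (h0 : 0 ≤ p) (h1 : p ≤ 1) (m k : ℕ) : 0 ≤ binTail m p k := by
  rw [← Finset.card_range m, ← bern_card_tail]
  exact bern_nonneg h0 h1 fun _ _ => ind_nonneg _

lemma binTail_mono {p : ℝ} (h0 : 0 ≤ p) (h1 : p ≤ 1) {m m' : ℕ} (h : m ≤ m') (k : ℕ) :
    binTail m p k ≤ binTail m' p k := by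
  rw [← Finset.card_range m, ← Finset.card_range m', ← bern_card_tail, ← bern_card_tail,
    ← bern_inter (Finset.range_subset_range.2 h)]
  exact bern_mono h0 h1 fun F _ => ind_mono fun h => h.trans (Finset.card_le_card
    Finset.inter_subset_left)

lemma binTail_anti {p : ℝ} (h0 : 0 ≤ p) (h1 : p ≤ 1) (m : ℕ) {k k' : ℕ} (h : k ≤ k') :
    binTail m p k' ≤ binTail m p k := by
  rw [← Finset.card_range m, ← bern_card_tail, ← bern_card_tail]
  exact bern_mono h0 h1 fun F _ => ind_mono h.trans

/-- The cross-multiplied form of C(m-a, j) / C(m, j) ≤ (1 - a/m)^j. Factor by factor, (m - a - i)/(m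
- i) ≤ (m - a)/m; where the subtraction truncates, the left side is zero. -/
lemma choose_sub_mul_pow_le (m a j : ℕ) :
    (m - a).choose j * m ^ j ≤ m.choose j * (m - a) ^ j := by
  have key : (m - a).descFactorial j * m ^ j ≤ m.descFactorial j * (m - a) ^ j := by
    induction j with
    | zero => simp
    | succ j ih =>
      rw [Nat.descFactorial_succ, Nat.descFactorial_succ, pow_succ, pow_succ]
      have : (m - a - j) * m ≤ (m - j) * (m - a) := by
        rcases le_total m (a + j) with h | h
        · rw [show m - a - j = 0 by omega]; simp
        · obtain ⟨x, rfl⟩ := Nat.exists_eq_add_of_le h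
          rw [show a + j + x - a - j = x by omega, show a + j + x - j = a + x by omega,
            show a + j + x - a = j + x by omega]
          nlinarith [Nat.zero_le (a * j)]
      calc (m - a - j) * (m - a).descFactorial j * (m ^ j * m)
          = ((m - a).descFactorial j * m ^ j) * ((m - a - j) * m) := by ring
        _ ≤ (m.descFactorial j * (m - a) ^ j) * ((m - j) * (m - a)) := Nat.mul_le_mul ih this
        _ = _ := by ring
  rw [Nat.descFactorial_eq_factorial_mul_choose, Nat.descFactorial_eq_factorial_mul_choose,
    mul_assoc, mul_assoc] at key
  exact Nat.le_of_mul_le_mul_left key (Nat.factorial_pos j)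

/-- A set missing `A` has all its elements in `E \ A`, so the event splits into two independent
ones. The two bounds that follow keep the tail probability as a factor. -/
lemma bern_miss {E A : Finset α} (h : A ⊆ E) (p : ℝ) (k : ℕ) :
    bern E p (fun F => ind (k ≤ F.card ∧ F ∩ A = ∅)) =
      (1 - p) ^ A.card * binTail (E.card - A.card) p k := by
  have hE : bern E p (fun F => ind (k ≤ F.card ∧ F ∩ A = ∅)) =
      bern E p (fun F => ind (F ∩ A = ∅) * ind (k ≤ (F ∩ (E \ A)).card)) := by
    refine bern_congr fun F hF => ?_
    rw [← ind_and, and_comm]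
    congr 1
    refine propext (and_congr_right fun hA => ?_)
    have : F ∩ (E \ A) = F := by
      ext x; constructor
      · grind
      · intro hx
        have : x ∉ A := fun hxA => by
          have : x ∈ F ∩ A := Finset.mem_inter.2 ⟨hx, hxA⟩
          rw [hA] at this; simp at this
        simp [hx, this, hF hx]
    rw [this]
  rw [hE, bern_indep h Finset.sdiff_subset Finset.disjoint_sdiff p (fun F => ind (F = ∅))
    (fun F => ind (k ≤ F.card)), bern_card_tail, Finset.card_sdiff_of_subset h]
  congr 1
  have := bern_void h p
  rwa [bern_inter h p (fun F => ind (F = ∅))] at this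

lemma bern_miss_le_pow {E A : Finset α} (h : A ⊆ E) {p : ℝ} (h0 : 0 ≤ p) (h1 : p ≤ 1) (k : ℕ) :
    bern E p (fun F => ind (k ≤ F.card ∧ F ∩ A = ∅)) ≤
      (1 - p) ^ A.card * binTail E.card p k := by
  rw [bern_miss h]
  exact mul_le_mul_of_nonneg_left (binTail_mono h0 h1 (Nat.sub_le _ _) k)
    (pow_nonneg (by linarith) _)

/-- Given that a random set has at least `k` elements, it misses the set `A` with probability
at most `(1 - #A / #E) ^ k`. -/
lemma bern_miss_le_ratio {E A : Finset α} (h : A ⊆ E) {p : ℝ} (h0 : 0 ≤ p) (h1 : p ≤ 1)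
    {k : ℕ} {x : ℝ} (hx1 : x ≤ 1) (hx : x * E.card ≤ A.card) :
    bern E p (fun F => ind (k ≤ F.card ∧ F ∩ A = ∅)) ≤ (1 - x) ^ k * binTail E.card p k := by
  rw [bern_miss h, binTail, binTail, Finset.mul_sum, Finset.mul_sum]
  have hA := Finset.card_le_card h
  set m := E.card
  set a := A.card
  have hp1 : 0 ≤ 1 - p := by linarith
  -- For negative `x` the factor (1 - x)^k is at least 1, so the condition on `A` can simply be
  -- dropped.
  rcases lt_or_ge x 0 with hneg | hx0
  · have h1x : (1 : ℝ) ≤ (1 - x) ^ k := one_le_pow₀ (by linarith)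
    have := bern_mono h0 h1 (E := E) (f := fun F => ind (k ≤ F.card ∧ F ∩ A = ∅))
      (g := fun F => ind (k ≤ F.card)) fun F _ => ind_mono And.left
    rw [bern_miss h, bern_card_tail] at this
    rw [← Finset.mul_sum, ← Finset.mul_sum]
    calc _ ≤ binTail m p k := this
      _ = 1 * binTail m p k := (one_mul _).symm
      _ ≤ _ := by gcongr; exacts [binTail_nonneg h0 h1 _ _, le_of_eq rfl]
  have hsub : Finset.range (m - a + 1) ⊆ Finset.range (m + 1) :=
    Finset.range_subset_range.2 (by omega)
  refine le_trans (Finset.sum_le_sum fun j hj => ?_) (Finset.sum_le_sum_of_subset_of_nonneg hsub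
    fun j _ _ => ?_)
  · by_cases hkj : k ≤ j
    · rw [ind_true hkj, mul_one, mul_one]
      have hj' : j ≤ m - a := by simpa [Nat.lt_succ_iff] using hj
      have e : (1 - p) ^ a * (1 - p) ^ (m - a - j) = (1 - p) ^ (m - j) := by
        rw [← pow_add]; congr 1; omega
      -- Given that the set has exactly j elements it is uniform among the j-subsets, so this
      -- compares the chance of missing `A` with (1 - x)^j.
      have hc : ((m - a).choose j : ℝ) ≤ (1 - x) ^ j * m.choose j := by
        rcases Nat.eq_zero_or_pos m with hm | hm
        · have : j = 0 := by omega
          subst this; simp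
        have hm' : (0 : ℝ) < m := by exact_mod_cast hm
        have h3 : ((m - a).choose j : ℝ) * (m : ℝ) ^ j ≤ m.choose j * ((m - a : ℕ) : ℝ) ^ j := by
          exact_mod_cast choose_sub_mul_pow_le m a j
        have h4 : ((m - a : ℕ) : ℝ) ≤ (1 - x) * m := by
          rw [Nat.cast_sub hA]; nlinarith
        have h5 : ((m - a : ℕ) : ℝ) ^ j ≤ ((1 - x) * m) ^ j := by gcongr
        rw [mul_pow] at h5
        have h6 : ((m - a).choose j : ℝ) * (m : ℝ) ^ j ≤ ((1 - x) ^ j * m.choose j) * (m : ℝ) ^ j := by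
          nlinarith [mul_le_mul_of_nonneg_left h5 (Nat.cast_nonneg (α := ℝ) (m.choose j))]
        exact le_of_mul_le_mul_right h6 (by positivity)
      have hk : (1 - x) ^ j ≤ (1 - x) ^ k :=
        pow_le_pow_of_le_one (by linarith) (by linarith) hkj
      have hnn : 0 ≤ p ^ j * (1 - p) ^ (m - j) := by positivity
      calc (1 - p) ^ a * (((m - a).choose j : ℝ) * (p ^ j * (1 - p) ^ (m - a - j)))
          = ((m - a).choose j : ℝ) * (p ^ j * (1 - p) ^ (m - j)) := by rw [← e]; ring
        _ ≤ ((1 - x) ^ k * m.choose j) * (p ^ j * (1 - p) ^ (m - j)) := by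
          refine mul_le_mul_of_nonneg_right (hc.trans ?_) hnn
          gcongr
        _ = _ := by ring
    · simp [ind_false hkj]
  · have := ind_nonneg (k ≤ j)
    have : 0 ≤ 1 - x := by linarith
    positivity

/-- The expected number of pivotal elements for the event that `F` has at least `k` elements. -/
lemma sum_bern_pivotal_le {E : Finset α} {p : ℝ} (h0 : 0 ≤ p) (h1 : p ≤ 1) (k : ℕ) :
    p * ∑ e ∈ E, bern E p (fun F => ind ((F.erase e).card + 1 = k)) ≤ k * binTail E.card p k := by
  -- Being pivotal does not depend on `e` itself, so multiplying by p adds the condition that `e` is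
  -- chosen. Summing over `e` then counts each set of size exactly k with multiplicity k.
  have hstep : ∀ e ∈ E, p * bern E p (fun F => ind ((F.erase e).card + 1 = k)) =
      bern E p (fun F => ind (e ∈ F) * ind (F.card = k)) := by
    intro e he
    have hE : E = insert e (E.erase e) := (Finset.insert_erase he).symm
    have hne : e ∉ E.erase e := Finset.notMem_erase e E
    rw [hE, bern_insert hne, bern_insert hne]
    have a1 : bern (E.erase e) p (fun F => ind (((insert e F).erase e).card + 1 = k)) =
        bern (E.erase e) p (fun F => ind (F.card + 1 = k)) := bern_congr fun F hF => by
      rw [Finset.erase_insert fun h => hne (hF h)]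
    have a2 : bern (E.erase e) p (fun F => ind ((F.erase e).card + 1 = k)) =
        bern (E.erase e) p (fun F => ind (F.card + 1 = k)) := bern_congr fun F hF => by
      rw [Finset.erase_eq_of_notMem fun h => hne (hF h)]
    have a3 : bern (E.erase e) p (fun F => ind (e ∈ insert e F) * ind ((insert e F).card = k)) =
        bern (E.erase e) p (fun F => ind (F.card + 1 = k)) := bern_congr fun F hF => by
      rw [Finset.card_insert_of_notMem fun h => hne (hF h), ind_true (Finset.mem_insert_self e F),
        one_mul]
    have a4 : bern (E.erase e) p (fun F => ind (e ∈ F) * ind (F.card = k)) = 0 := by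
      rw [← bern_const (E.erase e) p 0]
      refine bern_congr fun F hF => ?_
      rw [ind_false fun h => hne (hF h), zero_mul]
    rw [a1, a2, a3, a4]; ring
  rw [Finset.mul_sum, Finset.sum_congr rfl hstep, ← bern_sum, ← bern_card_tail, ← bern_mul_left]
  refine bern_mono h0 h1 fun F hF => ?_
  rw [← Finset.sum_mul]
  have : ∑ e ∈ E, ind (e ∈ F) = F.card := by
    rw [← card_filter_eq_sum_ind]
    congr 2; ext x; simp only [Finset.mem_filter]
    exact ⟨And.right, fun h => ⟨hF h, h⟩⟩
  rw [this]
  by_cases h : F.card = k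
  · rw [ind_true h, ind_true h.ge, h]
  · rw [ind_false h, mul_zero]
    exact mul_nonneg (Nat.cast_nonneg _) (ind_nonneg _)

/-- The bridge from measures to finite sums: the random set is almost surely contained in `E`, so
the event reduces to a finite union of singletons. -/
lemma setBernoulli_real_eq_bern [Countable α] (E : Finset α) (p : I) (P : Set α → Prop) :
    (setBernoulli (E : Set α) p).real {s | P s} = bern E p (fun F => ind (P F)) := by
  classical
  have hfin : {s ∈ {s | P s} | s ⊆ (E : Set α)} =
      ⋃ F ∈ E.powerset.filter (fun F : Finset α => P (F : Set α)), {(F : Set α)} := by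
    ext s
    simp only [Set.mem_ofPred_eq, Set.mem_iUnion, Finset.mem_filter, Finset.mem_powerset,
      Set.mem_singleton_iff, exists_prop]
    constructor
    · rintro ⟨h1, h2⟩
      have hs : s.Finite := E.finite_toSet.subset h2
      refine ⟨hs.toFinset, ⟨?_, ?_⟩, ?_⟩
      · intro x hx; exact h2 (by simpa using hx)
      · simpa using h1
      · simp
    · rintro ⟨F, ⟨h1, h2⟩, rfl⟩
      exact ⟨h2, by exact_mod_cast h1⟩
  rw [measureReal_def, setBernoulli_apply_eq_apply_subsets, ← measureReal_def, hfin,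
    measureReal_biUnion_finset (by
      intro F _ F' _ h
      simpa [Function.onFun] using h) (by simp), bern, Finset.sum_filter]
  refine Finset.sum_congr rfl fun F hF => ?_
  have hF' := Finset.mem_powerset.1 hF
  rw [setBernoulli_real_singleton p (by exact_mod_cast hF') E.finite_toSet]
  rw [← Finset.coe_sdiff, Set.ncard_coe_finset, Set.ncard_coe_finset]
  by_cases h : P F <;> simp [ind, h]

end Bernoulli

lemma binomial_real_tail (m : ℕ) (p : I) (k : ℝ) :
    (binomial m p).real {j : ℕ | k ≤ (j : ℝ)} = binTail m p ⌈k⌉₊ := by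
  have h1 : {j : ℕ | k ≤ (j : ℝ)} = {j : ℕ | ⌈k⌉₊ ≤ j} := by
    ext j; simp [Nat.ceil_le]
  have h2 : (binomial m p).real {j : ℕ | ⌈k⌉₊ ≤ j} =
      (setBernoulli (Finset.range m : Set ℕ) p).real {s | ⌈k⌉₊ ≤ s.ncard} := by
    rw [binomial, measureReal_def, measureReal_def, Measure.map_apply (by fun_prop) .of_discrete]
    congr 2
    simp
  rw [h1, h2, setBernoulli_real_eq_bern (Finset.range m) p (fun s => ⌈k⌉₊ ≤ s.ncard)]
  conv_rhs => rw [← Finset.card_range m, ← bern_card_tail]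
  exact bern_congr fun F _ => by rw [Set.ncard_coe_finset]


/-! ### Degree-preserving switchings and the attachment lemma. -/

section Switching

variable {V : Type*} [Fintype V] [DecidableEq V]

/-- The neighbours of `v` as a finset. -/
noncomputable def nbr (G : SimpleGraph V) (v : V) : Finset V := by
  classical exact Finset.univ.filter (G.Adj v)

/-- The edges of `G` as a finset. -/
noncomputable def edges (G : SimpleGraph V) : Finset (Sym2 V) := by
  classical exact Finset.univ.filter (· ∈ G.edgeSet)

@[simp] lemma mem_nbr {G : SimpleGraph V} {v u : V} : u ∈ nbr G v ↔ G.Adj v u := by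
  simp [nbr]

@[simp] lemma mem_edges {G : SimpleGraph V} {e : Sym2 V} : e ∈ edges G ↔ e ∈ G.edgeSet := by
  simp [edges]

lemma coe_edges (G : SimpleGraph V) : (edges G : Set (Sym2 V)) = G.edgeSet := by
  ext; simp

lemma ncard_neighborSet (G : SimpleGraph V) (v : V) :
    (G.neighborSet v).ncard = (nbr G v).card := by
  rw [← Set.ncard_coe_finset]; congr 1; ext; simp

/-- The switching that replaces the edges `ab`, `cd` by `ad`, `cb`. -/
def sw (G : SimpleGraph V) (a b c d : V) : SimpleGraph V where
  Adj x y := (G.Adj x y ∧ s(x, y) ≠ s(a, b) ∧ s(x, y) ≠ s(c, d)) ∨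
    (x ≠ y ∧ (s(x, y) = s(a, d) ∨ s(x, y) = s(c, b)))
  symm := ⟨by
    intro x y h
    rw [Sym2.eq_swap (a := y), G.adj_comm y x, ne_comm (a := y)]; exact h⟩
  loopless := ⟨by intro x h; simp at h⟩

/-- The switching `sw G a b c d` produces a simple graph with the same degrees. -/
def SwOK (G : SimpleGraph V) (a b c d : V) : Prop :=
  G.Adj a b ∧ G.Adj c d ∧ ¬ G.Adj a d ∧ ¬ G.Adj c b ∧ a ≠ d ∧ c ≠ b

lemma SwOK.swap {G : SimpleGraph V} {a b c d : V} (h : SwOK G a b c d) : SwOK G c d a b := by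
  obtain ⟨h1, h2, h3, h4, h5, h6⟩ := h
  exact ⟨h2, h1, h4, h3, h6, h5⟩

lemma SwOK.flip {G : SimpleGraph V} {a b c d : V} (h : SwOK G a b c d) : SwOK G b a d c := by
  obtain ⟨h1, h2, h3, h4, h5, h6⟩ := h
  exact ⟨h1.symm, h2.symm, fun h => h4 h.symm, fun h => h3 h.symm, h6.symm, h5.symm⟩

lemma sw_swap (G : SimpleGraph V) (a b c d : V) : sw G a b c d = sw G c d a b := by
  ext x y; simp only [sw]; tauto

lemma sw_flip (G : SimpleGraph V) (a b c d : V) : sw G a b c d = sw G b a d c := by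
  ext x y
  simp only [sw]
  rw [Sym2.eq_swap (a := b) (b := a), Sym2.eq_swap (a := d) (b := c),
    Sym2.eq_swap (a := b) (b := c), Sym2.eq_swap (a := d) (b := a)]
  tauto

/-- One vertex suffices, because `sw_swap` and `sw_flip` bring each of the four into the first
position. -/
lemma nbr_sw_fst {G : SimpleGraph V} {a b c d : V} (h : SwOK G a b c d) :
    nbr (sw G a b c d) a = insert d ((nbr G a).erase b) := by
  obtain ⟨h1, h2, h3, h4, h5, h6⟩ := h
  have hac : a ≠ c := fun h => h3 (h ▸ h2)
  ext x
  simp only [mem_nbr, sw, Finset.mem_insert, Finset.mem_erase, Sym2.eq_iff, ne_eq]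
  have := h1.ne
  grind

lemma nbr_sw_of_ne {G : SimpleGraph V} {a b c d x : V} (ha : x ≠ a) (hb : x ≠ b) (hc : x ≠ c)
    (hd : x ≠ d) : nbr (sw G a b c d) x = nbr G x := by
  ext y
  simp only [mem_nbr, sw, Sym2.eq_iff, ne_eq]
  grind

lemma card_nbr_sw {G : SimpleGraph V} {a b c d : V} (h : SwOK G a b c d) (x : V) :
    (nbr (sw G a b c d) x).card = (nbr G x).card := by
  have key : ∀ {a b c d : V}, SwOK G a b c d → (nbr (sw G a b c d) a).card = (nbr G a).card := by
    intro a b c d h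
    rw [nbr_sw_fst h, Finset.card_insert_of_notMem (by simp [h.2.2.1]),
      Finset.card_erase_add_one (by simp [h.1])]
  by_cases ha : x = a
  · subst ha; exact key h
  by_cases hb : x = b
  · subst hb; rw [sw_flip]; exact key h.flip
  by_cases hc : x = c
  · subst hc; rw [sw_swap]; exact key h.swap
  by_cases hd : x = d
  · subst hd; rw [sw_swap, sw_flip]; exact key h.swap.flip
  · rw [nbr_sw_of_ne ha hb hc hd]

/-- Switchings are reversible from the image and the four vertices alone. This supplies the
injectivity required by the double counts. -/
lemma sw_sw {G : SimpleGraph V} {a b c d : V} (h : SwOK G a b c d) :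
    sw (sw G a b c d) a d c b = G := by
  obtain ⟨h1, h2, h3, h4, h5, h6⟩ := h
  have h1' := h1.symm
  have h2' := h2.symm
  have := h1.ne
  have := h2.ne
  have h3' : ¬ G.Adj d a := fun h => h3 h.symm
  have h4' : ¬ G.Adj b c := fun h => h4 h.symm
  ext x y
  by_cases hxy : x = y
  · subst hxy; simp
  simp only [sw, Sym2.eq_iff, ne_eq]
  grind

/-- Exposed edges survive a switching of unexposed ones, so switchings remain available after
conditioning on a subgraph `R`. -/
lemma le_sw {R G : SimpleGraph V} {a b c d : V} (hR : R ≤ G) (h1 : ¬ R.Adj a b)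
    (h2 : ¬ R.Adj c d) : R ≤ sw G a b c d := by
  intro x y hxy
  left
  refine ⟨hR hxy, ?_, ?_⟩
  · intro h
    rw [Sym2.eq_iff] at h
    rcases h with ⟨rfl, rfl⟩ | ⟨rfl, rfl⟩
    exacts [h1 hxy, h1 hxy.symm]
  · intro h
    rw [Sym2.eq_iff] at h
    rcases h with ⟨rfl, rfl⟩ | ⟨rfl, rfl⟩
    exacts [h2 hxy, h2 hxy.symm]

/-- Double counting: if every element of `B` has at least `a` images in `Ω` and every element of
`Ω` arises at most `b` times then `#B * a ≤ #Ω * b`. -/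
lemma card_mul_le_of_switch {ι τ : Type*} [DecidableEq τ] {B Ω : Finset ι}
    (f : ι → τ → ι) (t t' : ι → Finset τ) {a b : ℝ} (hb : 0 ≤ b)
    (ha : ∀ G ∈ B, a ≤ (t G).card)
    (hΩ : ∀ G ∈ B, ∀ x ∈ t G, f G x ∈ Ω)
    (ht' : ∀ G ∈ B, ∀ x ∈ t G, x ∈ t' (f G x))
    (hcard : ∀ G ∈ B, ∀ x ∈ t G, ((t' (f G x)).card : ℝ) ≤ b)
    (hinj : ∀ G ∈ B, ∀ G' ∈ B, ∀ x, x ∈ t G → x ∈ t G' → f G x = f G' x → G = G') :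
    (B.card : ℝ) * a ≤ Ω.card * b := by
  classical
  have h1 : (B.card : ℝ) * a ≤ ((B.sigma t).card : ℝ) := by
    rw [Finset.card_sigma]; push_cast
    rw [← nsmul_eq_mul]
    exact Finset.card_nsmul_le_sum _ _ _ ha
  -- The bound `b` is known only for graphs that arise from a switching; the others are discarded
  -- before summing.
  let Ω' := Ω.filter fun G => ((t' G).card : ℝ) ≤ b
  have h2 : (B.sigma t).card ≤ (Ω'.sigma t').card := by
    refine Finset.card_le_card_of_injOn (fun y => ⟨f y.1 y.2, y.2⟩) ?_ ?_
    · rintro ⟨G, x⟩ h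
      simp only [Finset.coe_sigma, Set.mem_sigma_iff, Finset.mem_coe] at h
      simp only [Finset.coe_sigma, Set.mem_sigma_iff, Finset.mem_coe, Ω', Finset.mem_filter]
      exact ⟨⟨hΩ G h.1 x h.2, hcard G h.1 x h.2⟩, ht' G h.1 x h.2⟩
    · rintro ⟨G, x⟩ h ⟨G', x'⟩ h' he
      simp only [Finset.coe_sigma, Set.mem_sigma_iff, Finset.mem_coe] at h h'
      simp only [Sigma.mk.injEq, heq_eq_eq] at he
      obtain ⟨he, rfl⟩ := he
      rw [hinj G h.1 G' h'.1 x h.2 h'.2 he]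
  have h3 : ((Ω'.sigma t').card : ℝ) ≤ Ω'.card * b := by
    rw [Finset.card_sigma]; push_cast
    rw [← nsmul_eq_mul]
    exact Finset.sum_le_card_nsmul _ _ _ fun G hG => (Finset.mem_filter.1 hG).2
  have h4 : (Ω'.card : ℝ) * b ≤ Ω.card * b := by
    gcongr; exact Finset.filter_subset _ _
  have h2' : ((B.sigma t).card : ℝ) ≤ (Ω'.sigma t').card := by exact_mod_cast h2
  linarith

/-- A family of graphs containing `R` that is closed under degree-preserving switchings of edges
outside `R`. -/
def SwClosed (R : SimpleGraph V) (Ω : Finset (SimpleGraph V)) : Prop :=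
  (∀ G ∈ Ω, R ≤ G) ∧ ∀ G ∈ Ω, ∀ a b c d, SwOK G a b c d → ¬ R.Adj a b → ¬ R.Adj c d →
    sw G a b c d ∈ Ω

/-- The ordered pairs of vertices of `C` that are adjacent in `G`. -/
noncomputable def arcs (G : SimpleGraph V) (C D : Finset V) : Finset (V × V) := by
  classical exact (C ×ˢ D).filter fun x => G.Adj x.1 x.2

@[simp] lemma mem_arcs {G : SimpleGraph V} {C D : Finset V} {x : V × V} :
    x ∈ arcs G C D ↔ (x.1 ∈ C ∧ x.2 ∈ D) ∧ G.Adj x.1 x.2 := by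
  simp [arcs]

lemma card_arcs (G : SimpleGraph V) (C D : Finset V) :
    (arcs G C D).card = ∑ x ∈ C, (nbr G x ∩ D).card := by
  classical
  have : arcs G C D = (C.sigma fun x => nbr G x ∩ D).map (Equiv.sigmaEquivProd V V).toEmbedding := by
    ext ⟨x, y⟩
    simp only [mem_arcs, Finset.mem_map_equiv, Finset.mem_sigma, Finset.mem_inter, mem_nbr]
    simp [Equiv.sigmaEquivProd]
    tauto
  rw [this, Finset.card_map, Finset.card_sigma]

/-- At least a quarter of the arcs inside `C` can be switched with the edge `vz`. -/
lemma card_switchable {G H : SimpleGraph V} {v z : V} {C : Finset V} {ℓ q : ℕ} {β : ℝ}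
    (hI : (nbr G v ∩ C).card < ℓ) (hq : (nbr G z ∩ C).card ≤ q)
    (hβ : β ≤ (arcs H C C).card) (hIβ : (ℓ * C.card : ℝ) ≤ β / 8) (hqβ : (q : ℝ) ^ 2 ≤ β / 4)
    (t : Finset (V × V))
    (ht : ∀ x ∈ arcs H C C, x.1 ≠ v → ¬ G.Adj v x.1 → ¬ G.Adj z x.2 → x ∈ t) :
    β / 4 ≤ t.card := by
  classical
  set O := arcs H C C
  set B := O.filter fun x => x.1 = v ∨ G.Adj v x.1
  set A := O.filter fun x => G.Adj z x.2
  set A' := O.filter fun x => G.Adj z x.1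
  have hB : B.card ≤ ℓ * C.card := by
    have : B ⊆ (insert v (nbr G v ∩ C)) ×ˢ C := by
      intro x hx
      simp only [B, O, Finset.mem_filter, mem_arcs] at hx
      simp only [Finset.mem_product, Finset.mem_insert, Finset.mem_inter, mem_nbr]
      tauto
    refine (Finset.card_le_card this).trans ?_
    rw [Finset.card_product]
    gcongr
    exact (Finset.card_insert_le _ _).trans hI
  -- Reversing arcs shows that as many arcs have their head adjacent to `z` as their tail. Both
  -- happen for at most q² arcs, so `A` has at most (#O + q²)/2 elements. Thus about half of the
  -- arcs survive even if `z` is adjacent to many endpoints.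
  have hAA' : A.card = A'.card := by
    refine Finset.card_bij (fun x _ => x.swap) ?_ ?_ ?_
    · rintro ⟨x, y⟩ h
      simp only [A, A', O, Finset.mem_filter, mem_arcs, Prod.swap_prod_mk] at h ⊢
      exact ⟨⟨⟨h.1.1.2, h.1.1.1⟩, h.1.2.symm⟩, h.2⟩
    · intro x _ y _ h; exact Prod.swap_injective h
    · rintro ⟨x, y⟩ h
      refine ⟨(y, x), ?_, rfl⟩
      simp only [A, A', O, Finset.mem_filter, mem_arcs] at h ⊢
      exact ⟨⟨⟨h.1.1.2, h.1.1.1⟩, h.1.2.symm⟩, h.2⟩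
  have hinter : (A ∩ A').card ≤ q ^ 2 := by
    have : A ∩ A' ⊆ (nbr G z ∩ C) ×ˢ (nbr G z ∩ C) := by
      intro x hx
      simp only [A, A', O, Finset.mem_filter, mem_arcs, Finset.mem_inter] at hx
      simp only [Finset.mem_product, Finset.mem_inter, mem_nbr]
      tauto
    refine (Finset.card_le_card this).trans ?_
    rw [Finset.card_product, sq]
    gcongr
  have hunion : (A ∪ A').card ≤ O.card :=
    Finset.card_le_card (Finset.union_subset (Finset.filter_subset _ _) (Finset.filter_subset _ _))
  have hsum := Finset.card_union_add_card_inter A A'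
  have ht' : O ⊆ t ∪ (B ∪ A) := by
    intro x hx
    simp only [Finset.mem_union, B, A, Finset.mem_filter]
    have := ht x hx
    tauto
  have h1 := (Finset.card_le_card ht').trans
    ((Finset.card_union_le _ _).trans (Nat.add_le_add_left (Finset.card_union_le _ _) _))
  have e1 : (O.card : ℝ) ≤ t.card + (B.card + A.card) := by exact_mod_cast h1
  have e2 : 2 * (A.card : ℝ) ≤ O.card + q ^ 2 := by
    have : 2 * A.card ≤ O.card + q ^ 2 := by omega
    exact_mod_cast this
  have e3 : (B.card : ℝ) ≤ ℓ * C.card := by exact_mod_cast hB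
  linarith

/-- The attachment lemma: in a family of graphs closed under switchings, few graphs have a vertex
`v` with fewer than `ℓ` neighbours in `C`, provided that `C` spans many edges and that `v` has many
neighbours outside `C` which themselves have at most `q` neighbours in `C`. -/
lemma attachment {R : SimpleGraph V} {Ω B : Finset (SimpleGraph V)} (hΩ : SwClosed R Ω)
    (hB : B ⊆ Ω) {v : V} {C : Finset V} {ℓ q : ℕ} {K β M : ℝ} (hM0 : 0 ≤ M)
    (hM : ∀ G ∈ Ω, (∑ x, (nbr G x).card : ℝ) ≤ M)
    (hI : ∀ G ∈ B, (nbr G v ∩ C).card < ℓ)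
    (hK : ∀ G ∈ B, ∃ Z : Finset V, K ≤ Z.card ∧ ∀ z ∈ Z, G.Adj v z ∧ ¬ R.Adj v z ∧ z ∉ C ∧
      (nbr G z ∩ C).card ≤ q)
    (hβ : ∀ G ∈ B, β ≤ (arcs (G \ R) C C).card)
    (hβ0 : 0 ≤ β)
    (hIβ : (ℓ * C.card : ℝ) ≤ β / 8) (hqβ : (q : ℝ) ^ 2 ≤ β / 4) :
    (B.card : ℝ) * (K * (β / 4)) ≤ Ω.card * (ℓ * M) := by
  classical
  let t : SimpleGraph V → Finset (V × V × V) := fun G =>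
    Finset.univ.filter fun x => (G.Adj v x.1 ∧ ¬ R.Adj v x.1 ∧ x.1 ∉ C ∧ (nbr G x.1 ∩ C).card ≤ q) ∧
      x.2 ∈ arcs (G \ R) C C ∧ x.2.1 ≠ v ∧ ¬ G.Adj v x.2.1 ∧ ¬ G.Adj x.1 x.2.2
  -- A switching replaces vz and wu by vu and wz. To undo it one chooses u among the neighbours of
  -- `v` in `C`, at most ℓ after the switching, and an ordered adjacent pair (z, w), at most M. This
  -- is the factor ℓM.
  let t' : SimpleGraph V → Finset (V × V × V) := fun G =>
    Finset.univ.filter fun x => x.2.1 ∈ nbr G v ∩ C ∧ G.Adj x.1 x.2.2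
  let f : SimpleGraph V → V × V × V → SimpleGraph V := fun G x => sw G v x.1 x.2.2 x.2.1
  have hok : ∀ G ∈ B, ∀ x ∈ t G, SwOK G v x.1 x.2.2 x.2.1 := by
    rintro G hG ⟨z, u, w⟩ hx
    simp only [t, Finset.mem_filter, mem_arcs, SimpleGraph.sdiff_adj] at hx
    obtain ⟨-, ⟨h1, h2, h3, h4⟩, ⟨⟨h5, h5'⟩, h6, h6'⟩, h7, h8, h9⟩ := hx
    exact ⟨h1, h6.symm, h8, fun h => h9 h.symm, h7.symm, fun h => h3 ((show w = z from h) ▸ h5')⟩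
  refine card_mul_le_of_switch (B := B) (Ω := Ω) f t t' (by positivity) ?_ ?_ ?_ ?_ ?_
  · intro G hG
    obtain ⟨Z, hZ, hZ'⟩ := hK G hG
    have hsub : (Z.sigma fun z => (Finset.univ.filter fun y : V × V => (z, y) ∈ t G)).card
        ≤ (t G).card := by
      refine Finset.card_le_card_of_injOn (fun x => (x.1, x.2)) ?_ ?_
      · rintro ⟨z, y⟩ h
        simp only [Finset.coe_sigma, Set.mem_sigma_iff, Finset.mem_coe, Finset.mem_filter] at h
        exact h.2.2
      · rintro ⟨z, y⟩ _ ⟨z', y'⟩ _ h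
        simp only [Prod.mk.injEq] at h
        obtain ⟨rfl, rfl⟩ := h; rfl
    have hge : ∀ z ∈ Z, β / 4 ≤
        ((Finset.univ.filter fun y : V × V => (z, y) ∈ t G).card : ℝ) := by
      intro z hz
      refine card_switchable (hI G hG) (hZ' z hz).2.2.2 (hβ G hG) hIβ hqβ _ ?_
      intro x hx h1 h2 h3
      simp only [t, Finset.mem_filter, Finset.mem_univ, true_and]
      exact ⟨hZ' z hz, hx, h1, h2, h3⟩
    calc K * (β / 4) ≤ Z.card * (β / 4) := by gcongr
      _ ≤ ∑ z ∈ Z, ((Finset.univ.filter fun y : V × V => (z, y) ∈ t G).card : ℝ) := by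
        rw [← nsmul_eq_mul]; exact Finset.card_nsmul_le_sum _ _ _ hge
      _ ≤ (t G).card := by
        rw [Finset.card_sigma] at hsub
        exact_mod_cast hsub
  · intro G hG x hx
    have hx' := hx
    simp only [t, Finset.mem_filter, mem_arcs, SimpleGraph.sdiff_adj] at hx
    exact hΩ.2 G (hB hG) _ _ _ _ (hok G hG x hx') hx.2.1.2.1 fun h => hx.2.2.1.2.2 h.symm
  · intro G hG x hx
    have hx' := hok G hG x hx
    simp only [t, Finset.mem_filter, mem_arcs, SimpleGraph.sdiff_adj] at hx
    simp only [t', f, Finset.mem_filter, Finset.mem_univ, true_and, Finset.mem_inter, mem_nbr]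
    refine ⟨⟨?_, hx.2.2.1.1.1⟩, ?_⟩
    · exact Or.inr ⟨hx'.2.2.2.2.1, Or.inl rfl⟩
    · exact Or.inr ⟨hx'.2.2.2.2.2.symm, Or.inr Sym2.eq_swap⟩
  · intro G hG x hx
    have hx' := hok G hG x hx
    have hfΩ : f G x ∈ Ω := by
      have hx2 := hx
      simp only [t, Finset.mem_filter, mem_arcs, SimpleGraph.sdiff_adj] at hx2
      exact hΩ.2 G (hB hG) _ _ _ _ hx' hx2.2.1.2.1 fun h => hx2.2.2.1.2.2 h.symm
    have hnb : (nbr (f G x) v ∩ C).card ≤ ℓ := by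
      have : nbr (f G x) v ∩ C ⊆ insert x.2.1 (nbr G v ∩ C) := by
        intro y hy
        simp only [f, nbr_sw_fst hx', Finset.mem_inter, Finset.mem_insert, Finset.mem_erase] at hy
        simp only [Finset.mem_insert, Finset.mem_inter]
        tauto
      exact (Finset.card_le_card this).trans ((Finset.card_insert_le _ _).trans (hI G hG))
    have hsub : (t' (f G x)).card ≤
        ((nbr (f G x) v ∩ C) ×ˢ arcs (f G x) Finset.univ Finset.univ).card := by
      refine Finset.card_le_card_of_injOn (fun x => (x.2.1, x.1, x.2.2)) ?_ ?_
      · rintro ⟨z, u, w⟩ h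
        simp only [t', Finset.coe_filter, Finset.mem_univ, true_and, Set.mem_ofPred_eq] at h
        simp only [Finset.coe_product, Set.mem_prod, Finset.mem_coe, mem_arcs, Finset.mem_univ,
          true_and]
        exact h
      · rintro ⟨z, u, w⟩ _ ⟨z', u', w'⟩ _ h
        simp only [Prod.mk.injEq] at h ⊢
        tauto
    have hc : ((arcs (f G x) Finset.univ Finset.univ).card : ℝ) ≤ M := by
      rw [card_arcs]
      simpa using hM _ hfΩ
    calc ((t' (f G x)).card : ℝ)
        ≤ ((nbr (f G x) v ∩ C).card : ℝ) * (arcs (f G x) Finset.univ Finset.univ).card := by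
          rw [Finset.card_product] at hsub
          exact_mod_cast hsub
      _ ≤ ℓ * M := by gcongr
  · intro G hG G' hG' x hx hx' he
    rw [← sw_sw (hok G hG x hx), ← sw_sw (hok G' hG' x hx')]
    simp only [f] at he
    rw [he]

end Switching


/-! ### Expansion: balanced cuts of the core are not sparse. -/

section Cuts

variable {V : Type*} [Fintype V] [DecidableEq V]

/-- Each of the four vertices trades one neighbour in `S` for another. Hence cut switchings preserve
`MostlyDense`. -/
lemma card_nbr_inter_sw {G : SimpleGraph V} {a b c d : V} (h : SwOK G a b c d) {S : Finset V}
    (ha : a ∈ S) (hb : b ∈ S) (hc : c ∈ S) (hd : d ∈ S) (x : V) :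
    (nbr (sw G a b c d) x ∩ S).card = (nbr G x ∩ S).card := by
  have key : ∀ {a b c d : V}, SwOK G a b c d → b ∈ S → d ∈ S →
      (nbr (sw G a b c d) a ∩ S).card = (nbr G a ∩ S).card := by
    intro a b c d h hb hd
    rw [nbr_sw_fst h, Finset.insert_inter_of_mem hd, Finset.erase_inter,
      Finset.card_insert_of_notMem (by simp [h.2.2.1]),
      Finset.card_erase_add_one (by simp [h.1, hb])]
  by_cases ha' : x = a
  · subst ha'; exact key h hb hd
  by_cases hb' : x = b
  · subst hb'; rw [sw_flip]; exact key h.flip ha hc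
  by_cases hc' : x = c
  · subst hc'; rw [sw_swap]; exact key h.swap hd hb
  by_cases hd' : x = d
  · subst hd'; rw [sw_swap, sw_flip]; exact key h.swap.flip hc ha
  · rw [nbr_sw_of_ne ha' hb' hc' hd']

lemma card_arcs_comm (G : SimpleGraph V) (A B : Finset V) :
    (arcs G A B).card = (arcs G B A).card := by
  refine Finset.card_bij (fun x _ => x.swap) ?_ ?_ ?_
  · rintro ⟨x, y⟩ h
    simp only [mem_arcs, Prod.swap_prod_mk] at h ⊢
    exact ⟨h.1.symm, h.2.symm⟩
  · intro x _ y _ h; exact Prod.swap_injective h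
  · rintro ⟨x, y⟩ h
    refine ⟨(y, x), ?_, rfl⟩
    simp only [mem_arcs] at h ⊢
    exact ⟨h.1.symm, h.2.symm⟩

/-- All but a small proportion of the vertices of `S` have at least `r` neighbours in `S`. -/
def MostlyDense (G : SimpleGraph V) (S : Finset V) (r : ℕ) : Prop :=
  ∃ L ⊆ S, 32 * L.card ≤ S.card ∧ ∀ a ∈ S, a ∉ L → r ≤ (nbr G a ∩ S).card

lemma card_heavy_mul_le (G : SimpleGraph V) (A B : Finset V) (H : Finset V) (hH : H ⊆ A) {c : ℕ}
    (hc : ∀ u ∈ H, c ≤ (nbr G u ∩ B).card) : H.card * c ≤ (arcs G A B).card := by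
  rw [card_arcs]
  calc H.card * c ≤ ∑ u ∈ H, (nbr G u ∩ B).card := by
        rw [← smul_eq_mul]; exact Finset.card_nsmul_le_sum _ _ _ hc
    _ ≤ _ := Finset.sum_le_sum_of_subset hH

/-- In a sparse cut `(A, B)` of `S`, many vertices of `A` have many neighbours in `A` that are
adjacent to few vertices of `B`. -/
lemma exists_good_vertices {G : SimpleGraph V} {S A B : Finset V} {r k : ℕ} (hS : A ∪ B = S)
    (hQ : MostlyDense G S r) (hA : S.card ≤ 8 * A.card)
    (hB : S.card ≤ 8 * B.card) (hm : 0 < S.card) (hk : 4096 * k ≤ r * S.card)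
    (hcut : (arcs G A B).card < 4 * k) :
    ∃ A' ⊆ A, A.card ≤ 2 * A'.card ∧ ∃ F : V → Finset V, ∀ u ∈ A', F u ⊆ A ∧
      (F u).card = (r + 1) / 2 ∧ ∀ v ∈ F u, G.Adj u v ∧ 16 * (nbr G v ∩ B).card < B.card := by
  classical
  obtain ⟨L, hLS, hL, hLr⟩ := hQ
  have hr : 0 < r := by
    rcases Nat.eq_zero_or_pos r with h | h
    · subst h; omega
    · exact h
  set m := S.card
  -- `H` is to be avoided by the second endpoints and `W` by the first. Counting the fewer than 4k
  -- cut edges gives #H ≤ r/8 and #W ≤ #S/128. A vertex of `A` outside `L` and `W` loses fewer than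
  -- r/8 neighbours to `B` and at most r/8 to `H`, so at least half of its r neighbours remain.
  set H := A.filter fun u => B.card ≤ 16 * (nbr G u ∩ B).card
  set W := A.filter fun u => r ≤ 8 * (nbr G u ∩ B).card
  have hH : 8 * H.card ≤ r := by
    have h1 : H.card * B.card ≤ 16 * (arcs G A B).card := by
      rw [card_arcs, Finset.mul_sum, ← smul_eq_mul]
      refine (Finset.card_nsmul_le_sum H (fun u => 16 * (nbr G u ∩ B).card) _ fun u hu =>
        (Finset.mem_filter.1 hu).2).trans (Finset.sum_le_sum_of_subset (Finset.filter_subset _ _))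
    have h2 : H.card * m ≤ 512 * k := by
      calc H.card * m ≤ H.card * (8 * B.card) := Nat.mul_le_mul_left _ hB
        _ = 8 * (H.card * B.card) := by ring
        _ ≤ 8 * (16 * (4 * k)) := by omega
        _ = 512 * k := by ring
    have h3 : 8 * H.card * m ≤ r * m := by
      calc 8 * H.card * m = 8 * (H.card * m) := by ring
        _ ≤ 8 * (512 * k) := by omega
        _ ≤ r * m := by omega
    exact Nat.le_of_mul_le_mul_right h3 hm
  have hW : 128 * W.card ≤ m := by
    have h1 : W.card * r ≤ 8 * (arcs G A B).card := by
      rw [card_arcs, Finset.mul_sum, ← smul_eq_mul]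
      refine (Finset.card_nsmul_le_sum W (fun u => 8 * (nbr G u ∩ B).card) _ fun u hu =>
        (Finset.mem_filter.1 hu).2).trans (Finset.sum_le_sum_of_subset (Finset.filter_subset _ _))
    have h3 : r * (128 * W.card) ≤ r * m := by
      calc r * (128 * W.card) = 128 * (W.card * r) := by ring
        _ ≤ 128 * (8 * (4 * k)) := by omega
        _ = 4096 * k := by ring
        _ ≤ r * m := hk
    exact Nat.le_of_mul_le_mul_left h3 hr
  have hsplit : ∀ u, (nbr G u ∩ S).card ≤ (nbr G u ∩ A).card + (nbr G u ∩ B).card := by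
    intro u
    rw [← hS, Finset.inter_union_distrib_left]
    exact Finset.card_union_le _ _
  have hgood : ∀ u ∈ (A \ L) \ W, (r + 1) / 2 ≤ ((nbr G u ∩ A) \ H).card := by
    intro u hu
    simp only [Finset.mem_sdiff, W, Finset.mem_filter, not_and, not_le] at hu
    have h1 := hLr u (by rw [← hS]; exact Finset.mem_union_left _ hu.1.1) hu.1.2
    have h2 := hu.2 hu.1.1
    have h3 := hsplit u
    have h4 := Finset.le_card_sdiff H (nbr G u ∩ A)
    omega
  have hex : ∀ u ∈ (A \ L) \ W, ∃ F ⊆ (nbr G u ∩ A) \ H, F.card = (r + 1) / 2 :=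
    fun u hu => Finset.exists_subset_card_eq (hgood u hu)
  choose! F hF using hex
  refine ⟨(A \ L) \ W, Finset.sdiff_subset.trans Finset.sdiff_subset, ?_, F, ?_⟩
  · have h1 := Finset.le_card_sdiff L A
    have h2 := Finset.le_card_sdiff W (A \ L)
    omega
  · intro u hu
    obtain ⟨h1, h2⟩ := hF u hu
    refine ⟨fun v hv => ?_, h2, fun v hv => ?_⟩
    · have := h1 hv
      simp only [Finset.mem_sdiff, Finset.mem_inter] at this
      exact this.1.2
    · have := h1 hv
      simp only [Finset.mem_sdiff, Finset.mem_inter, mem_nbr, H, Finset.mem_filter, not_and,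
        not_le] at this
      exact ⟨this.1.1, this.2 this.1.2⟩

/-- The quadruples `(u, v, c, d)` that can be switched to increase the size of the cut `(A, B)`. -/
noncomputable def cutSwitches (G : SimpleGraph V) (A B : Finset V) :
    Finset ((V × V) × (V × V)) := by
  classical
  exact Finset.univ.filter fun x => (x.1.1 ∈ A ∧ x.1.2 ∈ A ∧ x.2.1 ∈ B ∧ x.2.2 ∈ B) ∧
    G.Adj x.1.1 x.1.2 ∧ G.Adj x.2.1 x.2.2 ∧ ¬ G.Adj x.1.1 x.2.2 ∧ ¬ G.Adj x.2.1 x.1.2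

/-- Pair an arc u → v inside `A` with an arc c → d inside `B`, both from `exists_good_vertices`. The
only obstructions are the adjacencies ud and cv, and these are rare because d has few neighbours in
`A` and v has few in `B`. -/
lemma card_cutSwitches {G : SimpleGraph V} {S A B : Finset V} {r k : ℕ} (hS : A ∪ B = S)
    (hQ : MostlyDense G S r) (hA : S.card ≤ 8 * A.card)
    (hB : S.card ≤ 8 * B.card) (hm : 0 < S.card) (hk : 4096 * k ≤ r * S.card)
    (hcut : (arcs G A B).card < 4 * k) :
    (32 * k ^ 2 : ℝ) ≤ (cutSwitches G A B).card := by
  classical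
  obtain ⟨A', hA'A, hA', F, hF⟩ := exists_good_vertices hS hQ hA hB hm hk hcut
  obtain ⟨B', hB'B, hB', E, hE⟩ := exists_good_vertices (G := G) (A := B) (B := A)
    (by rw [Finset.union_comm]; exact hS) hQ hB hA hm hk (by rwa [card_arcs_comm])
  set h := (r + 1) / 2
  let P : Finset ((V × V) × (V × V)) :=
    ((A'.sigma F).map (Equiv.sigmaEquivProd V V).toEmbedding) ×ˢ
      ((B'.sigma E).map (Equiv.sigmaEquivProd V V).toEmbedding)
  have hsum : ∀ (X : Finset V) (K : V → Finset V) (f : V × V → ℝ),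
      ∑ x ∈ (X.sigma K).map (Equiv.sigmaEquivProd V V).toEmbedding, f x
        = ∑ u ∈ X, ∑ v ∈ K u, f (u, v) := by
    intro X K f
    rw [Finset.sum_map, Finset.sum_sigma]; rfl
  have hmemF : ∀ x, x ∈ (A'.sigma F).map (Equiv.sigmaEquivProd V V).toEmbedding ↔
      x.1 ∈ A' ∧ x.2 ∈ F x.1 := by
    rintro ⟨u, v⟩; simp [Finset.mem_map_equiv, Equiv.sigmaEquivProd]
  have hmemE : ∀ x, x ∈ (B'.sigma E).map (Equiv.sigmaEquivProd V V).toEmbedding ↔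
      x.1 ∈ B' ∧ x.2 ∈ E x.1 := by
    rintro ⟨u, v⟩; simp [Finset.mem_map_equiv, Equiv.sigmaEquivProd]
  set X := (A'.sigma F).map (Equiv.sigmaEquivProd V V).toEmbedding
  set Y := (B'.sigma E).map (Equiv.sigmaEquivProd V V).toEmbedding
  have hXc : (X.card : ℝ) = A'.card * h := by
    have : ∑ x ∈ X, (1 : ℝ) = ∑ u ∈ A', ∑ v ∈ F u, (1 : ℝ) := hsum A' F fun _ => 1
    rw [Finset.sum_const, nsmul_eq_mul, mul_one] at this
    rw [this, ← nsmul_eq_mul]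
    exact Finset.sum_eq_card_nsmul fun u hu => by simp [(hF u hu).2.1]
  have hYc : (Y.card : ℝ) = B'.card * h := by
    have : ∑ x ∈ Y, (1 : ℝ) = ∑ u ∈ B', ∑ v ∈ E u, (1 : ℝ) := hsum B' E fun _ => 1
    rw [Finset.sum_const, nsmul_eq_mul, mul_one] at this
    rw [this, ← nsmul_eq_mul]
    exact Finset.sum_eq_card_nsmul fun u hu => by simp [(hE u hu).2.1]
  -- All sets `F u` have the same size `h`, so the sum factors: each neighbour u of d is counted `h`
  -- times. The bound #A/16 on the neighbours of d becomes #A'/8 since `A'` is at least half of `A`.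
  have hb1 : ∀ y ∈ Y, ∑ x ∈ X, ind (G.Adj x.1 y.2) ≤ h * (A'.card / 8) := by
    intro y hy
    obtain ⟨hy1, hy2⟩ := (hmemE y).1 hy
    have hs := hsum A' F fun x => ind (G.Adj x.1 y.2)
    rw [hs]
    have e1 : ∑ u ∈ A', ∑ v ∈ F u, ind (G.Adj u y.2) = h * ∑ u ∈ A', ind (G.Adj u y.2) := by
      rw [Finset.mul_sum]
      exact Finset.sum_congr rfl fun u hu => by simp [(hF u hu).2.1]
    have e2 : ∑ u ∈ A', ind (G.Adj u y.2) ≤ (nbr G y.2 ∩ A).card := by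
      rw [← card_filter_eq_sum_ind]
      exact_mod_cast Finset.card_le_card fun u hu => by
        simp only [Finset.mem_filter] at hu
        simp only [Finset.mem_inter, mem_nbr]
        exact ⟨hu.2.symm, hA'A hu.1⟩
    have e3 := ((hE y.1 hy1).2.2 y.2 hy2).2
    have e4 : 8 * (nbr G y.2 ∩ A).card ≤ A'.card := by omega
    have e5 : (8 : ℝ) * (nbr G y.2 ∩ A).card ≤ A'.card := by exact_mod_cast e4
    simp only [e1]
    gcongr
    linarith
  have hb2 : ∀ x ∈ X, ∑ y ∈ Y, ind (G.Adj y.1 x.2) ≤ h * (B'.card / 8) := by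
    intro x hx
    obtain ⟨hx1, hx2⟩ := (hmemF x).1 hx
    have hs := hsum B' E fun y => ind (G.Adj y.1 x.2)
    rw [hs]
    have e1 : ∑ u ∈ B', ∑ v ∈ E u, ind (G.Adj u x.2) = h * ∑ u ∈ B', ind (G.Adj u x.2) := by
      rw [Finset.mul_sum]
      exact Finset.sum_congr rfl fun u hu => by simp [(hE u hu).2.1]
    have e2 : ∑ u ∈ B', ind (G.Adj u x.2) ≤ (nbr G x.2 ∩ B).card := by
      rw [← card_filter_eq_sum_ind]
      exact_mod_cast Finset.card_le_card fun u hu => by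
        simp only [Finset.mem_filter] at hu
        simp only [Finset.mem_inter, mem_nbr]
        exact ⟨hu.2.symm, hB'B hu.1⟩
    have e3 := ((hF x.1 hx1).2.2 x.2 hx2).2
    have e4 : 8 * (nbr G x.2 ∩ B).card ≤ B'.card := by omega
    have e5 : (8 : ℝ) * (nbr G x.2 ∩ B).card ≤ B'.card := by exact_mod_cast e4
    simp only [e1]
    gcongr
    linarith
  have hlow : ∑ x ∈ X, ∑ y ∈ Y, (1 - ind (G.Adj x.1 y.2) - ind (G.Adj y.1 x.2)) ≤
      (cutSwitches G A B).card := by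
    rw [← Finset.sum_product']
    have : ((cutSwitches G A B).card : ℝ) ≥ (((X ×ˢ Y).filter fun z =>
        ¬ G.Adj z.1.1 z.2.2 ∧ ¬ G.Adj z.2.1 z.1.2).card : ℝ) := by
      refine Nat.cast_le.2 (Finset.card_le_card ?_)
      rintro ⟨x, y⟩ hz
      simp only [Finset.mem_filter, Finset.mem_product] at hz
      obtain ⟨⟨hx, hy⟩, hz⟩ := hz
      obtain ⟨hx1, hx2⟩ := (hmemF x).1 hx
      obtain ⟨hy1, hy2⟩ := (hmemE y).1 hy
      simp only [cutSwitches, Finset.mem_filter, Finset.mem_univ, true_and]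
      exact ⟨⟨hA'A hx1, (hF _ hx1).1 hx2, hB'B hy1, (hE _ hy1).1 hy2⟩,
        ((hF _ hx1).2.2 _ hx2).1, ((hE _ hy1).2.2 _ hy2).1, hz⟩
    refine le_trans ?_ this
    rw [card_filter_eq_sum_ind]
    refine Finset.sum_le_sum fun z _ => ?_
    rw [ind_and, ind_not, ind_not]
    nlinarith [ind_nonneg (G.Adj z.1.1 z.2.2), ind_nonneg (G.Adj z.2.1 z.1.2)]
  have hexp : ∑ x ∈ X, ∑ y ∈ Y, (1 - ind (G.Adj x.1 y.2) - ind (G.Adj y.1 x.2)) =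
      X.card * Y.card - (∑ y ∈ Y, ∑ x ∈ X, ind (G.Adj x.1 y.2)) -
        ∑ x ∈ X, ∑ y ∈ Y, ind (G.Adj y.1 x.2) := by
    simp only [Finset.sum_sub_distrib, Finset.sum_const, nsmul_eq_mul, mul_one]
    rw [Finset.sum_comm (s := X)]
  have s1 : ∑ y ∈ Y, ∑ x ∈ X, ind (G.Adj x.1 y.2) ≤ Y.card * (h * (A'.card / 8)) := by
    rw [← nsmul_eq_mul]; exact Finset.sum_le_card_nsmul _ _ _ hb1
  have s2 : ∑ x ∈ X, ∑ y ∈ Y, ind (G.Adj y.1 x.2) ≤ X.card * (h * (B'.card / 8)) := by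
    rw [← nsmul_eq_mul]; exact Finset.sum_le_card_nsmul _ _ _ hb2
  rw [hXc] at hexp s2
  rw [hYc] at hexp s1
  -- Each obstruction excludes at most one eighth of the pairs. With h ≥ r/2, #A' and #B' at least
  -- #S/16 and r #S ≥ 4096 k, the result far exceeds the 32 k² needed.
  have hmain : (3 / 4 : ℝ) * (h ^ 2 * (A'.card * B'.card)) ≤ (cutSwitches G A B).card := by
    rw [hexp] at hlow
    nlinarith
  refine le_trans ?_ hmain
  have hh : (r : ℝ) ≤ 2 * h := by
    have : r ≤ 2 * h := by omega
    exact_mod_cast this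
  have hAr : (A.card : ℝ) ≤ 2 * A'.card := by exact_mod_cast hA'
  have hBr : (B.card : ℝ) ≤ 2 * B'.card := by exact_mod_cast hB'
  have hAr2 : (S.card : ℝ) ≤ 16 * A'.card := by
    have : (S.card : ℝ) ≤ 8 * A.card := by exact_mod_cast hA
    linarith
  have hBr2 : (S.card : ℝ) ≤ 16 * B'.card := by
    have : (S.card : ℝ) ≤ 8 * B.card := by exact_mod_cast hB
    linarith
  have hkr : (4096 : ℝ) * k ≤ r * S.card := by exact_mod_cast hk
  have hAB : (S.card : ℝ) ^ 2 ≤ 256 * (A'.card * B'.card) := by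
    nlinarith [mul_le_mul hAr2 hBr2 (by positivity) (by positivity)]
  have hr2 : (r : ℝ) ^ 2 ≤ 4 * h ^ 2 := by
    nlinarith [mul_le_mul hh hh (by positivity) (by positivity)]
  have h1 : ((4096 : ℝ) * k) ^ 2 ≤ (r * S.card) ^ 2 := by gcongr
  have h2 : (r * S.card : ℝ) ^ 2 ≤ (4 * h ^ 2) * (256 * (A'.card * B'.card)) := by
    rw [mul_pow]; gcongr
  nlinarith [h1, h2, sq_nonneg (k : ℝ)]

/-- The graphs of `Ω` that are dense inside `S` and have fewer than `x` edges across `(A, B)`. -/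
noncomputable def sparseCut (Ω : Finset (SimpleGraph V)) (S A B : Finset V) (r x : ℕ) :
    Finset (SimpleGraph V) := by
  classical exact Ω.filter fun G => MostlyDense G S r ∧ (arcs G A B).card < x

/-- There are at least 32 k² switchings out of each graph. Undoing one means choosing two arcs of a
cut that has at most 4k of them, so at most 16 k² switchings lead into any graph. A switching adds
at most two arcs to the cut, hence the shift from `x` to `x + 2`. -/
lemma two_mul_card_sparseCut_le {Ω : Finset (SimpleGraph V)} (hΩ : SwClosed ⊥ Ω)
    {S A B : Finset V} {r k x : ℕ} (hS : A ∪ B = S) (hAB : Disjoint A B)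
    (hA : S.card ≤ 8 * A.card) (hB : S.card ≤ 8 * B.card) (hm : 0 < S.card)
    (hk : 4096 * k ≤ r * S.card) (hx : x + 2 ≤ 4 * k) :
    2 * (sparseCut Ω S A B r x).card ≤ (sparseCut Ω S A B r (x + 2)).card := by
  classical
  let t' : SimpleGraph V → Finset ((V × V) × (V × V)) := fun G => Finset.univ.filter fun x =>
    (x.1.1, x.2.2) ∈ arcs G A B ∧ (x.1.2, x.2.1) ∈ arcs G A B
  let f : SimpleGraph V → (V × V) × (V × V) → SimpleGraph V := fun G x =>
    sw G x.1.1 x.1.2 x.2.1 x.2.2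
  have hne : ∀ {a b : V}, a ∈ A → b ∈ B → a ≠ b := fun ha hb h =>
    Finset.disjoint_left.1 hAB ha (h ▸ hb)
  have hok : ∀ G : SimpleGraph V, ∀ x ∈ cutSwitches G A B, SwOK G x.1.1 x.1.2 x.2.1 x.2.2 := by
    intro G x h
    simp only [cutSwitches, Finset.mem_filter, Finset.mem_univ, true_and] at h
    obtain ⟨⟨h1, h2, h3, h4⟩, h5, h6, h7, h8⟩ := h
    exact ⟨h5, h6, h7, h8, hne h1 h4, (hne h2 h3).symm⟩
  have hcut : ∀ G : SimpleGraph V, ∀ x ∈ cutSwitches G A B,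
      (arcs (f G x) A B).card ≤ (arcs G A B).card + 2 := by
    rintro G ⟨⟨u, v⟩, ⟨c, d⟩⟩ h
    simp only [cutSwitches, Finset.mem_filter, Finset.mem_univ, true_and] at h
    obtain ⟨⟨h1, h2, h3, h4⟩, -⟩ := h
    have : arcs (f G ((u, v), (c, d))) A B ⊆ insert (u, d) (insert (v, c) (arcs G A B)) := by
      rintro ⟨y, z⟩ hyz
      simp only [mem_arcs, f, sw, Sym2.eq_iff] at hyz
      simp only [Finset.mem_insert, mem_arcs, Prod.mk.injEq]
      have := fun h => hne (a := y) (b := d) hyz.1.1 h4 h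
      have := fun h => hne (a := y) (b := c) hyz.1.1 h3 h
      tauto
    refine (Finset.card_le_card this).trans ((Finset.card_insert_le _ _).trans ?_)
    have := Finset.card_insert_le (v, c) (arcs G A B)
    omega
  have hmem : ∀ {G y}, G ∈ sparseCut Ω S A B r y ↔
      G ∈ Ω ∧ MostlyDense G S r ∧ (arcs G A B).card < y := by
    intro G y; simp [sparseCut]
  have key := card_mul_le_of_switch (B := sparseCut Ω S A B r x)
    (Ω := sparseCut Ω S A B r (x + 2)) f (fun G => cutSwitches G A B) t'
    (a := 32 * k ^ 2) (b := 16 * k ^ 2) (by positivity) ?_ ?_ ?_ ?_ ?_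
  · rcases Nat.eq_zero_or_pos k with h | h
    · omega
    have hk0 : (0 : ℝ) < 16 * (k : ℝ) ^ 2 := by positivity
    have : (2 * (sparseCut Ω S A B r x).card : ℝ) * (16 * (k : ℝ) ^ 2) ≤
        (sparseCut Ω S A B r (x + 2)).card * (16 * (k : ℝ) ^ 2) := by linarith
    exact_mod_cast le_of_mul_le_mul_right this hk0
  · intro G hG
    have := hmem.1 hG
    exact card_cutSwitches hS this.2.1 hA hB hm hk (by omega)
  · intro G hG y hy
    have hG' := hmem.1 hG
    have ho := hok G y hy
    refine hmem.2 ⟨hΩ.2 G hG'.1 _ _ _ _ ho (by simp) (by simp), ?_, ?_⟩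
    · obtain ⟨L, hL1, hL2, hL3⟩ := hG'.2.1
      refine ⟨L, hL1, hL2, fun a ha haL => ?_⟩
      simp only [cutSwitches, Finset.mem_filter, Finset.mem_univ, true_and] at hy
      have hAS : A ⊆ S := hS ▸ Finset.subset_union_left
      have hBS : B ⊆ S := hS ▸ Finset.subset_union_right
      rw [card_nbr_inter_sw ho (hAS hy.1.1) (hAS hy.1.2.1) (hBS hy.1.2.2.1) (hBS hy.1.2.2.2)]
      exact hL3 a ha haL
    · have := hcut G y hy
      omega
  · intro G hG y hy
    have ho := hok G y hy
    simp only [cutSwitches, Finset.mem_filter, Finset.mem_univ, true_and] at hy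
    simp only [t', Finset.mem_filter, Finset.mem_univ, true_and, mem_arcs, f, sw]
    exact ⟨⟨⟨hy.1.1, hy.1.2.2.2⟩, Or.inr ⟨ho.2.2.2.2.1, by tauto⟩⟩,
      ⟨⟨hy.1.2.1, hy.1.2.2.1⟩, Or.inr ⟨ho.2.2.2.2.2.symm, Or.inr Sym2.eq_swap⟩⟩⟩
  · intro G hG y hy
    have h1 := hcut G y hy
    have h2 := (hmem.1 hG).2.2
    have h3 : (arcs (f G y) A B).card ≤ 4 * k := by omega
    have h4 : (t' (f G y)).card ≤ (arcs (f G y) A B ×ˢ arcs (f G y) A B).card := by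
      refine Finset.card_le_card_of_injOn (fun x => ((x.1.1, x.2.2), (x.1.2, x.2.1))) ?_ ?_
      · rintro ⟨⟨u, v⟩, ⟨c, d⟩⟩ h
        simp only [t', Finset.coe_filter, Finset.mem_univ, true_and, Set.mem_ofPred_eq] at h
        simp only [Finset.coe_product, Set.mem_prod, Finset.mem_coe]
        exact h
      · rintro ⟨⟨u, v⟩, ⟨c, d⟩⟩ _ ⟨⟨u', v'⟩, ⟨c', d'⟩⟩ _ h
        simp only [Prod.mk.injEq] at h ⊢
        tauto
    rw [Finset.card_product] at h4
    have h5 : (t' (f G y)).card ≤ 16 * k ^ 2 := by nlinarith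
    exact_mod_cast h5
  · intro G _ G' _ y hy hy' he
    rw [← sw_sw (hok G y hy), ← sw_sw (hok G' y hy')]
    simp only [f] at he
    rw [he]

/-- The doubling is applied k times, raising the threshold from 2k to 4k, the range in which it is
valid. -/
lemma pow_mul_card_sparseCut_le {Ω : Finset (SimpleGraph V)} (hΩ : SwClosed ⊥ Ω)
    {S A B : Finset V} {r k : ℕ} (hS : A ∪ B = S) (hAB : Disjoint A B)
    (hA : S.card ≤ 8 * A.card) (hB : S.card ≤ 8 * B.card) (hm : 0 < S.card)
    (hk : 4096 * k ≤ r * S.card) :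
    2 ^ k * (sparseCut Ω S A B r (2 * k)).card ≤ Ω.card := by
  have : ∀ j ≤ k, 2 ^ j * (sparseCut Ω S A B r (2 * k)).card ≤
      (sparseCut Ω S A B r (2 * k + 2 * j)).card := by
    intro j hj
    induction j with
    | zero => simp
    | succ j ih =>
      have h1 := ih (by omega)
      have h2 := two_mul_card_sparseCut_le hΩ (x := 2 * k + 2 * j) hS hAB hA hB hm hk (by omega)
      rw [pow_succ, show 2 * k + 2 * (j + 1) = 2 * k + 2 * j + 2 by ring]
      linarith
  refine (this k le_rfl).trans (Finset.card_le_card ?_)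
  intro G hG
  simp only [sparseCut, Finset.mem_filter] at hG
  exact hG.1

/-- Every balanced cut of `S` has at least `x` edges. -/
def CutExpanding (G : SimpleGraph V) (S : Finset V) (x : ℕ) : Prop :=
  ∀ A ⊆ S, S.card ≤ 8 * A.card → S.card ≤ 8 * (S \ A).card → x ≤ (arcs G A (S \ A)).card

/-- Few graphs that are dense inside `S` have a sparse balanced cut of `S`. -/
lemma card_not_cutExpanding_le {Ω : Finset (SimpleGraph V)} (hΩ : SwClosed ⊥ Ω)
    {S : Finset V} {r k : ℕ} (hm : 0 < S.card) (hk : 4096 * k ≤ r * S.card)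
    {B : Finset (SimpleGraph V)} (hB : ∀ G ∈ B, G ∈ Ω ∧ MostlyDense G S r ∧
      ¬ CutExpanding G S (2 * k)) :
    2 ^ k * B.card ≤ 2 ^ S.card * Ω.card := by
  classical
  have hsub : B ⊆ (S.powerset.filter fun A => S.card ≤ 8 * A.card ∧
      S.card ≤ 8 * (S \ A).card).biUnion fun A => sparseCut Ω S A (S \ A) r (2 * k) := by
    intro G hG
    obtain ⟨h1, h2, h3⟩ := hB G hG
    simp only [CutExpanding, not_forall, not_le] at h3
    obtain ⟨A, hA, h4, h5, h6⟩ := h3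
    simp only [Finset.mem_biUnion, Finset.mem_filter, Finset.mem_powerset, sparseCut]
    exact ⟨A, ⟨hA, h4, h5⟩, h1, h2, h6⟩
  have h1 := (Finset.card_le_card hsub).trans Finset.card_biUnion_le
  have h2 : ∀ A ∈ (S.powerset.filter fun A => S.card ≤ 8 * A.card ∧
      S.card ≤ 8 * (S \ A).card), 2 ^ k * (sparseCut Ω S A (S \ A) r (2 * k)).card ≤ Ω.card := by
    intro A hA
    simp only [Finset.mem_filter, Finset.mem_powerset] at hA
    exact pow_mul_card_sparseCut_le hΩ (Finset.union_sdiff_of_subset hA.1) Finset.disjoint_sdiff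
      hA.2.1 hA.2.2 hm hk
  calc 2 ^ k * B.card ≤ 2 ^ k * ∑ A ∈ _, (sparseCut Ω S A (S \ A) r (2 * k)).card :=
        Nat.mul_le_mul_left _ h1
    _ = ∑ A ∈ _, 2 ^ k * (sparseCut Ω S A (S \ A) r (2 * k)).card := Finset.mul_sum _ _ _
    _ ≤ _ • Ω.card := Finset.sum_le_card_nsmul _ _ _ h2
    _ ≤ 2 ^ S.card * Ω.card := by
      rw [smul_eq_mul]
      refine Nat.mul_le_mul_right _ ?_
      rw [← Finset.card_powerset]
      exact Finset.card_le_card (Finset.filter_subset _ _)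

end Cuts


/-! ### The giant component of a percolated expander, and attaching vertices to it. -/

section Giant

variable {V : Type*} [Fintype V] [DecidableEq V]

/-- The graph with edge set `F`. -/
def gr (F : Finset (Sym2 V)) : SimpleGraph V := SimpleGraph.fromEdgeSet (F : Set (Sym2 V))

@[simp] lemma gr_adj {F : Finset (Sym2 V)} {a b : V} : (gr F).Adj a b ↔ s(a, b) ∈ F ∧ a ≠ b := by
  simp [gr]

lemma gr_mono {F F' : Finset (Sym2 V)} (h : F ⊆ F') : gr F ≤ gr F' := by
  intro a b hab
  rw [gr_adj] at hab ⊢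
  exact ⟨h hab.1, hab.2⟩

lemma gr_le {G : SimpleGraph V} {F : Finset (Sym2 V)} (h : F ⊆ edges G) : gr F ≤ G := by
  intro a b hab
  rw [gr_adj] at hab
  simpa using h hab.1

/-- The vertices reachable from `a` in `R`. -/
noncomputable def reach (R : SimpleGraph V) (a : V) : Finset V := by
  classical exact Finset.univ.filter (R.Reachable a)

@[simp] lemma mem_reach {R : SimpleGraph V} {a b : V} : b ∈ reach R a ↔ R.Reachable a b := by
  simp [reach]

lemma reach_mono {R R' : SimpleGraph V} (h : R ≤ R') (a : V) : reach R a ⊆ reach R' a := by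
  intro b hb
  rw [mem_reach] at hb ⊢
  exact hb.mono h

lemma reach_subset {R : SimpleGraph V} {a b : V} (h : R.Reachable a b) :
    reach R b ⊆ reach R a := by
  intro c hc
  rw [mem_reach] at hc ⊢
  exact h.trans hc

/-- The vertex `a` lies in a component of `R` that contains three quarters of `S`. -/
def InGiant (R : SimpleGraph V) (S : Finset V) (a : V) : Prop :=
  3 * S.card ≤ 4 * (reach R a ∩ S).card

lemma InGiant.of_reachable {R : SimpleGraph V} {S : Finset V} {a b : V} (h : R.Reachable a b)
    (hb : InGiant R S b) : InGiant R S a := by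
  unfold InGiant at *
  have := Finset.card_le_card (Finset.inter_subset_inter_right (u := S) (reach_subset h))
  omega

lemma InGiant.mono {R R' : SimpleGraph V} (h : R ≤ R') {S : Finset V} {a : V}
    (ha : InGiant R S a) : InGiant R' S a := by
  unfold InGiant at *
  have := Finset.card_le_card (Finset.inter_subset_inter_right (u := S) (reach_mono h a))
  omega

/-- The vertices of `S` in a component of `R` that contains three quarters of `S`. -/
noncomputable def giant (R : SimpleGraph V) (S : Finset V) : Finset V := by
  classical exact S.filter (InGiant R S)

@[simp] lemma mem_giant {R : SimpleGraph V} {S : Finset V} {a : V} :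
    a ∈ giant R S ↔ a ∈ S ∧ InGiant R S a := by
  simp [giant]

/-- Every cut of `S` with at least `x` edges in `G` is crossed by an edge of `R`. -/
def Crossing (G R : SimpleGraph V) (S : Finset V) (x : ℕ) : Prop :=
  ∀ A ⊆ S, x ≤ (arcs G A (S \ A)).card → (arcs R A (S \ A)).Nonempty

/-- A subset of `S` closed under reachability in `R` has fewer than `x` arcs of `G` leaving it, so
by expansion it or its complement has fewer than #S/8 vertices. Take a largest such closed set on
the small side and add one more component: the union must have a small complement, so that component
contains over three quarters of `S`. The second claim holds because `giant` is itself closed. -/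
lemma giant_spec {G R : SimpleGraph V} {S : Finset V} {x : ℕ} (hm : 0 < S.card)
    (h2 : Crossing G R S x) (h3 : CutExpanding G S x) :
    3 * S.card ≤ 4 * (giant R S).card ∧ (arcs G (giant R S) (S \ giant R S)).card < x := by
  classical
  have hcl : ∀ A ⊆ S, (∀ a ∈ A, ∀ b ∈ S, R.Reachable a b → b ∈ A) →
      (arcs G A (S \ A)).card < x := by
    intro A hA hAc
    by_contra hx
    obtain ⟨⟨a, b⟩, hab⟩ := h2 A hA (not_lt.1 hx)
    simp only [mem_arcs, Finset.mem_sdiff] at hab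
    exact hab.1.2.2 (hAc a hab.1.1 b hab.1.2.1 hab.2.reachable)
  have hcl2 : ∀ A ⊆ S, (∀ a ∈ A, ∀ b ∈ S, R.Reachable a b → b ∈ A) →
      8 * A.card < S.card ∨ 8 * (S \ A).card < S.card := by
    intro A hA hAc
    by_contra! h
    exact absurd (h3 A hA h.1 h.2) (not_le.2 (hcl A hA hAc))
  have hgc : ∀ a ∈ giant R S, ∀ b ∈ S, R.Reachable a b → b ∈ giant R S := by
    intro a ha b hb hab
    rw [mem_giant] at ha ⊢
    exact ⟨hb, ha.2.of_reachable hab.symm⟩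
  refine ⟨?_, hcl _ (fun a ha => (mem_giant.1 ha).1) hgc⟩
  let P := S.powerset.filter fun A => (∀ a ∈ A, ∀ b ∈ S, R.Reachable a b → b ∈ A) ∧
    8 * A.card < S.card
  obtain ⟨A, hA, hmax⟩ := P.exists_max_image Finset.card ⟨∅, by simp [P, hm]⟩
  simp only [P, Finset.mem_filter, Finset.mem_powerset] at hA hmax
  obtain ⟨hAS, hAc, hA8⟩ := hA
  have hne : (S \ A).Nonempty := by
    rw [← Finset.card_pos]
    have := Finset.le_card_sdiff A S
    omega
  obtain ⟨y, hy⟩ := hne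
  rw [Finset.mem_sdiff] at hy
  set K := reach R y ∩ S
  have hyK : y ∈ K := by simp [K, hy.1]
  have hAKS : A ∪ K ⊆ S := Finset.union_subset hAS Finset.inter_subset_right
  have hAKc : ∀ a ∈ A ∪ K, ∀ b ∈ S, R.Reachable a b → b ∈ A ∪ K := by
    intro a ha b hb hab
    rcases Finset.mem_union.1 ha with ha | ha
    · exact Finset.mem_union_left _ (hAc a ha b hb hab)
    · simp only [K, Finset.mem_inter, mem_reach] at ha
      exact Finset.mem_union_right _ (by simp [K, hb, ha.1.trans hab])
  have hlt : A.card < (A ∪ K).card := Finset.card_lt_card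
    ⟨Finset.subset_union_left, fun h => hy.2 (h (Finset.mem_union_right _ hyK))⟩
  have h8 : 8 * (S \ (A ∪ K)).card < S.card := by
    rcases hcl2 _ hAKS hAKc with h | h
    · have := hmax (A ∪ K) ⟨hAKS, hAKc, h⟩
      omega
    · exact h
  have h9 := Finset.card_sdiff_add_card_eq_card hAKS
  have h10 := Finset.card_union_le A K
  have hK : 3 * S.card ≤ 4 * K.card := by omega
  have hKg : K ⊆ giant R S := by
    intro a ha
    simp only [K, Finset.mem_inter, mem_reach] at ha
    exact mem_giant.2 ⟨ha.2, InGiant.of_reachable ha.1.symm hK⟩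
  have := Finset.card_le_card hKg
  omega

/-- The edges of `G` joining `a` to a vertex of `C`. -/
noncomputable def spokes (G : SimpleGraph V) (a : V) (C : Finset V) : Finset (Sym2 V) :=
  (nbr G a ∩ C).image fun u => s(a, u)

lemma mem_spokes {G : SimpleGraph V} {a : V} {C : Finset V} {e : Sym2 V} :
    e ∈ spokes G a C ↔ ∃ u ∈ C, G.Adj a u ∧ e = s(a, u) := by
  simp only [spokes, Finset.mem_image, Finset.mem_inter, mem_nbr]
  constructor
  · rintro ⟨u, ⟨h1, h2⟩, rfl⟩; exact ⟨u, h2, h1, rfl⟩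
  · rintro ⟨u, h1, h2, rfl⟩; exact ⟨u, ⟨h2, h1⟩, rfl⟩

lemma spokes_subset (G : SimpleGraph V) (a : V) (C : Finset V) : spokes G a C ⊆ edges G := by
  intro e he
  obtain ⟨u, -, h, rfl⟩ := mem_spokes.1 he
  simpa using h

lemma card_spokes (G : SimpleGraph V) (a : V) (C : Finset V) :
    (spokes G a C).card = (nbr G a ∩ C).card := by
  exact Finset.card_image_of_injective _ fun u v h => Sym2.congr_right.1 h

lemma bern_no_spoke_le {G : SimpleGraph V} {E : Finset (Sym2 V)} {p : ℝ} (h0 : 0 ≤ p) (h1 : p ≤ 1)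
    {a : V} {C : Finset V} (hE : spokes G a C ⊆ E) {q : ℕ} (hq : q ≤ (nbr G a ∩ C).card) :
    bern E p (fun F => ind (F ∩ spokes G a C = ∅)) ≤ (1 - p) ^ q := by
  rw [bern_void hE, card_spokes]
  exact pow_le_pow_of_le_one (by linarith) (by linarith) hq

/-- A union bound over the subsets of `S`; a cut with at least `x` edges loses all of them with
probability at most (1 - p)^x. -/
lemma bern_not_crossing_le (G : SimpleGraph V) {p : ℝ} (h0 : 0 ≤ p) (h1 : p ≤ 1) (S : Finset V)
    (x : ℕ) :
    bern (edges G) p (fun F => ind (¬ Crossing G (gr F) S x)) ≤ 2 ^ S.card * (1 - p) ^ x := by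
  classical
  let cut : Finset V → Finset (Sym2 V) := fun A => (arcs G A (S \ A)).image fun y => s(y.1, y.2)
  have hcut : ∀ A, cut A ⊆ edges G := by
    intro A e he
    simp only [cut, Finset.mem_image] at he
    obtain ⟨y, hy, rfl⟩ := he
    simpa using (mem_arcs.1 hy).2
  have hcc : ∀ A, (cut A).card = (arcs G A (S \ A)).card := by
    intro A
    refine Finset.card_image_of_injOn ?_
    rintro ⟨a, b⟩ hab ⟨a', b'⟩ hab' h
    simp only [Finset.mem_coe, mem_arcs, Finset.mem_sdiff] at hab hab'
    simp only [Sym2.eq_iff] at h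
    rcases h with ⟨rfl, rfl⟩ | ⟨rfl, rfl⟩
    · rfl
    · exact absurd hab.1.1 hab'.1.2.2
  have hle : bern (edges G) p (fun F => ind (¬ Crossing G (gr F) S x)) ≤
      bern (edges G) p (fun F => ∑ A ∈ S.powerset.filter (fun A => x ≤ (arcs G A (S \ A)).card),
        ind (F ∩ cut A = ∅)) := by
    refine bern_mono h0 h1 fun F _ => ?_
    by_cases h : Crossing G (gr F) S x
    · rw [ind_false (not_not.2 h)]
      exact Finset.sum_nonneg fun _ _ => ind_nonneg _
    · rw [ind_true h]
      simp only [Crossing, not_forall] at h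
      obtain ⟨A, hA, hx, hne⟩ := h
      have : F ∩ cut A = ∅ := by
        rw [Finset.eq_empty_iff_forall_notMem]
        intro e he
        simp only [cut, Finset.mem_inter, Finset.mem_image] at he
        obtain ⟨heF, y, hy, rfl⟩ := he
        refine hne ⟨y, ?_⟩
        rw [mem_arcs] at hy ⊢
        exact ⟨hy.1, gr_adj.2 ⟨heF, hy.2.ne⟩⟩
      rw [← ind_true this]
      exact Finset.single_le_sum (f := fun A => ind (F ∩ cut A = ∅)) (fun _ _ => ind_nonneg _)
        (by simp [hA, hx])
  refine hle.trans ?_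
  rw [bern_sum]
  calc ∑ A ∈ S.powerset.filter (fun A => x ≤ (arcs G A (S \ A)).card),
        bern (edges G) p (fun F => ind (F ∩ cut A = ∅))
      ≤ (S.powerset.filter (fun A => x ≤ (arcs G A (S \ A)).card)).card • (1 - p) ^ x := by
        refine Finset.sum_le_card_nsmul _ _ _ fun A hA => ?_
        rw [bern_void (hcut A), hcc A]
        exact pow_le_pow_of_le_one (by linarith) (by linarith) (Finset.mem_filter.1 hA).2
    _ ≤ 2 ^ S.card * (1 - p) ^ x := by
        rw [nsmul_eq_mul]
        have : (S.powerset.filter (fun A => x ≤ (arcs G A (S \ A)).card)).card ≤ 2 ^ S.card := by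
          rw [← Finset.card_powerset]
          exact Finset.card_le_card (Finset.filter_subset _ _)
        have h2 : ((S.powerset.filter (fun A => x ≤ (arcs G A (S \ A)).card)).card : ℝ) ≤
            2 ^ S.card := by exact_mod_cast this
        exact mul_le_mul_of_nonneg_right h2 (pow_nonneg (by linarith) _)

/-- At density at most one half, a vertex keeps at least an eighth of its edges to `C` outside
the percolated graph. -/
lemma bern_few_remaining_le (G : SimpleGraph V) {p : ℝ} (h0 : 0 ≤ p) (h1 : p ≤ 1 / 2) (a : V)
    (C : Finset V) :
    bern (edges G) p (fun F => ind (8 * (nbr (G \ gr F) a ∩ C).card ≤ (nbr G a ∩ C).card)) ≤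
      (4 / 5) ^ (nbr G a ∩ C).card := by
  rw [← card_spokes G a C]
  refine le_trans (le_of_eq ?_) (bern_few_missed (E := spokes G a C) h0 h1)
  rw [← bern_inter (spokes_subset G a C)]
  refine bern_congr fun F _ => ?_
  have : (nbr (G \ gr F) a ∩ C).card = (spokes G a C \ (F ∩ spokes G a C)).card := by
    rw [← card_spokes]
    congr 1
    ext e
    simp only [Finset.mem_sdiff, Finset.mem_inter, mem_spokes, SimpleGraph.sdiff_adj, gr_adj]
    constructor
    · rintro ⟨u, hu, ⟨h1, h2⟩, rfl⟩
      refine ⟨⟨u, hu, h1, rfl⟩, fun h => h2 ⟨h.1, h1.ne⟩⟩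
    · rintro ⟨⟨u, hu, h1, rfl⟩, h2⟩
      refine ⟨u, hu, ⟨h1, fun h => h2 ⟨h.1, u, hu, h1, rfl⟩⟩, rfl⟩
  rw [this]

/-- The vertex `y` is joined to `C` directly or through one of its neighbours by many paths. -/
def Attachable (G : SimpleGraph V) (C : Finset V) (q : ℕ) (y : V) : Prop :=
  y ∈ C ∨ q ≤ (nbr G y ∩ C).card ∨
    ∃ Z : Finset V, q ≤ Z.card ∧ ∀ z ∈ Z, G.Adj y z ∧ q ≤ (nbr G z ∩ C).card

/-- For routes of length two, the edges from `y` to `Z` are exposed first. Unless all are lost, some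
z in `Z` is reached, and its edges to `C` are still unexposed. Each stage fails with probability at
most (1 - p)^q. -/
lemma bern_not_attached_le {G : SimpleGraph V} {p : ℝ} (h0 : 0 ≤ p) (h1 : p ≤ 1)
    {C : Finset V} {q : ℕ} {y : V} (hy : Attachable G C q y) :
    bern (edges G) p (fun F => ind (¬ ∃ u ∈ C, (gr F).Reachable y u)) ≤ 2 * (1 - p) ^ q := by
  classical
  have hpq : 0 ≤ (1 - p) ^ q := pow_nonneg (by linarith) _
  have hspoke : ∀ {F : Finset (Sym2 V)} {a : V}, F ∩ spokes G a C ≠ ∅ →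
      ∃ u ∈ C, (gr F).Adj a u := by
    intro F a h
    obtain ⟨e, he⟩ := Finset.nonempty_iff_ne_empty.2 h
    rw [Finset.mem_inter, mem_spokes] at he
    obtain ⟨heF, u, hu, hau, rfl⟩ := he
    exact ⟨u, hu, gr_adj.2 ⟨heF, hau.ne⟩⟩
  by_cases hyC : y ∈ C
  · have : bern (edges G) p (fun F => ind (¬ ∃ u ∈ C, (gr F).Reachable y u)) =
        bern (edges G) p (fun _ => 0) :=
      bern_congr fun F _ => ind_false (not_not.2 ⟨y, hyC, SimpleGraph.Reachable.refl _⟩)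
    rw [this, bern_const]; positivity
  rcases hy with hy | hy | ⟨Z, hZ, hZ'⟩
  · exact absurd hy hyC
  · have : bern (edges G) p (fun F => ind (¬ ∃ u ∈ C, (gr F).Reachable y u)) ≤
        bern (edges G) p (fun F => ind (F ∩ spokes G y C = ∅)) := by
      refine bern_mono h0 h1 fun F _ => ind_mono fun h => ?_
      by_contra hne
      obtain ⟨u, hu, hyu⟩ := hspoke hne
      exact h ⟨u, hu, hyu.reachable⟩
    linarith [bern_no_spoke_le h0 h1 (spokes_subset G y C) hy]
  · have hZn : Z ⊆ nbr G y := fun z hz => mem_nbr.2 (hZ' z hz).1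
    have hE₁ := spokes_subset G y Z
    rw [← Finset.union_sdiff_of_subset hE₁, bern_union Finset.disjoint_sdiff]
    have key : ∀ F₁ ⊆ spokes G y Z, bern (edges G \ spokes G y Z) p (fun F₂ =>
        ind (¬ ∃ u ∈ C, (gr (F₁ ∪ F₂)).Reachable y u)) ≤ ind (F₁ = ∅) + (1 - p) ^ q := by
      intro F₁ hF₁
      by_cases hF : F₁ = ∅
      · rw [ind_true hF]
        have := bern_le_const h0 h1 (E := edges G \ spokes G y Z) (f := fun F₂ =>
          ind (¬ ∃ u ∈ C, (gr (F₁ ∪ F₂)).Reachable y u)) (c := 1) fun _ _ => ind_le_one _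
        linarith
      · rw [ind_false hF, zero_add]
        obtain ⟨e, he⟩ := Finset.nonempty_iff_ne_empty.2 hF
        obtain ⟨z, hz, hyz, rfl⟩ := mem_spokes.1 (hF₁ he)
        refine le_trans (bern_mono h0 h1 fun F₂ _ => ind_mono fun h => ?_)
          (bern_no_spoke_le (G := G) (a := z) (C := C) h0 h1 ?_ (hZ' z hz).2)
        · by_contra hne
          obtain ⟨u, hu, hzu⟩ := hspoke hne
          refine h ⟨u, hu, SimpleGraph.Reachable.trans (v := z) ?_ ?_⟩
          · exact (gr_adj.2 ⟨Finset.mem_union_left _ he, hyz.ne⟩ :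
              (gr (F₁ ∪ F₂)).Adj y z).reachable
          · exact (gr_mono Finset.subset_union_right hzu).reachable
        · intro e' he'
          -- An edge from z to `C` cannot also be an edge at `y`, since `y` is neither z nor in `C`.
          refine Finset.mem_sdiff.2 ⟨spokes_subset _ _ _ he', fun hmem => ?_⟩
          obtain ⟨u, hu, hzu, rfl⟩ := mem_spokes.1 he'
          obtain ⟨z', hz', hyz', h⟩ := mem_spokes.1 hmem
          rw [Sym2.eq_iff] at h
          rcases h with ⟨rfl, rfl⟩ | ⟨rfl, rfl⟩
          · exact hyz.ne rfl
          · exact hyC hu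
    refine (bern_mono h0 h1 key).trans ?_
    rw [bern_add, bern_const]
    have h3 : bern (spokes G y Z) p (fun F => ind (F = ∅)) ≤ (1 - p) ^ q := by
      have h4 := bern_no_spoke_le (G := G) (E := spokes G y Z) (a := y) (C := Z) h0 h1 le_rfl
        (q := q) (by rwa [Finset.inter_eq_right.2 hZn])
      refine le_trans (le_of_eq (bern_congr fun F hF => ?_)) h4
      rw [Finset.inter_eq_left.2 hF]
    linarith

/-- Averaging over pairs of a graph and a percolated subgraph, subgraph by subgraph. -/
lemma sum_bern_le_of_fiber {Ω : Finset (SimpleGraph V)} {e : ℕ} (he : ∀ G ∈ Ω, (edges G).card = e)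
    {p c : ℝ} (h0 : 0 ≤ p) (h1 : p ≤ 1) (f : SimpleGraph V → Finset (Sym2 V) → ℝ)
    (h : ∀ (F : Finset (Sym2 V)) (Ω' : Finset (SimpleGraph V)),
      (∀ G, G ∈ Ω' ↔ G ∈ Ω ∧ F ⊆ edges G) → ∑ G ∈ Ω', f G F ≤ c * Ω'.card) :
    ∑ G ∈ Ω, bern (edges G) p (f G) ≤ c * Ω.card := by
  classical
  have key : ∀ g : SimpleGraph V → Finset (Sym2 V) → ℝ, ∑ G ∈ Ω, bern (edges G) p (g G) =
      ∑ F : Finset (Sym2 V), p ^ F.card * (1 - p) ^ (e - F.card) *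
        ∑ G ∈ Ω.filter (fun G => F ⊆ edges G), g G F := by
    intro g
    have : ∀ G ∈ Ω, bern (edges G) p (g G) = ∑ F : Finset (Sym2 V),
        if F ⊆ edges G then p ^ F.card * (1 - p) ^ (e - F.card) * g G F else 0 := by
      intro G hG
      rw [bern, ← Finset.sum_filter]
      refine Finset.sum_congr ?_ fun F hF => ?_
      · ext; simp
      · simp only [Finset.mem_filter, Finset.mem_univ, true_and] at hF
        -- All graphs have `e` edges, so the weight of `F` does not depend on the graph: given `F`,
        -- the graph is uniform among those containing it.
        rw [Finset.card_sdiff_of_subset hF, he G hG]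
    rw [Finset.sum_congr rfl this, Finset.sum_comm]
    refine Finset.sum_congr rfl fun F _ => ?_
    rw [← Finset.sum_filter, Finset.mul_sum]
  have h2 := key fun _ _ => c
  simp only [bern_const, Finset.sum_const, nsmul_eq_mul] at h2
  rw [mul_comm, h2, key]
  refine Finset.sum_le_sum fun F _ => ?_
  have h3 := h F (Ω.filter (fun G => F ⊆ edges G)) (by simp)
  rw [mul_comm c] at h3
  exact mul_le_mul_of_nonneg_left h3 (mul_nonneg (pow_nonneg h0 _) (pow_nonneg (by linarith) _))

/-- This allows switching arguments to be run conditionally on the percolated subgraph, with its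
edges frozen. -/
lemma SwClosed.fiber {Ω Ω' : Finset (SimpleGraph V)} (hΩ : SwClosed ⊥ Ω) {F : Finset (Sym2 V)}
    (h : ∀ G, G ∈ Ω' ↔ G ∈ Ω ∧ F ⊆ edges G) : SwClosed (gr F) Ω' := by
  refine ⟨fun G hG => gr_le ((h G).1 hG).2, fun G hG a b c d hok h1 h2 => ?_⟩
  obtain ⟨hG1, hG2⟩ := (h G).1 hG
  refine (h _).2 ⟨hΩ.2 G hG1 a b c d hok (by simp) (by simp), ?_⟩
  have hle := le_sw (gr_le hG2) h1 h2
  intro e he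
  induction e with
  | _ x y =>
    have hadj : G.Adj x y := by simpa using hG2 he
    have : (gr F).Adj x y := gr_adj.2 ⟨he, hadj.ne⟩
    simpa using hle this

end Giant


/-! ### High-degree vertices lie in the giant component. -/

section Core

variable {V : Type*} [Fintype V] [DecidableEq V]

/-- The degree sequence `δ` of total degree about `M` is concentrated on the vertices of `T`, whose
degrees are at least about `θ`, and the vertices of `S ⊇ T` have degrees at least about `d`. -/
structure DenseCore (δ : V → ℕ) (T S : Finset V) (M θ d : ℝ) : Prop where
  subset : T ⊆ S
  M_pos : 0 < M
  θ_pos : 0 < θ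
  sum_le : (∑ v, (δ v : ℝ)) ≤ M
  gap : 2 / 5 * M ≤ ∑ v ∈ T, (δ v : ℝ) - ∑ v ∈ Tᶜ, (δ v : ℝ)
  le_of_notMem : ∀ v, v ∉ T → (δ v : ℝ) ≤ θ
  le_of_mem : ∀ v ∈ T, θ / 2 ≤ δ v
  le_of_mem_core : ∀ v ∈ S, d / 8 ≤ δ v
  sq_le : θ ^ 2 ≤ M / 10
  M_le : M ≤ 8 * θ * S.card
  d_le : d ≤ 4 * θ

lemma DenseCore.card_pos {δ : V → ℕ} {T S : Finset V} {M θ d : ℝ} (h : DenseCore δ T S M θ d) :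
    0 < S.card := by
  by_contra h0
  have h1 := h.M_le
  have : S.card = 0 := by omega
  rw [this] at h1
  have := h.M_pos
  simp at h1
  linarith

/-- Arcs leaving `T` are paid for by the degrees outside `T`, so at least the gap between the two
degree sums stays inside. -/
lemma card_arcs_core {δ : V → ℕ} {T S : Finset V} {M θ d : ℝ} (h : DenseCore δ T S M θ d)
    {G : SimpleGraph V} (hG : ∀ v, (nbr G v).card = δ v) :
    2 / 5 * M ≤ (arcs G T T).card := by
  have h1 : ∑ v ∈ T, δ v = (arcs G T T).card + (arcs G T Tᶜ).card := by
    rw [card_arcs, card_arcs, ← Finset.sum_add_distrib]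
    refine Finset.sum_congr rfl fun v _ => ?_
    rw [← hG v, ← Finset.sdiff_eq_inter_compl, Finset.card_inter_add_card_sdiff]
  have h2 : (arcs G T Tᶜ).card ≤ ∑ v ∈ Tᶜ, δ v := by
    rw [card_arcs_comm, card_arcs]
    refine Finset.sum_le_sum fun v _ => ?_
    rw [← hG v]
    exact Finset.card_le_card Finset.inter_subset_left
  have h1' : ∑ v ∈ T, (δ v : ℝ) = (arcs G T T).card + (arcs G T Tᶜ).card := by exact_mod_cast h1
  have h2' : ((arcs G T Tᶜ).card : ℝ) ≤ ∑ v ∈ Tᶜ, (δ v : ℝ) := by exact_mod_cast h2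
  linarith [h.gap]

/-- A vertex has few neighbours in `T` only with small probability. -/
lemma few_core_nbrs {Ω : Finset (SimpleGraph V)} (hΩ : SwClosed ⊥ Ω) {δ : V → ℕ}
    (hdeg : ∀ G ∈ Ω, ∀ v, (nbr G v).card = δ v) {T S : Finset V} {M θ d : ℝ}
    (h : DenseCore δ T S M θ d) (v : V) {ℓ : ℕ} (hℓ : 40 * (ℓ : ℝ) ≤ θ) (hℓv : 2 * ℓ ≤ δ v) :
    (∑ G ∈ Ω, ind ((nbr G v ∩ T).card < ℓ)) * δ v ≤ 20 * ℓ * Ω.card := by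
  classical
  rw [← card_filter_eq_sum_ind]
  have hT : θ / 2 * T.card ≤ M := by
    calc θ / 2 * T.card = ∑ v ∈ T, θ / 2 := by simp [mul_comm]
      _ ≤ ∑ v ∈ T, (δ v : ℝ) := Finset.sum_le_sum h.le_of_mem
      _ ≤ ∑ v, (δ v : ℝ) := Finset.sum_le_univ_sum_of_nonneg fun _ => Nat.cast_nonneg _
      _ ≤ M := h.sum_le
  have hM := h.M_pos
  have hθ := h.θ_pos
  -- Vertices outside `T` have degree at most θ, so the cap `q` on neighbours in `T` is automatic.
  -- Degrees at least θ/2 give #T ≤ 2M/θ, hence ℓ #T ≤ M/20 = β/8, and q² ≤ θ² ≤ M/10 = β/4.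
  have key := attachment (R := ⊥) (Ω := Ω) (B := Ω.filter fun G => (nbr G v ∩ T).card < ℓ) hΩ
    (Finset.filter_subset _ _) (v := v) (C := T) (ℓ := ℓ) (q := ⌊θ⌋₊) (K := δ v / 2)
    (β := 2 / 5 * M) (M := M) hM.le ?_ ?_ ?_ ?_ (by positivity) ?_ ?_
  · have h1 : ((Ω.filter fun G => (nbr G v ∩ T).card < ℓ).card * δ v : ℝ) * M ≤
        (20 * ℓ * Ω.card) * M := by linarith
    exact le_of_mul_le_mul_right h1 hM
  · intro G hG
    refine le_trans (le_of_eq ?_) h.sum_le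
    exact Finset.sum_congr rfl fun x _ => by rw [hdeg G hG]
  · intro G hG
    exact (Finset.mem_filter.1 hG).2
  · intro G hG
    rw [Finset.mem_filter] at hG
    refine ⟨nbr G v \ T, ?_, fun z hz => ?_⟩
    · have h1 := Finset.card_inter_add_card_sdiff (nbr G v) T
      rw [hdeg G hG.1 v] at h1
      have h2 : δ v ≤ 2 * (nbr G v \ T).card := by omega
      have h3 : (δ v : ℝ) ≤ 2 * (nbr G v \ T).card := by exact_mod_cast h2
      linarith
    · rw [Finset.mem_sdiff, mem_nbr] at hz
      refine ⟨hz.1, by simp, hz.2, Nat.le_floor ?_⟩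
      refine le_trans ?_ (h.le_of_notMem z hz.2)
      rw [← hdeg G hG.1 z]
      exact_mod_cast Finset.card_le_card Finset.inter_subset_left
  · intro G hG
    rw [Finset.mem_filter] at hG
    rw [sdiff_bot]
    exact card_arcs_core h (hdeg G hG.1)
  · have : (ℓ : ℝ) * T.card ≤ θ / 40 * T.card := by gcongr; linarith
    nlinarith
  · have h1 : (⌊θ⌋₊ : ℝ) ≤ θ := Nat.floor_le hθ.le
    have h2 : (⌊θ⌋₊ : ℝ) ^ 2 ≤ θ ^ 2 := by gcongr
    linarith [h.sq_le]

lemma MostlyDense.mono {G G' : SimpleGraph V} (h : G ≤ G') {S : Finset V} {r : ℕ}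
    (hG : MostlyDense G S r) : MostlyDense G' S r := by
  obtain ⟨L, h1, h2, h3⟩ := hG
  refine ⟨L, h1, h2, fun a ha haL => (h3 a ha haL).trans (Finset.card_le_card ?_)⟩
  intro b hb
  simp only [Finset.mem_inter, mem_nbr] at hb ⊢
  exact ⟨h hb.1, hb.2⟩

/-- After removing a percolated subgraph, a random graph is still dense inside the core. -/
lemma sum_not_mostlyDense_le {Ω : Finset (SimpleGraph V)} (hΩ : SwClosed ⊥ Ω) {δ : V → ℕ}
    (hdeg : ∀ G ∈ Ω, ∀ v, (nbr G v).card = δ v) {T S : Finset V} {M θ d : ℝ}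
    (h : DenseCore δ T S M θ d) {r : ℕ} (hr : 0 < r) (hrd : 1280 * (r : ℝ) ≤ d) {p : ℝ}
    (h0 : 0 ≤ p) (h1 : p ≤ 1 / 2) :
    ∑ G ∈ Ω, bern (edges G) p (fun F => ind (¬ MostlyDense (G \ gr F) S r)) ≤
      (40960 * r / d + 32 * (4 / 5) ^ (8 * r)) * Ω.card := by
  classical
  have hm : (0 : ℝ) < S.card := by exact_mod_cast h.card_pos
  have hd : 0 < d := lt_of_lt_of_le (by positivity) hrd
  have hp1 : p ≤ 1 := by linarith
  have hG : ∀ G ∈ Ω, bern (edges G) p (fun F => ind (¬ MostlyDense (G \ gr F) S r)) ≤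
      32 / S.card * ∑ a ∈ S, (ind ((nbr G a ∩ T).card < 8 * r) + (4 / 5) ^ (8 * r)) := by
    intro G _
    -- Markov's inequality for the number of vertices with fewer than `r` remaining neighbours in
    -- `S`, which exceeds #S/32 when density fails. Each such vertex either had fewer than 8r
    -- neighbours in `T` or lost seven eighths of its neighbours in `S`.
    have hle : bern (edges G) p (fun F => ind (¬ MostlyDense (G \ gr F) S r)) ≤
        bern (edges G) p (fun F => 32 / S.card *
          ∑ a ∈ S, ind ((nbr (G \ gr F) a ∩ S).card < r)) := by
      refine bern_mono h0 hp1 fun F _ => ?_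
      by_cases hD : MostlyDense (G \ gr F) S r
      · rw [ind_false (not_not.2 hD)]
        exact mul_nonneg (by positivity) (Finset.sum_nonneg fun _ _ => ind_nonneg _)
      · rw [ind_true hD, ← card_filter_eq_sum_ind, div_mul_eq_mul_div, le_div_iff₀ hm, one_mul]
        by_contra! hlt
        refine hD ⟨S.filter fun a => (nbr (G \ gr F) a ∩ S).card < r, Finset.filter_subset _ _,
          ?_, fun a ha haL => ?_⟩
        · exact_mod_cast hlt.le
        · simp only [Finset.mem_filter, not_and, not_lt] at haL
          exact haL ha
    refine hle.trans ?_
    rw [bern_mul_left, bern_sum]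
    refine mul_le_mul_of_nonneg_left (Finset.sum_le_sum fun a _ => ?_) (by positivity)
    by_cases hlt : (nbr G a ∩ T).card < 8 * r
    · rw [ind_true hlt]
      have := bern_le_const h0 hp1 (E := edges G)
        (f := fun F => ind ((nbr (G \ gr F) a ∩ S).card < r)) (c := 1) fun _ _ => ind_le_one _
      have : (0 : ℝ) ≤ (4 / 5) ^ (8 * r) := by positivity
      linarith
    · rw [ind_false hlt, zero_add]
      have h8 : 8 * r ≤ (nbr G a ∩ S).card := (not_lt.1 hlt).trans
        (Finset.card_le_card (Finset.inter_subset_inter_left h.subset))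
      refine (bern_mono h0 hp1 fun F _ => ind_mono fun hF => ?_).trans
        ((bern_few_remaining_le G h0 h1 a S).trans
          (pow_le_pow_of_le_one (by norm_num) (by norm_num) h8))
      omega
  have hrec : ∀ a ∈ S, ∑ G ∈ Ω, ind ((nbr G a ∩ T).card < 8 * r) ≤ 1280 * r / d * Ω.card := by
    intro a ha
    have hda := h.le_of_mem_core a ha
    have hda' : 2 * ((8 * r : ℕ) : ℝ) ≤ δ a := by push_cast; linarith
    have h2 := few_core_nbrs hΩ hdeg h a (ℓ := 8 * r) (by push_cast; linarith [h.d_le])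
      (by exact_mod_cast hda')
    have hnn : 0 ≤ ∑ G ∈ Ω, ind ((nbr G a ∩ T).card < 8 * r) :=
      Finset.sum_nonneg fun _ _ => ind_nonneg _
    push_cast at h2
    rw [div_mul_eq_mul_div, le_div_iff₀ hd]
    nlinarith
  calc ∑ G ∈ Ω, bern (edges G) p (fun F => ind (¬ MostlyDense (G \ gr F) S r))
      ≤ ∑ G ∈ Ω, 32 / S.card * ∑ a ∈ S, (ind ((nbr G a ∩ T).card < 8 * r) + (4 / 5) ^ (8 * r)) :=
        Finset.sum_le_sum hG
    _ = 32 / S.card * ∑ a ∈ S, (∑ G ∈ Ω, ind ((nbr G a ∩ T).card < 8 * r) +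
          Ω.card * (4 / 5) ^ (8 * r)) := by
        rw [← Finset.mul_sum, Finset.sum_comm]
        simp only [Finset.sum_add_distrib, Finset.sum_const, nsmul_eq_mul]
    _ ≤ 32 / S.card * ∑ a ∈ S, (1280 * r / d * Ω.card + Ω.card * (4 / 5) ^ (8 * r)) := by
        gcongr with a ha
        exact hrec a ha
    _ = _ := by
        rw [Finset.sum_const, nsmul_eq_mul]
        field_simp
        ring

/-- The typical situation in which a vertex `y` of the core is not attachable to the giant
component of the percolated graph `gr F`. -/
def Stuck (G : SimpleGraph V) (F : Finset (Sym2 V)) (S : Finset V) (r k q : ℕ) (y : V) : Prop :=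
  MostlyDense (G \ gr F) S r ∧ Crossing G (gr F) S (2 * k) ∧ CutExpanding G S (2 * k) ∧
    (nbr G y).card < 8 * (nbr (G \ gr F) y).card ∧ ¬ Attachable G (giant (gr F) S) q y

/-- The giant contains three quarters of `S`, and all but #S/32 of its vertices have `r` unexposed
neighbours in `S`. Fewer than 2k of these arcs leave the giant, a negligible loss as 4096 k ≤ r #S.
-/
lemma card_arcs_giant {G : SimpleGraph V} {F : Finset (Sym2 V)} {S : Finset V} {r k q : ℕ}
    {y : V} (hS : 0 < S.card) (hk : 4096 * k ≤ r * S.card) (h : Stuck G F S r k q y) :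
    r * S.card ≤ 2 * (arcs (G \ gr F) (giant (gr F) S) (giant (gr F) S)).card := by
  classical
  obtain ⟨⟨L, hLS, hL, hLr⟩, h2, h3, -, -⟩ := h
  obtain ⟨hg1, hg2⟩ := giant_spec hS h2 h3
  set C := giant (gr F) S
  have hCS : C ⊆ S := fun a ha => (mem_giant.1 ha).1
  have h4 : (C.card - L.card) * r ≤ (arcs (G \ gr F) C S).card := by
    refine le_trans ?_ (card_heavy_mul_le (G \ gr F) C S (C \ L) Finset.sdiff_subset (c := r) ?_)
    · exact Nat.mul_le_mul_right _ (Finset.le_card_sdiff L C)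
    · intro u hu
      rw [Finset.mem_sdiff] at hu
      exact hLr u (hCS hu.1) hu.2
  have h5 : (arcs (G \ gr F) C S).card ≤
      (arcs (G \ gr F) C C).card + (arcs G C (S \ C)).card := by
    refine le_trans (Finset.card_le_card ?_) (Finset.card_union_le _ _)
    intro x hx
    simp only [mem_arcs, Finset.mem_union, Finset.mem_sdiff, SimpleGraph.sdiff_adj] at hx ⊢
    tauto
  have h6 : 11 * S.card ≤ 16 * (C.card - L.card) := by omega
  have h7 : 11 * S.card * r ≤ 16 * ((C.card - L.card) * r) := by
    calc 11 * S.card * r ≤ 16 * (C.card - L.card) * r := Nat.mul_le_mul_right _ h6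
      _ = _ := by ring
  have h8 : 11 * S.card * r = 11 * (r * S.card) := by ring
  omega

/-- Once `F` is fixed the giant is a fixed set, so `attachment` applies to it in the fibre over `F`.
A stuck vertex has many unexposed edges, mostly to vertices with few neighbours in the giant, which
is exactly the rare situation. The constant is 64 · 8 · 8, from K = θ/64, β/4 = r #S/8 and M ≤ 8θ
#S. -/
lemma sum_stuck_le {Ω : Finset (SimpleGraph V)} (hΩ : SwClosed ⊥ Ω) {δ : V → ℕ}
    (hdeg : ∀ G ∈ Ω, ∀ v, (nbr G v).card = δ v) {e : ℕ} (he : ∀ G ∈ Ω, (edges G).card = e)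
    {T S : Finset V} {M θ d : ℝ}
    (h : DenseCore δ T S M θ d) {r k q : ℕ} (hr : 0 < r) (hrd : 1280 * (r : ℝ) ≤ d)
    (hqr : 32 * q ≤ r) (hk : 4096 * k ≤ r * S.card) {p : ℝ} (h0 : 0 ≤ p) (h1 : p ≤ 1) {y : V}
    (hy : y ∈ T) :
    ∑ G ∈ Ω, bern (edges G) p (fun F => ind (Stuck G F S r k q y)) ≤
      (4096 * q / r) * Ω.card := by
  classical
  refine sum_bern_le_of_fiber he h0 h1 _ fun F Ω' hΩ' => ?_
  rw [← card_filter_eq_sum_ind]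
  set B := Ω'.filter fun G => Stuck G F S r k q y
  have hS := h.card_pos
  rcases B.eq_empty_or_nonempty with hB | ⟨G₀, hG₀⟩
  · rw [hB]; simp; positivity
  -- Some vertex has `r` neighbours in `S`. This is what makes q² at most r #S/8.
  have hrS : r ≤ S.card := by
    obtain ⟨L, hLS, hL, hLr⟩ := (Finset.mem_filter.1 hG₀).2.1
    have : (S \ L).Nonempty := by
      rw [← Finset.card_pos]
      have := Finset.le_card_sdiff L S
      omega
    obtain ⟨a, ha⟩ := this
    rw [Finset.mem_sdiff] at ha
    exact (hLr a ha.1 ha.2).trans (Finset.card_le_card Finset.inter_subset_right)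
  have hδy := h.le_of_mem y hy
  have hθ := h.θ_pos
  have hdθ := h.d_le
  have hM := h.M_pos
  have hS' : (0 : ℝ) < S.card := by exact_mod_cast hS
  have hr' : (0 : ℝ) < r := by exact_mod_cast hr
  have hqr' : 32 * (q : ℝ) ≤ r := by exact_mod_cast hqr
  have hrS' : (r : ℝ) ≤ S.card := by exact_mod_cast hrS
  have key := attachment (R := gr F) (Ω := Ω') (B := B) (hΩ.fiber hΩ') (Finset.filter_subset _ _)
    (v := y) (C := giant (gr F) S) (ℓ := q) (q := q) (K := θ / 64) (β := r * S.card / 2) (M := M)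
    hM.le ?_ ?_ ?_ ?_ (by positivity) ?_ ?_
  · have h2 : (B.card : ℝ) * (θ * (r * S.card)) ≤ 512 * (Ω'.card * (q * M)) := by linarith
    have h3 : 512 * ((Ω'.card : ℝ) * (q * M)) ≤
        512 * (Ω'.card * (q * (8 * θ * S.card))) := by
      gcongr; exact h.M_le
    have h4 : (B.card : ℝ) * r * (θ * S.card) ≤ 4096 * q * Ω'.card * (θ * S.card) := by linarith
    have h5 := le_of_mul_le_mul_right h4 (by positivity)
    rw [div_mul_eq_mul_div, le_div_iff₀ hr']
    exact h5
  · intro G hG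
    refine le_trans (le_of_eq ?_) h.sum_le
    exact Finset.sum_congr rfl fun x _ => by rw [hdeg G ((hΩ' G).1 hG).1]
  · intro G hG
    have hst := (Finset.mem_filter.1 hG).2
    by_contra hlt
    exact hst.2.2.2.2 (Or.inr (Or.inl (not_lt.1 hlt)))
  · intro G hG
    have hst := (Finset.mem_filter.1 hG).2
    have hGΩ := ((hΩ' G).1 (Finset.mem_filter.1 hG).1).1
    obtain ⟨-, -, -, h8, hna⟩ := hst
    set C := giant (gr F) S
    simp only [Attachable, not_or, not_exists, not_and, not_le] at hna
    obtain ⟨hyC, hq1, hq2⟩ := hna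
    set N := nbr (G \ gr F) y
    have hNG : N ⊆ nbr G y := by
      intro z hz
      simp only [N, mem_nbr, SimpleGraph.sdiff_adj] at hz
      exact mem_nbr.2 hz.1
    set Z' := N.filter fun z => q ≤ (nbr G z ∩ C).card
    have hZ' : Z'.card < q := by
      by_contra hlt
      have := hq2 Z' (not_lt.1 hlt)
      simp only [Z', Finset.mem_filter] at this
      push Not at this
      obtain ⟨z, ⟨hz1, hz2⟩, hz3⟩ := this
      exact absurd (hz3 (mem_nbr.1 (hNG hz1))) (not_lt.2 hz2)
    -- More than δ y/8 ≥ θ/16 edges at `y` are unexposed. Not being attachable excludes fewer than q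
    -- neighbours in `Z'` and fewer than q in `C`, and 2q is negligible against θ, which leaves
    -- θ/64.
    refine ⟨(N \ Z') \ C, ?_, ?_⟩
    · have hc1 := Finset.le_card_sdiff Z' N
      have hc2 : ((N \ Z') \ C).card + (nbr G y ∩ C).card ≥ (N \ Z').card := by
        have h1 := Finset.card_inter_add_card_sdiff (N \ Z') C
        have h2 := Finset.card_le_card (Finset.inter_subset_inter_right (u := C)
          (Finset.sdiff_subset.trans hNG : N \ Z' ⊆ nbr G y))
        omega
      rw [hdeg G hGΩ] at h8
      have h9 : δ y < 8 * (((N \ Z') \ C).card + 2 * q) := by omega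
      have h10 : (δ y : ℝ) < 8 * (((N \ Z') \ C).card + 2 * q) := by exact_mod_cast h9
      linarith
    · intro z hz
      simp only [Finset.mem_sdiff, Z', Finset.mem_filter, not_and, not_le] at hz
      have hz1 := hz.1.1
      simp only [N, mem_nbr, SimpleGraph.sdiff_adj] at hz1
      exact ⟨hz1.1, hz1.2, hz.2, (hz.1.2 hz.1.1).le⟩
  · intro G hG
    have := card_arcs_giant hS hk (Finset.mem_filter.1 hG).2
    have h2 : (r : ℝ) * S.card ≤
        2 * (arcs (G \ gr F) (giant (gr F) S) (giant (gr F) S)).card := by exact_mod_cast this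
    linarith
  · have : ((giant (gr F) S).card : ℝ) ≤ S.card := by
      exact_mod_cast Finset.card_le_card fun a ha => (mem_giant.1 ha).1
    nlinarith [mul_le_mul_of_nonneg_left this (Nat.cast_nonneg (α := ℝ) q)]
  · nlinarith [Nat.cast_nonneg (α := ℝ) q]

/-- The bound on the probability that a vertex of the core misses the giant component. -/
noncomputable def coreErr (d p₁ p₂ : ℝ) (m r k q : ℕ) : ℝ :=
  40960 * r / d + 33 * (4 / 5) ^ (8 * r) + 2 ^ m / 2 ^ k + 2 ^ m * (1 - p₁) ^ (2 * k) +
    4096 * q / r + 2 * (1 - p₂) ^ q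

/-- Every vertex of `T` lies in the giant component of the percolated random graph with high
probability. -/
lemma sum_not_inGiant_le {Ω : Finset (SimpleGraph V)} (hΩ : SwClosed ⊥ Ω) {δ : V → ℕ}
    (hdeg : ∀ G ∈ Ω, ∀ v, (nbr G v).card = δ v) {e : ℕ} (he : ∀ G ∈ Ω, (edges G).card = e)
    {T S : Finset V} {M θ d : ℝ}
    (h : DenseCore δ T S M θ d) {r k q : ℕ} (hr : 0 < r) (hrd : 1280 * (r : ℝ) ≤ d)
    (hqr : 32 * q ≤ r) (hk : 4096 * k ≤ r * S.card) {p p₁ p₂ : ℝ} (h10 : 0 ≤ p₁)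
    (h11 : p₁ ≤ 1 / 2) (h20 : 0 ≤ p₂) (h21 : p₂ ≤ 1) (hp : 1 - p = (1 - p₁) * (1 - p₂)) {y : V}
    (hy : y ∈ T) :
    ∑ G ∈ Ω, bern (edges G) p (fun F => ind (¬ InGiant (gr F) S y)) ≤
      coreErr d p₁ p₂ S.card r k q * Ω.card := by
  classical
  have h11' : p₁ ≤ 1 := by linarith
  have hS := h.card_pos
  have hG : ∀ G ∈ Ω, bern (edges G) p (fun F => ind (¬ InGiant (gr F) S y)) ≤
      bern (edges G) p₁ (fun F => ind (¬ MostlyDense (G \ gr F) S r)) +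
      ind (MostlyDense G S r ∧ ¬ CutExpanding G S (2 * k)) +
      bern (edges G) p₁ (fun F => ind (¬ Crossing G (gr F) S (2 * k))) +
      bern (edges G) p₁ (fun F => ind
        (8 * (nbr (G \ gr F) y ∩ Finset.univ).card ≤ (nbr G y ∩ Finset.univ).card)) +
      bern (edges G) p₁ (fun F => ind (Stuck G F S r k q y)) + 2 * (1 - p₂) ^ q := by
    intro G hGΩ
    -- The p₁-round builds the giant, and the p₂-round attaches `y` to it unless one of five
    -- exceptional events occurs. The terms of `coreErr` are the bounds for these events and for the
    -- failure of the second round.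
    rw [bern_sprinkle hp]
    rw [← bern_const (edges G) p₁ (ind (MostlyDense G S r ∧ ¬ CutExpanding G S (2 * k))),
      ← bern_const (edges G) p₁ (2 * (1 - p₂) ^ q), ← bern_add, ← bern_add, ← bern_add,
      ← bern_add, ← bern_add]
    refine bern_mono h10 h11' fun F _ => ?_
    have hpq : 0 ≤ 2 * (1 - p₂) ^ q := by
      have := pow_nonneg (sub_nonneg.2 h21) q
      linarith
    have n1 := ind_nonneg (¬ MostlyDense (G \ gr F) S r)
    have n2 := ind_nonneg (MostlyDense G S r ∧ ¬ CutExpanding G S (2 * k))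
    have n3 := ind_nonneg (¬ Crossing G (gr F) S (2 * k))
    have n4 := ind_nonneg
      (8 * (nbr (G \ gr F) y ∩ Finset.univ).card ≤ (nbr G y ∩ Finset.univ).card)
    have n5 := ind_nonneg (Stuck G F S r k q y)
    have hone := bern_le_const h20 h21 (E := edges G)
      (f := fun F₂ => ind (¬ InGiant (gr (F ∪ F₂)) S y)) (c := 1) fun _ _ => ind_le_one _
    by_cases c1 : MostlyDense (G \ gr F) S r
    swap
    · rw [ind_true c1] at *; linarith
    by_cases c2 : CutExpanding G S (2 * k)
    swap
    · rw [ind_true (⟨c1.mono sdiff_le, c2⟩ : MostlyDense G S r ∧ ¬ CutExpanding G S (2 * k))] at *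
      linarith
    by_cases c3 : Crossing G (gr F) S (2 * k)
    swap
    · rw [ind_true c3] at *; linarith
    by_cases c4 : 8 * (nbr (G \ gr F) y ∩ Finset.univ).card ≤ (nbr G y ∩ Finset.univ).card
    · rw [ind_true c4] at *; linarith
    by_cases c5 : Attachable G (giant (gr F) S) q y
    swap
    · have : Stuck G F S r k q y := by
        refine ⟨c1, c3, c2, ?_, c5⟩
        simpa using c4
      rw [ind_true this] at *; linarith
    have hatt := bern_not_attached_le h20 h21 c5
    have : bern (edges G) p₂ (fun F₂ => ind (¬ InGiant (gr (F ∪ F₂)) S y)) ≤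
        bern (edges G) p₂ (fun F₂ => ind (¬ ∃ u ∈ giant (gr F) S, (gr F₂).Reachable y u)) := by
      refine bern_mono h20 h21 fun F₂ _ => ind_mono fun hn => ?_
      rintro ⟨u, hu, hyu⟩
      refine hn (InGiant.of_reachable (hyu.mono (gr_mono Finset.subset_union_right)) ?_)
      exact (mem_giant.1 hu).2.mono (gr_mono Finset.subset_union_left)
    linarith
  refine (Finset.sum_le_sum hG).trans ?_
  simp only [Finset.sum_add_distrib, Finset.sum_const, nsmul_eq_mul]
  have e1 := sum_not_mostlyDense_le hΩ hdeg h hr hrd h10 h11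
  have e2 : ∑ G ∈ Ω, ind (MostlyDense G S r ∧ ¬ CutExpanding G S (2 * k)) ≤
      2 ^ S.card / 2 ^ k * Ω.card := by
    rw [← card_filter_eq_sum_ind, div_mul_eq_mul_div, le_div_iff₀ (by positivity), mul_comm]
    have := card_not_cutExpanding_le hΩ hS hk
      (B := Ω.filter fun G => MostlyDense G S r ∧ ¬ CutExpanding G S (2 * k))
      fun G hG => by simpa using hG
    exact_mod_cast this
  have e3 : ∑ G ∈ Ω, bern (edges G) p₁ (fun F => ind (¬ Crossing G (gr F) S (2 * k))) ≤
      Ω.card * (2 ^ S.card * (1 - p₁) ^ (2 * k)) := by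
    rw [← nsmul_eq_mul]
    exact Finset.sum_le_card_nsmul _ _ _ fun G _ => bern_not_crossing_le G h10 h11' S (2 * k)
  have e4 : ∑ G ∈ Ω, bern (edges G) p₁ (fun F => ind
        (8 * (nbr (G \ gr F) y ∩ Finset.univ).card ≤ (nbr G y ∩ Finset.univ).card)) ≤
      Ω.card * (4 / 5) ^ (8 * r) := by
    rw [← nsmul_eq_mul]
    refine Finset.sum_le_card_nsmul _ _ _ fun G hGΩ => ?_
    refine (bern_few_remaining_le G h10 h11 y Finset.univ).trans
      (pow_le_pow_of_le_one (by norm_num) (by norm_num) ?_)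
    rw [Finset.inter_univ, hdeg G hGΩ]
    have h1 := h.le_of_mem y hy
    have h2 := h.d_le
    have h3 : ((8 * r : ℕ) : ℝ) ≤ δ y := by push_cast; linarith [Nat.cast_nonneg (α := ℝ) r]
    exact_mod_cast h3
  have e5 := sum_stuck_le hΩ hdeg he h hr hrd hqr hk h10 h11' hy
  unfold coreErr
  linarith

end Core


/-! ### Deleting a vertex, and attaching it through its own edges. -/

section Vertex

variable {V : Type*} [Fintype V] [DecidableEq V]

/-- The finset of all graphs with degree sequence `δ`. -/
noncomputable def degGraphs (δ : V → ℕ) : Finset (SimpleGraph V) :=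
  (Set.toFinite {G : SimpleGraph V | ∀ v, (nbr G v).card = δ v}).toFinset

@[simp] lemma mem_degGraphs {δ : V → ℕ} {G : SimpleGraph V} :
    G ∈ degGraphs δ ↔ ∀ v, (nbr G v).card = δ v := by
  simp [degGraphs]

lemma swClosed_degGraphs (δ : V → ℕ) : SwClosed ⊥ (degGraphs δ) := by
  refine ⟨fun _ _ => bot_le, fun G hG a b c d hok _ _ => ?_⟩
  rw [mem_degGraphs] at hG ⊢
  intro v
  rw [card_nbr_sw hok, hG v]

lemma two_mul_card_edges {δ : V → ℕ} {G : SimpleGraph V} (hG : G ∈ degGraphs δ) :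
    2 * (edges G).card = ∑ v, δ v := by
  classical
  have h1 : edges G = G.edgeFinset := by ext; simp
  rw [h1, ← SimpleGraph.sum_degrees_eq_twice_card_edges]
  refine Finset.sum_congr rfl fun v _ => ?_
  rw [← mem_degGraphs.1 hG v, ← SimpleGraph.card_neighborFinset_eq_degree]
  congr 1; ext; simp

lemma card_edges_degGraphs (δ : V → ℕ) : ∃ e, ∀ G ∈ degGraphs δ, (edges G).card = e :=
  ⟨(∑ v, δ v) / 2, fun G hG => by have := two_mul_card_edges hG; omega⟩

/-- The graph `G` with the edges at `v` removed. -/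
def del (G : SimpleGraph V) (v : V) : SimpleGraph V where
  Adj a b := G.Adj a b ∧ a ≠ v ∧ b ≠ v
  symm := ⟨fun _ _ h => ⟨h.1.symm, h.2.2, h.2.1⟩⟩
  loopless := ⟨fun _ h => h.1.ne rfl⟩

/-- The degree sequence that remains when `v` is removed from a graph in which `N` is the
neighbourhood of `v`. -/
def delDeg (δ : V → ℕ) (v : V) (N : Finset V) (w : V) : ℕ :=
  if w = v then 0 else if w ∈ N then δ w - 1 else δ w

lemma nbr_del_self (G : SimpleGraph V) (v : V) : nbr (del G v) v = ∅ := by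
  ext; simp [del]

lemma nbr_del_of_ne (G : SimpleGraph V) {v w : V} (h : w ≠ v) :
    nbr (del G v) w = (nbr G w).erase v := by
  ext; simp [del, h, and_comm]

lemma del_mem_degGraphs {δ : V → ℕ} {G : SimpleGraph V} (hG : G ∈ degGraphs δ) (v : V) :
    del G v ∈ degGraphs (delDeg δ v (nbr G v)) := by
  rw [mem_degGraphs] at hG ⊢
  intro w
  by_cases hw : w = v
  · subst hw; simp [nbr_del_self, delDeg]
  · rw [nbr_del_of_ne G hw, delDeg, if_neg hw]
    by_cases hwv : w ∈ nbr G v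
    · rw [if_pos hwv, Finset.card_erase_of_mem (by simpa using (mem_nbr.1 hwv).symm), hG w]
    · rw [if_neg hwv, Finset.erase_eq_of_notMem, hG w]
      rw [mem_nbr] at hwv ⊢
      exact fun h => hwv h.symm

/-- The graph obtained from `G` by joining `v` to the vertices of `N`. -/
def join (G : SimpleGraph V) (v : V) (N : Finset V) : SimpleGraph V where
  Adj a b := G.Adj a b ∨ (a = v ∧ b ∈ N.erase v) ∨ (b = v ∧ a ∈ N.erase v)
  symm := ⟨fun _ _ h => by rw [G.adj_comm]; tauto⟩
  loopless := ⟨fun a h => by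
    rcases h with h | ⟨rfl, h⟩ | ⟨rfl, h⟩
    · exact h.ne rfl
    · simp at h
    · simp at h⟩

/-- Removing `v` is a bijection from the graphs with degree sequence `δ` in which `v` has
neighbourhood `N` to the graphs with the remaining degree sequence. -/
lemma sum_fiber_del {δ : V → ℕ} {v : V} {N : Finset V} (f : SimpleGraph V → ℝ)
    {Ω : Finset (SimpleGraph V)} (hΩ : ∀ G, G ∈ Ω ↔ G ∈ degGraphs δ ∧ nbr G v = N)
    (hne : Ω.Nonempty) :
    ∑ G ∈ Ω, f (del G v) = ∑ G ∈ degGraphs (delDeg δ v N), f G := by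
  classical
  obtain ⟨G₀, hG₀⟩ := hne
  rw [hΩ, mem_degGraphs] at hG₀
  obtain ⟨hG₀, hN₀⟩ := hG₀
  have hvN : v ∉ N := by rw [← hN₀]; simp
  have hcard : N.card = δ v := by rw [← hN₀, hG₀]
  have hpos : ∀ w ∈ N, 1 ≤ δ w := by
    intro w hw
    rw [← hN₀, mem_nbr] at hw
    rw [← hG₀ w]
    exact Finset.card_pos.2 ⟨v, mem_nbr.2 hw.symm⟩
  refine Finset.sum_bij (fun G _ => del G v) ?_ ?_ ?_ ?_
  · intro G hG
    obtain ⟨h1, h2⟩ := (hΩ G).1 hG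
    have := del_mem_degGraphs h1 v
    rwa [h2] at this
  · intro G hG G' hG' he
    obtain ⟨h1, h2⟩ := (hΩ G).1 hG
    obtain ⟨h1', h2'⟩ := (hΩ G').1 hG'
    have hv : ∀ w, G.Adj v w ↔ G'.Adj v w := by
      intro w
      rw [← mem_nbr, ← mem_nbr, h2, h2']
    ext a b
    by_cases ha : a = v
    · subst ha; exact hv b
    by_cases hb : b = v
    · subst hb; rw [G.adj_comm, G'.adj_comm]; exact hv a
    have : (del G v).Adj a b ↔ (del G' v).Adj a b := by rw [he]
    simpa [del, ha, hb] using this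
  · intro G hG
    rw [mem_degGraphs] at hG
    have hGv : nbr G v = ∅ := by
      rw [← Finset.card_eq_zero, hG v]; simp [delDeg]
    have hGv' : ∀ w, ¬ G.Adj v w := by
      intro w hw
      have : w ∈ nbr G v := mem_nbr.2 hw
      rw [hGv] at this
      simp at this
    have hGv'' : ∀ w, ¬ G.Adj w v := fun w h => hGv' w h.symm
    have hdel : del (join G v N) v = G := by
      ext a b
      simp only [del, join]
      constructor
      · rintro ⟨h | h | h, h1, h2⟩
        · exact h
        · exact absurd h.1 h1
        · exact absurd h.1 h2
      · intro h
        exact ⟨Or.inl h, fun e => hGv' b (e ▸ h), fun e => hGv'' a (e ▸ h)⟩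
    have hnv : nbr (join G v N) v = N := by
      ext w
      simp only [mem_nbr, join, Finset.mem_erase]
      constructor
      · rintro (h | h | h)
        · exact absurd h (hGv' w)
        · exact h.2.2
        · exact absurd rfl h.2.1
      · intro h
        exact Or.inr (Or.inl ⟨trivial, fun e => hvN (e ▸ h), h⟩)
    refine ⟨join G v N, (hΩ _).2 ⟨?_, hnv⟩, hdel⟩
    rw [mem_degGraphs]
    intro w
    by_cases hw : w = v
    · subst hw; rw [hnv, hcard]
    · have h1 := hG w
      rw [← hdel, nbr_del_of_ne _ hw, delDeg, if_neg hw] at h1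
      by_cases hwN : w ∈ N
      · rw [if_pos hwN, Finset.card_erase_of_mem] at h1
        · have hp := hpos w hwN
          have : 0 < (nbr (join G v N) w).card := Finset.card_pos.2 ⟨v, by
            simp only [mem_nbr, join, Finset.mem_erase]
            exact Or.inr (Or.inr ⟨trivial, hw, hwN⟩)⟩
          omega
        · simp only [mem_nbr, join, Finset.mem_erase]
          exact Or.inr (Or.inr ⟨trivial, hw, hwN⟩)
      · rw [if_neg hwN, Finset.erase_eq_of_notMem] at h1
        · exact h1
        · simp only [mem_nbr, join, Finset.mem_erase]
          rintro (h | h | h)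
          · exact hGv'' w h
          · exact hw h.1
          · exact hwN h.2.2
  · intro G _; rfl

lemma edges_eq_union (G : SimpleGraph V) (v : V) :
    edges G = edges (del G v) ∪ spokes G v Finset.univ := by
  ext e
  induction e with
  | _ a b =>
    simp only [Finset.mem_union, mem_edges, SimpleGraph.mem_edgeSet, mem_spokes, Finset.mem_univ,
      true_and, del, Sym2.eq_iff]
    constructor
    · intro h
      by_cases ha : a = v
      · exact Or.inr ⟨b, ha ▸ h, Or.inl ⟨ha, rfl⟩⟩
      by_cases hb : b = v
      · exact Or.inr ⟨a, hb ▸ h.symm, Or.inr ⟨rfl, hb⟩⟩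
      exact Or.inl ⟨h, ha, hb⟩
    · rintro (h | ⟨u, h, ⟨rfl, rfl⟩ | ⟨rfl, rfl⟩⟩)
      exacts [h.1, h, h.symm]

lemma disjoint_edges_del (G : SimpleGraph V) (v : V) :
    Disjoint (edges (del G v)) (spokes G v Finset.univ) := by
  rw [Finset.disjoint_left]
  intro e h1 h2
  obtain ⟨u, -, -, rfl⟩ := mem_spokes.1 h2
  simp [del] at h1

/-- The component of `v` in `H` contains more than half of `S`. -/
def InBig (H : SimpleGraph V) (S : Finset V) (v : V) : Prop :=
  S.card < 2 * (reach H v ∩ S).card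

/-- Three quarters of `S.erase v` is more than half of `S` as soon as `S` has four elements. -/
lemma inBig_of_adj {F F₀ : Finset (Sym2 V)} (hF : F₀ ⊆ F) {S : Finset V} (hS : 4 ≤ S.card)
    {v y : V} (hvy : (gr F).Adj v y) (hy : InGiant (gr F₀) (S.erase v) y) :
    InBig (gr F) S v := by
  have h1 : InGiant (gr F) (S.erase v) v :=
    InGiant.of_reachable hvy.reachable (hy.mono (gr_mono hF))
  unfold InGiant at h1
  have h2 := Finset.card_le_card (Finset.inter_subset_inter_left (Finset.erase_subset v S) :
    reach (gr F) v ∩ S.erase v ⊆ reach (gr F) v ∩ S)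
  have h3 := Finset.pred_card_le_card_erase (s := S) (a := v)
  unfold InBig
  omega

/-- The part `F₀` avoids `v`, so every edge at `v` comes from `F₁`. -/
lemma card_nbr_le_of_union {G : SimpleGraph V} {v : V} {F₀ F₁ : Finset (Sym2 V)}
    (h₀ : F₀ ⊆ edges (del G v)) : (nbr (gr (F₀ ∪ F₁)) v).card ≤ F₁.card := by
  refine Finset.card_le_card_of_injOn (fun u => s(v, u)) ?_ ?_
  · intro u hu
    simp only [Finset.mem_coe, mem_nbr, gr_adj, Finset.mem_union] at hu
    rcases hu.1 with h | h
    · have := h₀ h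
      simp [del] at this
    · exact h
  · intro a _ b _ h
    exact Sym2.congr_right.1 h

/-- The main estimate for one graph: if the giant component of the graph without `v` contains most
of the neighbours of `v` in `T`, then `v` is attached to it. -/
lemma bern_not_inBig_le {G : SimpleGraph V} {v : V} {T S : Finset V} (hS : 4 ≤ S.card) {p : ℝ}
    (h0 : 0 ≤ p) (h1 : p ≤ 1) {k ℓ : ℕ} {η : ℝ} (hη0 : 0 ≤ η)
    (hη : (1 - p) ^ ((ℓ + 1) / 2) ≤ η ∨
      (2 * ℓ ≤ (nbr G v).card ∧ (1 - (ℓ : ℝ) / (2 * (nbr G v).card)) ^ k ≤ η)) :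
    bern (edges G) p (fun F => ind (k ≤ (nbr (gr F) v).card ∧ ¬ InBig (gr F) S v)) ≤
      (η + ind ((nbr G v ∩ T).card < ℓ) + 2 / (nbr G v ∩ T).card * ∑ y ∈ nbr G v ∩ T,
        bern (edges (del G v)) p (fun F => ind (¬ InGiant (gr F) (S.erase v) y))) *
          binTail (nbr G v).card p k := by
  classical
  set N := nbr G v
  set Sp := spokes G v Finset.univ
  have hSp : Sp.card = N.card := by rw [card_spokes, Finset.inter_univ]
  have hb := binTail_nonneg h0 h1 N.card k
  rw [edges_eq_union G v, bern_union (disjoint_edges_del G v)]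
  rw [← bern_const (edges (del G v)) p (η + ind ((N ∩ T).card < ℓ)), ← bern_sum, ← bern_mul_left,
    ← bern_add, ← bern_mul_right]
  refine bern_mono h0 h1 fun F₀ hF₀ => ?_
  have htail : bern Sp p (fun F₁ => ind (k ≤ (nbr (gr (F₀ ∪ F₁)) v).card ∧
      ¬ InBig (gr (F₀ ∪ F₁)) S v)) ≤ binTail N.card p k := by
    rw [← hSp, ← bern_card_tail]
    exact bern_mono h0 h1 fun F₁ _ => ind_mono fun h => h.1.trans (card_nbr_le_of_union hF₀)
  have hsum0 : 0 ≤ 2 / ((N ∩ T).card : ℝ) *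
      ∑ y ∈ N ∩ T, ind (¬ InGiant (gr F₀) (S.erase v) y) :=
    mul_nonneg (by positivity) (Finset.sum_nonneg fun _ _ => ind_nonneg _)
  by_cases c1 : (N ∩ T).card < ℓ
  · rw [ind_true c1]
    refine htail.trans ?_
    nlinarith
  rw [ind_false c1, add_zero]
  set A := (N ∩ T).filter fun y => InGiant (gr F₀) (S.erase v) y
  have hAc : ((N ∩ T).card : ℝ) - A.card = ∑ y ∈ N ∩ T, ind (¬ InGiant (gr F₀) (S.erase v) y) := by
    rw [← card_filter_eq_sum_ind, sub_eq_iff_eq_add, add_comm]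
    exact_mod_cast (Finset.card_filter_add_card_filter_not _).symm
  by_cases c2 : 2 * A.card < (N ∩ T).card
  -- When over half of the neighbours in `T` miss the giant, the averaged sum, scaled by 2, is at
  -- least 1. As in every case, the tail probability is kept as a factor, so that the final bound is
  -- relative to the expected number of vertices with `k` kept edges.
  · refine htail.trans ?_
    have hpos : (0 : ℝ) < (N ∩ T).card := by
      have : 0 < (N ∩ T).card := by omega
      exact_mod_cast this
    have h2 : (1 : ℝ) ≤ 2 / ((N ∩ T).card : ℝ) *
        ∑ y ∈ N ∩ T, ind (¬ InGiant (gr F₀) (S.erase v) y) := by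
      rw [← hAc, div_mul_eq_mul_div, le_div_iff₀ hpos]
      have : (2 * A.card : ℝ) < (N ∩ T).card := by exact_mod_cast c2
      linarith
    nlinarith
  have hAN : A ⊆ N := (Finset.filter_subset _ _).trans Finset.inter_subset_left
  have hAl : ℓ ≤ 2 * A.card := by omega
  have hSA : spokes G v A ⊆ Sp := by
    intro e he
    obtain ⟨u, -, h, rfl⟩ := mem_spokes.1 he
    exact mem_spokes.2 ⟨u, Finset.mem_univ _, h, rfl⟩
  have hcA : (spokes G v A).card = A.card := by
    rw [card_spokes, Finset.inter_eq_right.2 hAN]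
  have hle : bern Sp p (fun F₁ => ind (k ≤ (nbr (gr (F₀ ∪ F₁)) v).card ∧
      ¬ InBig (gr (F₀ ∪ F₁)) S v)) ≤
      bern Sp p (fun F₁ => ind (k ≤ F₁.card ∧ F₁ ∩ spokes G v A = ∅)) := by
    refine bern_mono h0 h1 fun F₁ _ => ind_mono fun h => ⟨h.1.trans (card_nbr_le_of_union hF₀), ?_⟩
    rw [Finset.eq_empty_iff_forall_notMem]
    intro e he
    rw [Finset.mem_inter, mem_spokes] at he
    obtain ⟨he, y, hy, hvy, rfl⟩ := he
    refine h.2 (inBig_of_adj Finset.subset_union_left hS (y := y) ?_ (Finset.mem_filter.1 hy).2)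
    exact gr_adj.2 ⟨Finset.mem_union_right _ he, hvy.ne⟩
  have hηb : η * binTail N.card p k ≤ (η + 2 / ((N ∩ T).card : ℝ) *
      ∑ y ∈ N ∩ T, ind (¬ InGiant (gr F₀) (S.erase v) y)) * binTail N.card p k :=
    mul_le_mul_of_nonneg_right (by linarith) hb
  refine hle.trans (le_trans ?_ hηb)
  rcases hη with hη | ⟨hℓN, hη⟩
  · refine (bern_miss_le_pow hSA h0 h1 k).trans ?_
    rw [hcA, hSp]
    refine mul_le_mul_of_nonneg_right (le_trans ?_ hη) hb
    exact pow_le_pow_of_le_one (by linarith) (by linarith) (by omega)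
  -- Given at least `k` kept edges, missing a set of at least ℓ/2 of the #N edges costs a factor 1 -
  -- ℓ/(2 #N) for each of the `k`. This version needs no lower bound on p times the degree.
  · rcases Nat.eq_zero_or_pos N.card with hN | hN
    · refine (bern_miss_le_pow hSA h0 h1 k).trans ?_
      have hA0 : A.card = 0 := by have := Finset.card_le_card hAN; omega
      rw [hcA, hSp, hA0, pow_zero]
      refine mul_le_mul_of_nonneg_right ?_ hb
      rw [hN] at hη
      simpa using hη
    have hN' : (0 : ℝ) < N.card := by exact_mod_cast hN
    have hℓN' : 2 * (ℓ : ℝ) ≤ N.card := by exact_mod_cast hℓN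
    have hAl' : (ℓ : ℝ) ≤ 2 * A.card := by exact_mod_cast hAl
    refine (bern_miss_le_ratio hSA h0 h1 (k := k) (x := (ℓ : ℝ) / (2 * N.card)) ?_ ?_).trans ?_
    · rw [div_le_one (by positivity)]
      linarith [Nat.cast_nonneg (α := ℝ) ℓ]
    · rw [hcA, hSp, div_mul_eq_mul_div, div_le_iff₀ (by positivity)]
      nlinarith
    · rw [hSp]
      exact mul_le_mul_of_nonneg_right hη hb

/-- A vertex with at least `k` neighbours in the percolated random graph lies in the large component
with high conditional probability. -/
lemma sum_not_inBig_le {δ : V → ℕ} {T S : Finset V} {M θ d : ℝ} (h : DenseCore δ T S M θ d) (v : V)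
    (hdel : ∀ N : Finset V, N.card = δ v →
      DenseCore (delDeg δ v N) (T.erase v) (S.erase v) M θ d)
    (hS : 4 ≤ S.card) {r k' q : ℕ} (hr : 0 < r) (hrd : 1280 * (r : ℝ) ≤ d) (hqr : 32 * q ≤ r)
    (hk' : 4096 * k' ≤ r * (S.erase v).card) {p p₁ p₂ : ℝ} (h0 : 0 ≤ p) (h1 : p ≤ 1)
    (h10 : 0 ≤ p₁) (h11 : p₁ ≤ 1 / 2) (h20 : 0 ≤ p₂) (h21 : p₂ ≤ 1)
    (hp : 1 - p = (1 - p₁) * (1 - p₂)) {k ℓ : ℕ} {η : ℝ} (hη0 : 0 ≤ η)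
    (hη : (1 - p) ^ ((ℓ + 1) / 2) ≤ η ∨ (1 - (ℓ : ℝ) / (2 * δ v)) ^ k ≤ η)
    (hℓ : 40 * (ℓ : ℝ) ≤ θ) (hℓv : 2 * ℓ ≤ δ v) (hδ : 0 < δ v) :
    ∑ G ∈ degGraphs δ, bern (edges G) p
      (fun F => ind (k ≤ (nbr (gr F) v).card ∧ ¬ InBig (gr F) S v)) ≤
      (η + 20 * ℓ / δ v + 2 * coreErr d p₁ p₂ (S.erase v).card r k' q) *
        binTail (δ v) p k * (degGraphs δ).card := by
  classical
  set Ω := degGraphs δ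
  have hdeg : ∀ G ∈ Ω, ∀ v, (nbr G v).card = δ v := fun G hG => mem_degGraphs.1 hG
  have hb := binTail_nonneg h0 h1 (δ v) k
  set c := coreErr d p₁ p₂ (S.erase v).card r k' q
  have hc0 : 0 ≤ c := by
    have h1 : 0 ≤ 1 - p₁ := by linarith
    have h2 : 0 ≤ 1 - p₂ := by linarith
    have h3 : 0 < d := lt_of_lt_of_le (by positivity) hrd
    simp only [c, coreErr]
    positivity
  let g : SimpleGraph V → ℝ := fun G => 2 / (nbr G v ∩ T).card * ∑ y ∈ nbr G v ∩ T,
        bern (edges (del G v)) p (fun F => ind (¬ InGiant (gr F) (S.erase v) y))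
  have step1 : ∀ G ∈ Ω, bern (edges G) p
      (fun F => ind (k ≤ (nbr (gr F) v).card ∧ ¬ InBig (gr F) S v)) ≤
      (η + ind ((nbr G v ∩ T).card < ℓ) + g G) * binTail (δ v) p k := by
    intro G hG
    have := bern_not_inBig_le (G := G) (v := v) (T := T) hS h0 h1 (k := k) (ℓ := ℓ) hη0 (by
      rw [hdeg G hG v]
      rcases hη with hη | hη
      · exact Or.inl hη
      · exact Or.inr ⟨hℓv, hη⟩)
    rwa [hdeg G hG v] at this
  have step2 : ∑ G ∈ Ω, ind ((nbr G v ∩ T).card < ℓ) ≤ 20 * ℓ / δ v * Ω.card := by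
    have hδ' : (0 : ℝ) < δ v := by exact_mod_cast hδ
    have := few_core_nbrs (swClosed_degGraphs δ) hdeg h v hℓ hℓv
    rw [div_mul_eq_mul_div, le_div_iff₀ hδ']
    exact this
  -- The graphs are split by the neighbourhood N of `v`. In each class the graph without `v` is
  -- uniform for the degrees `delDeg δ v N`, so the result on the giant applies to every neighbour
  -- in `T`.
  have step3 : ∑ G ∈ Ω, g G ≤ 2 * c * Ω.card := by
    have hfib : ∀ f : SimpleGraph V → ℝ, ∑ G ∈ Ω, f G =
        ∑ N : Finset V, ∑ G ∈ Ω.filter (fun G => nbr G v = N), f G := fun f =>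
      (Finset.sum_fiberwise Ω (fun G => nbr G v) f).symm
    have hcardΩ : (2 * c * Ω.card : ℝ) =
        ∑ N : Finset V, 2 * c * ((Ω.filter (fun G => nbr G v = N)).card : ℝ) := by
      have := hfib fun _ => 1
      simp only [Finset.sum_const, nsmul_eq_mul, mul_one] at this
      rw [this, Finset.mul_sum]
    rw [hfib, hcardΩ]
    refine Finset.sum_le_sum fun N _ => ?_
    set ΩN := Ω.filter (fun G => nbr G v = N)
    rcases ΩN.eq_empty_or_nonempty with hemp | hne
    · rw [hemp]; simp
    have hΩN : ∀ G, G ∈ ΩN ↔ G ∈ degGraphs δ ∧ nbr G v = N := by simp [ΩN, Ω]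
    have hNδ : N.card = δ v := by
      obtain ⟨G, hG⟩ := hne
      have := (hΩN G).1 hG
      rw [← this.2, mem_degGraphs.1 this.1]
    have hvN : v ∉ N := by
      obtain ⟨G, hG⟩ := hne
      rw [← ((hΩN G).1 hG).2]; simp
    obtain ⟨e, he⟩ := card_edges_degGraphs (delDeg δ v N)
    have hcardN : (ΩN.card : ℝ) = (degGraphs (delDeg δ v N)).card := by
      have := sum_fiber_del (fun _ => (1 : ℝ)) hΩN hne
      simpa using this
    have hy : ∀ y ∈ N ∩ T, ∑ G ∈ ΩN, bern (edges (del G v)) p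
        (fun F => ind (¬ InGiant (gr F) (S.erase v) y)) ≤ c * ΩN.card := by
      intro y hy
      rw [Finset.mem_inter] at hy
      rw [sum_fiber_del (fun G => bern (edges G) p
        (fun F => ind (¬ InGiant (gr F) (S.erase v) y))) hΩN hne, hcardN]
      refine sum_not_inGiant_le (swClosed_degGraphs _) (fun G hG => mem_degGraphs.1 hG) he
        (hdel N hNδ) hr hrd hqr hk' h10 h11 h20 h21 hp ?_
      exact Finset.mem_erase.2 ⟨fun e => hvN (e ▸ hy.1), hy.2⟩
    have hg : ∑ G ∈ ΩN, g G = 2 / (N ∩ T).card * ∑ y ∈ N ∩ T, ∑ G ∈ ΩN,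
        bern (edges (del G v)) p (fun F => ind (¬ InGiant (gr F) (S.erase v) y)) := by
      rw [Finset.sum_comm, Finset.mul_sum]
      refine Finset.sum_congr rfl fun G hG => ?_
      simp only [g]
      rw [((hΩN G).1 hG).2]
    rw [hg]
    have hsum : ∑ y ∈ N ∩ T, ∑ G ∈ ΩN,
        bern (edges (del G v)) p (fun F => ind (¬ InGiant (gr F) (S.erase v) y)) ≤
          (N ∩ T).card * (c * ΩN.card) := by
      rw [← nsmul_eq_mul]
      exact Finset.sum_le_card_nsmul _ _ _ hy
    rcases Nat.eq_zero_or_pos (N ∩ T).card with h0 | hpos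
    · rw [h0]; simp; positivity
    · have hpos' : (0 : ℝ) < (N ∩ T).card := by exact_mod_cast hpos
      rw [div_mul_eq_mul_div, div_le_iff₀ hpos']
      linarith
  refine (Finset.sum_le_sum step1).trans ?_
  rw [← Finset.sum_mul, Finset.sum_add_distrib, Finset.sum_add_distrib, Finset.sum_const,
    nsmul_eq_mul]
  have : (Ω.card * η + ∑ G ∈ Ω, ind ((nbr G v ∩ T).card < ℓ) + ∑ G ∈ Ω, g G) * binTail (δ v) p k ≤
      ((η + 20 * ℓ / δ v + 2 * c) * Ω.card) * binTail (δ v) p k :=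
    mul_le_mul_of_nonneg_right (by linarith) hb
  linarith

end Vertex


/-! ### Concentration of the number of vertices with at least k kept edges. -/

section Concentration

variable {V : Type*} [Fintype V] [DecidableEq V]

lemma card_nbr_gr {G : SimpleGraph V} {F : Finset (Sym2 V)} (hF : F ⊆ edges G) (v : V) :
    (nbr (gr F) v).card = (F ∩ spokes G v Finset.univ).card := by
  rw [← Finset.card_image_of_injective (nbr (gr F) v) (f := fun u => s(v, u))
    fun a b h => Sym2.congr_right.1 h]
  congr 1
  ext e
  simp only [Finset.mem_image, mem_nbr, gr_adj, Finset.mem_inter, mem_spokes, Finset.mem_univ,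
    true_and]
  constructor
  · rintro ⟨u, ⟨h1, h2⟩, rfl⟩
    exact ⟨h1, u, by simpa using hF h1, rfl⟩
  · rintro ⟨h1, u, h2, rfl⟩
    exact ⟨u, ⟨h1, h2.ne⟩, rfl⟩

lemma bern_degree_tail (G : SimpleGraph V) (p : ℝ) (k : ℕ) (v : V) :
    bern (edges G) p (fun F => ind (k ≤ (nbr (gr F) v).card)) = binTail (nbr G v).card p k := by
  have h : (spokes G v Finset.univ).card = (nbr G v).card := by
    rw [card_spokes, Finset.inter_univ]
  rw [← h, ← bern_card_tail, ← bern_inter (spokes_subset G v Finset.univ)]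
  exact bern_congr fun F hF => by rw [card_nbr_gr hF]

/-- The number of vertices of `U` with at least `k` neighbours in `gr F`. -/
noncomputable def numDeg (U : Finset V) (k : ℕ) (F : Finset (Sym2 V)) : ℝ :=
  ∑ v ∈ U, ind (k ≤ (nbr (gr F) v).card)

lemma bern_numDeg (G : SimpleGraph V) (p : ℝ) (U : Finset V) (k : ℕ) :
    bern (edges G) p (numDeg U k) = ∑ v ∈ U, binTail (nbr G v).card p k := by
  unfold numDeg
  rw [bern_sum]
  exact Finset.sum_congr rfl fun v _ => bern_degree_tail G p k v

/-- Adding an edge affects only its two endpoints, and each only if it has exactly k - 1 other kept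
edges. The difference D lies between 0 and 2, so D² ≤ 2D, which makes the bound linear in pivotal
events. -/
lemma numDeg_diff_sq_le {G : SimpleGraph V} {U : Finset V} {k : ℕ} {F : Finset (Sym2 V)}
    (hF : F ⊆ edges G) {e : Sym2 V} (he : e ∈ edges G) :
    (numDeg U k (insert e F) - numDeg U k (F.erase e)) ^ 2 ≤
      2 * ∑ v ∈ U, ind (e ∈ spokes G v Finset.univ) *
        ind (((F ∩ spokes G v Finset.univ).erase e).card + 1 = k) := by
  classical
  have hF1 : insert e F ⊆ edges G := Finset.insert_subset he hF
  have hF2 : F.erase e ⊆ edges G := (Finset.erase_subset _ _).trans hF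
  set a : V → ℝ := fun v => ind (e ∈ spokes G v Finset.univ) *
        ind (((F ∩ spokes G v Finset.univ).erase e).card + 1 = k)
  have ha0 : ∀ v, 0 ≤ a v := fun v => mul_nonneg (ind_nonneg _) (ind_nonneg _)
  have hterm : ∀ v, 0 ≤ ind (k ≤ (nbr (gr (insert e F)) v).card) -
        ind (k ≤ (nbr (gr (F.erase e)) v).card) ∧
      ind (k ≤ (nbr (gr (insert e F)) v).card) - ind (k ≤ (nbr (gr (F.erase e)) v).card) ≤ a v := by
    intro v
    rw [card_nbr_gr hF1, card_nbr_gr hF2, Finset.erase_inter]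
    set Y := F ∩ spokes G v Finset.univ
    by_cases hes : e ∈ spokes G v Finset.univ
    · have h1 : insert e F ∩ spokes G v Finset.univ = insert e (Y.erase e) := by
        rw [Finset.insert_inter_of_mem hes]
        ext x; simp only [Finset.mem_insert, Finset.mem_erase]; tauto
      rw [h1, Finset.card_insert_of_notMem (Finset.notMem_erase e Y)]
      simp only [a, ind_true hes, one_mul]
      change 0 ≤ _ ∧ _ ≤ ind ((Y.erase e).card + 1 = k)
      rcases lt_trichotomy ((Y.erase e).card + 1) k with h | h | h
      · rw [ind_false (by omega), ind_false (by omega)]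
        simp [ind_nonneg]
      · rw [ind_true (by omega), ind_false (by omega), ind_true h]
        norm_num
      · rw [ind_true (by omega), ind_true (by omega)]
        simp [ind_nonneg]
    · rw [Finset.insert_inter_of_notMem hes, Finset.erase_eq_of_notMem
        fun h => hes (Finset.mem_inter.1 h).2]
      simp [ha0]
  have hsum : ∑ v ∈ U, a v ≤ 2 := by
    have h1 : ∀ v ∈ U, a v ≤ ind (v ∈ e) := by
      intro v _
      refine le_trans (mul_le_of_le_one_right (ind_nonneg _) (ind_le_one _)) (ind_mono fun h => ?_)
      obtain ⟨u, -, -, rfl⟩ := mem_spokes.1 h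
      exact Sym2.mem_mk_left _ _
    refine (Finset.sum_le_sum h1).trans ?_
    rw [← card_filter_eq_sum_ind]
    have : (U.filter fun v => v ∈ e).card ≤ 2 := by
      induction e with
      | _ x y =>
        refine (Finset.card_le_card (t := {x, y}) ?_).trans Finset.card_le_two
        intro v hv
        simpa using (Finset.mem_filter.1 hv).2
    exact_mod_cast this
  have hD0 : 0 ≤ numDeg U k (insert e F) - numDeg U k (F.erase e) := by
    unfold numDeg
    rw [← Finset.sum_sub_distrib]
    exact Finset.sum_nonneg fun v _ => (hterm v).1
  have hD1 : numDeg U k (insert e F) - numDeg U k (F.erase e) ≤ ∑ v ∈ U, a v := by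
    unfold numDeg
    rw [← Finset.sum_sub_distrib]
    exact Finset.sum_le_sum fun v _ => (hterm v).2
  nlinarith

/-- The variance of the number of vertices with at least `k` retained neighbours. -/
lemma bernVar_numDeg_le (G : SimpleGraph V) {p : ℝ} (h0 : 0 ≤ p) (h1 : p ≤ 1) (U : Finset V)
    (k : ℕ) :
    bernVar (edges G) p (numDeg U k) ≤ 2 * k * ∑ v ∈ U, binTail (nbr G v).card p k := by
  classical
  have hsum : ∑ e ∈ edges G, bern (edges G) p
      (fun F => (numDeg U k (insert e F) - numDeg U k (F.erase e)) ^ 2) ≤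
      2 * ∑ v ∈ U, ∑ e ∈ spokes G v Finset.univ, bern (spokes G v Finset.univ) p
        (fun F => ind ((F.erase e).card + 1 = k)) := by
    have h2 : ∀ e ∈ edges G, bern (edges G) p
        (fun F => (numDeg U k (insert e F) - numDeg U k (F.erase e)) ^ 2) ≤
        2 * ∑ v ∈ U, ind (e ∈ spokes G v Finset.univ) * bern (spokes G v Finset.univ) p
          (fun F => ind ((F.erase e).card + 1 = k)) := by
      intro e he
      refine (bern_mono h0 h1 fun F hF => numDeg_diff_sq_le hF he).trans (le_of_eq ?_)
      rw [bern_mul_left, bern_sum]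
      congr 1
      refine Finset.sum_congr rfl fun v _ => ?_
      rw [bern_mul_left, bern_inter (spokes_subset G v Finset.univ) p
        (fun F => ind ((F.erase e).card + 1 = k))]
    refine (Finset.sum_le_sum h2).trans (le_of_eq ?_)
    rw [← Finset.mul_sum, Finset.sum_comm]
    congr 1
    refine Finset.sum_congr rfl fun v _ => ?_
    rw [← Finset.sum_filter_add_sum_filter_not (edges G) (· ∈ spokes G v Finset.univ)]
    have e1 : (edges G).filter (· ∈ spokes G v Finset.univ) = spokes G v Finset.univ := by
      ext e; simp only [Finset.mem_filter]
      exact ⟨And.right, fun h => ⟨spokes_subset G v _ h, h⟩⟩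
    rw [e1]
    have e2 : ∑ e ∈ (edges G).filter (· ∉ spokes G v Finset.univ),
        ind (e ∈ spokes G v Finset.univ) * bern (spokes G v Finset.univ) p
          (fun F => ind ((F.erase e).card + 1 = k)) = 0 :=
      Finset.sum_eq_zero fun e he => by
        rw [ind_false (Finset.mem_filter.1 he).2, zero_mul]
    rw [e2, add_zero]
    exact Finset.sum_congr rfl fun e he => by rw [ind_true he, one_mul]
  have hpiv : p * ∑ v ∈ U, ∑ e ∈ spokes G v Finset.univ, bern (spokes G v Finset.univ) p
        (fun F => ind ((F.erase e).card + 1 = k)) ≤ k * ∑ v ∈ U, binTail (nbr G v).card p k := by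
    rw [Finset.mul_sum, Finset.mul_sum]
    refine Finset.sum_le_sum fun v _ => ?_
    have := sum_bern_pivotal_le (E := spokes G v Finset.univ) h0 h1 k
    rwa [card_spokes, Finset.inter_univ] at this
  have hnn : 0 ≤ ∑ v ∈ U, ∑ e ∈ spokes G v Finset.univ, bern (spokes G v Finset.univ) p
        (fun F => ind ((F.erase e).card + 1 = k)) :=
    Finset.sum_nonneg fun _ _ => Finset.sum_nonneg fun _ _ =>
      bern_nonneg h0 h1 fun _ _ => ind_nonneg _
  refine (bernVar_le h0 h1 _ _).trans ?_
  have hpp : 0 ≤ p * (1 - p) := mul_nonneg h0 (by linarith)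
  have h3 := mul_le_mul_of_nonneg_left hsum hpp
  refine h3.trans ?_
  nlinarith [mul_nonneg h0 hnn, mul_nonneg (mul_nonneg h0 h0) hnn]

/-- Chebyshev's inequality for the number of vertices with at least `k` retained neighbours. -/
lemma bern_numDeg_deviation_le (G : SimpleGraph V) {p : ℝ} (h0 : 0 ≤ p) (h1 : p ≤ 1)
    (U : Finset V) (k : ℕ) {N s η : ℝ} (hN : ∑ v ∈ U, binTail (nbr G v).card p k = N)
    (hs : 0 < s) (hη : 0 < η) :
    bern (edges G) p (fun F => ind (η * (s + N) ≤ |numDeg U k F - N|)) ≤ 2 * k / (η ^ 2 * s) := by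
  have hN0 : 0 ≤ N := by
    rw [← hN]; exact Finset.sum_nonneg fun _ _ => binTail_nonneg h0 h1 _ _
  have h2 := bern_chebyshev (E := edges G) h0 h1 (numDeg U k) (t := η * (s + N)) (by positivity)
  rw [bern_numDeg, hN] at h2
  have h3 := bernVar_numDeg_le G h0 h1 U k
  rw [hN] at h3
  refine h2.trans ?_
  rw [div_le_div_iff₀ (by positivity) (by positivity)]
  -- Measuring deviations against s + N makes the bound uniform in N, which may be much smaller or
  -- larger than s.
  have h4 : N * s ≤ (s + N) ^ 2 := by nlinarith
  have hk : (0 : ℝ) ≤ k := Nat.cast_nonneg k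
  calc bernVar (edges G) p (numDeg U k) * (η ^ 2 * s) ≤ (2 * k * N) * (η ^ 2 * s) := by gcongr
    _ = 2 * k * η ^ 2 * (N * s) := by ring
    _ ≤ 2 * k * η ^ 2 * (s + N) ^ 2 := by gcongr
    _ = 2 * k * (η * (s + N)) ^ 2 := by ring

lemma one_sub_pow_le_exp {p : ℝ} (h1 : p ≤ 1) (n : ℕ) :
    (1 - p) ^ n ≤ Real.exp (-(p * n)) := by
  have h := Real.one_sub_le_exp_neg p
  calc (1 - p) ^ n ≤ Real.exp (-p) ^ n := pow_le_pow_left₀ (by linarith) h n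
    _ = Real.exp (-(p * n)) := by rw [← Real.exp_nat_mul]; congr 1; ring

/-- A lower tail bound for the binomial distribution. -/
lemma one_sub_binTail_le {p : ℝ} (h0 : 0 ≤ p) (h1 : p ≤ 1) (m k : ℕ) :
    1 - binTail m p k ≤ 2 ^ k * Real.exp (-(p * m / 2)) := by
  -- Chernoff bound with base 2: fewer than `k` elements forces 2^k · 2^(-#F) ≥ 1, and the mean of
  -- 2^(-#F) is (1 - p/2)^m.
  have h2 : 1 - binTail m p k ≤ bern (Finset.range m) p (fun F => 2 ^ k * (1 / 2 : ℝ) ^ F.card) := by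
    have e : 1 - binTail m p k = bern (Finset.range m) p (fun F => 1 - ind (k ≤ F.card)) := by
      rw [bern_sub, bern_const, bern_card_tail, Finset.card_range]
    rw [e]
    refine bern_mono h0 h1 fun F _ => ?_
    by_cases h : k ≤ F.card
    · rw [ind_true h]; simp
    · rw [ind_false h]
      push Not at h
      have : (2 : ℝ) ^ F.card * (1 / 2) ^ F.card = 1 := by rw [← mul_pow]; norm_num
      rw [sub_zero]
      calc (1 : ℝ) = 2 ^ F.card * (1 / 2) ^ F.card := this.symm
        _ ≤ 2 ^ k * (1 / 2) ^ F.card := by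
          gcongr
          norm_num
  refine h2.trans ?_
  rw [bern_mul_left, bern_pow_card, Finset.card_range]
  have h3 := one_sub_pow_le_exp (p := p / 2) (by linarith) m
  have : 1 - p + p * (1 / 2) = 1 - p / 2 := by ring
  rw [this, show p * m / 2 = p / 2 * m by ring]
  gcongr

end Concentration

/-! ### From vertex counts to the largest component. -/

section Component

variable {n : ℕ}

/-- A component with two vertices has no isolated vertex. A singleton component is covered because
`S` is nonempty. -/
lemma largestComponent_le_of_isolated {H : SimpleGraph (Fin n)} {S : Finset (Fin n)}
    (hS : 0 < S.card) :
    (largestComponent H : ℝ) ≤ S.card + ∑ v ∈ Sᶜ, ind (1 ≤ (nbr H v).card) := by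
  classical
  obtain ⟨v₀, -⟩ := Finset.card_pos.1 hS
  rw [← card_filter_eq_sum_ind]
  have hle : largestComponent H ≤ S.card + (Sᶜ.filter fun v => 1 ≤ (nbr H v).card).card := by
    have : Nonempty H.ConnectedComponent := ⟨H.connectedComponentMk v₀⟩
    refine ciSup_le fun c => ?_
    by_cases hc : c.supp.ncard ≤ 1
    · omega
    push Not at hc
    rw [Set.one_lt_ncard] at hc
    obtain ⟨a, ha, b, hb, hab⟩ := hc
    rw [← Finset.card_union_of_disjoint (Finset.disjoint_left.2 fun x hx hx' => by
      simp only [Finset.mem_filter, Finset.mem_compl] at hx'; exact hx'.1 hx),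
      ← Set.ncard_coe_finset]
    refine Set.ncard_le_ncard (fun v hv => ?_) (Finset.finite_toSet _)
    simp only [Finset.coe_union, Set.mem_union, Finset.mem_coe, Finset.mem_filter,
      Finset.mem_compl]
    by_cases hvS : v ∈ S
    · exact Or.inl hvS
    refine Or.inr ⟨hvS, ?_⟩
    have hex : ∃ w, w ≠ v ∧ H.Reachable v w := by
      rw [SimpleGraph.ConnectedComponent.mem_supp_iff] at ha hb hv
      by_cases h : a = v
      · exact ⟨b, fun h' => hab (h.trans h'.symm), SimpleGraph.ConnectedComponent.exact
          (hv.trans hb.symm)⟩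
      · exact ⟨a, h, SimpleGraph.ConnectedComponent.exact (hv.trans ha.symm)⟩
    obtain ⟨w, hwv, ⟨walk⟩⟩ := hex
    cases walk with
    | nil => exact absurd rfl hwv
    | cons h _ => exact Finset.card_pos.2 ⟨_, mem_nbr.2 h⟩
  exact_mod_cast hle

/-- Two sets that each contain more than half of `S` meet, so all vertices of `W` share one
component. -/
lemma le_largestComponent_of_inBig {H : SimpleGraph (Fin n)} {S W : Finset (Fin n)}
    (hW : ∀ v ∈ W, InBig H S v) : W.card ≤ largestComponent H := by
  classical
  rcases W.eq_empty_or_nonempty with h | ⟨v, hv⟩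
  · rw [h]; simp
  have hbdd : BddAbove (Set.range fun c : H.ConnectedComponent => c.supp.ncard) :=
    Set.Finite.bddAbove (Set.finite_range _)
  refine le_trans ?_ (le_ciSup hbdd (H.connectedComponentMk v))
  rw [← Set.ncard_coe_finset]
  refine Set.ncard_le_ncard (fun w hw => ?_) (Set.toFinite _)
  rw [SimpleGraph.ConnectedComponent.mem_supp_iff]
  refine SimpleGraph.ConnectedComponent.sound ?_
  have h1 := hW v hv
  have h2 := hW w hw
  unfold InBig at h1 h2
  have h3 := Finset.card_union_add_card_inter (reach H v ∩ S) (reach H w ∩ S)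
  have h4 := Finset.card_le_card (Finset.union_subset
    (Finset.inter_subset_right : reach H v ∩ S ⊆ S) (Finset.inter_subset_right : reach H w ∩ S ⊆ S))
  have h5 : 0 < (reach H v ∩ S ∩ (reach H w ∩ S)).card := by omega
  obtain ⟨x, hx⟩ := Finset.card_pos.1 h5
  simp only [Finset.mem_inter, mem_reach] at hx
  exact hx.2.1.trans hx.1.1.symm

/-- The upper bound on the largest component of the percolation of a fixed graph. -/
lemma bern_large_component_le (G : SimpleGraph (Fin n)) {p : ℝ} (h0 : 0 ≤ p) (h1 : p ≤ 1)
    {S : Finset (Fin n)} (hS : 0 < S.card) {N η : ℝ}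
    (hN : ∑ v ∈ Sᶜ, binTail (nbr G v).card p 1 = N) (hη : 0 < η) :
    bern (edges G) p (fun F => ind (¬ (largestComponent (gr F) : ℝ) ≤ (1 + η) * (S.card + N))) ≤
      2 / (η ^ 2 * S.card) := by
  have hS' : (0 : ℝ) < S.card := by exact_mod_cast hS
  have := bern_numDeg_deviation_le G h0 h1 Sᶜ 1 hN hS' hη
  rw [Nat.cast_one, mul_one] at this
  refine le_trans (bern_mono h0 h1 fun F _ => ind_mono fun h => ?_) this
  have h2 := largestComponent_le_of_isolated (H := gr F) hS
  refine le_trans ?_ (le_abs_self _)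
  unfold numDeg
  linarith

/-- The lower bound on the largest component of the percolated random graph, given that every vertex
with at least `k` retained neighbours is likely to lie in a large component. -/
lemma sum_small_component_le {δ : Fin n → ℕ} {S₀ S : Finset (Fin n)} (hS₀ : 0 < S₀.card) {p : ℝ}
    (h0 : 0 ≤ p) (h1 : p ≤ 1) {k : ℕ} {ε η N : ℝ} (hη : 0 < η) (hε : 0 ≤ ε)
    (hN : ∑ v ∈ S₀ᶜ, binTail (δ v) p k = N)
    (hcore : ∀ v ∈ S₀, 1 - binTail (δ v) p k ≤ ε)
    (hbig : ∀ v, ∑ G ∈ degGraphs δ, bern (edges G) p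
      (fun F => ind (k ≤ (nbr (gr F) v).card ∧ ¬ InBig (gr F) S v)) ≤
        ε * binTail (δ v) p k * (degGraphs δ).card) :
    ∑ G ∈ degGraphs δ, bern (edges G) p
      (fun F => ind (¬ (1 - 2 * η) * (S₀.card + N) ≤ (largestComponent (gr F) : ℝ))) ≤
      (2 * ε / η + 2 * k / (η ^ 2 * S₀.card)) * (degGraphs δ).card := by
  classical
  set Ω := degGraphs δ
  have hS' : (0 : ℝ) < S₀.card := by exact_mod_cast hS₀
  have hN0 : 0 ≤ N := by
    rw [← hN]; exact Finset.sum_nonneg fun _ _ => binTail_nonneg h0 h1 _ _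
  have hpos : 0 < η * (S₀.card + N) := by positivity
  let bad : Fin n → Finset (Sym2 (Fin n)) → ℝ := fun v F =>
    ind (k ≤ (nbr (gr F) v).card ∧ ¬ InBig (gr F) S v)
  let B : Finset (Sym2 (Fin n)) → ℝ := fun F =>
    ∑ v ∈ S₀, (1 - ind (k ≤ (nbr (gr F) v).card)) + ∑ v, bad v F
  have hB0 : ∀ F, 0 ≤ B F := fun F => add_nonneg
    (Finset.sum_nonneg fun v _ => by linarith [ind_le_one (k ≤ (nbr (gr F) v).card)])
    (Finset.sum_nonneg fun v _ => ind_nonneg _)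
  -- `B` collects the core vertices with fewer than `k` kept edges and the vertices with `k` kept
  -- edges outside the large component. Its mean is at most 2ε(#S₀ + N), so Markov controls `B` and
  -- Chebyshev controls `numDeg`, each losing η(#S₀ + N).
  have hL : ∀ F, S₀.card + numDeg S₀ᶜ k F - B F ≤ (largestComponent (gr F) : ℝ) := by
    intro F
    have h2 := le_largestComponent_of_inBig (H := gr F) (S := S)
      (W := Finset.univ.filter fun v => k ≤ (nbr (gr F) v).card ∧ InBig (gr F) S v)
      fun v hv => (Finset.mem_filter.1 hv).2.2
    have h3 : ((Finset.univ.filter fun v => k ≤ (nbr (gr F) v).card ∧ InBig (gr F) S v).card : ℝ) ≤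
        largestComponent (gr F) := by exact_mod_cast h2
    refine le_trans (le_of_eq ?_) h3
    rw [card_filter_eq_sum_ind]
    have h4 : ∀ v, ind (k ≤ (nbr (gr F) v).card ∧ InBig (gr F) S v) =
        ind (k ≤ (nbr (gr F) v).card) - bad v F := by
      intro v
      simp only [bad]
      rw [ind_and, ind_and, ind_not]; ring
    simp only [h4, Finset.sum_sub_distrib, B, numDeg, Finset.sum_const, nsmul_eq_mul, mul_one]
    rw [← Finset.sum_add_sum_compl S₀ fun v => ind (k ≤ (nbr (gr F) v).card)]
    ring
  have hG : ∀ G ∈ Ω, bern (edges G) p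
      (fun F => ind (¬ (1 - 2 * η) * (S₀.card + N) ≤ (largestComponent (gr F) : ℝ))) ≤
      bern (edges G) p B / (η * (S₀.card + N)) + 2 * k / (η ^ 2 * S₀.card) := by
    intro G hGΩ
    have hdeg := mem_degGraphs.1 hGΩ
    have hdev := bern_numDeg_deviation_le G h0 h1 S₀ᶜ k (N := N) (s := S₀.card) (η := η)
      (by rw [← hN]; exact Finset.sum_congr rfl fun v _ => by rw [hdeg]) hS' hη
    have hmar := bern_markov (E := edges G) h0 h1 (f := B) (fun F _ => hB0 F) hpos
    refine le_trans ?_ (add_le_add hmar hdev)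
    rw [← bern_add]
    refine bern_mono h0 h1 fun F _ => ind_or_le fun h => ?_
    by_contra! hc
    have h2 := hL F
    have h3 := neg_abs_le (numDeg S₀ᶜ k F - N)
    exact h (by linarith [hc.1, hc.2])
  refine (Finset.sum_le_sum hG).trans ?_
  rw [Finset.sum_add_distrib, Finset.sum_const, nsmul_eq_mul, ← Finset.sum_div]
  have hEB : ∑ G ∈ Ω, bern (edges G) p B ≤ 2 * ε * (S₀.card + N) * Ω.card := by
    have e1 : ∀ G ∈ Ω, bern (edges G) p B = ∑ v ∈ S₀, (1 - binTail (δ v) p k) +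
        ∑ v, bern (edges G) p (bad v) := by
      intro G hGΩ
      have hdeg := mem_degGraphs.1 hGΩ
      simp only [B]
      rw [bern_add, bern_sum, bern_sum]
      congr 1
      refine Finset.sum_congr rfl fun v _ => ?_
      rw [bern_sub, bern_const, bern_degree_tail, hdeg]
    rw [Finset.sum_congr rfl e1, Finset.sum_add_distrib, Finset.sum_const, nsmul_eq_mul,
      Finset.sum_comm]
    have e2 : ∑ v ∈ S₀, (1 - binTail (δ v) p k) ≤ S₀.card * ε := by
      rw [← nsmul_eq_mul]; exact Finset.sum_le_card_nsmul _ _ _ hcore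
    have e3 : ∑ v, ∑ G ∈ Ω, bern (edges G) p (bad v) ≤ ∑ v, ε * binTail (δ v) p k * Ω.card :=
      Finset.sum_le_sum fun v _ => hbig v
    have e4 : ∑ v, ε * binTail (δ v) p k * Ω.card ≤ ε * (S₀.card + N) * Ω.card := by
      rw [← Finset.sum_mul, ← Finset.mul_sum, ← Finset.sum_add_sum_compl S₀, hN]
      have e5 : ∑ v ∈ S₀, binTail (δ v) p k ≤ S₀.card := by
        have : ∑ v ∈ S₀, binTail (δ v) p k ≤ ∑ v ∈ S₀, (1 : ℝ) := by
          refine Finset.sum_le_sum fun v _ => ?_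
          rw [← Finset.card_range (δ v), ← bern_card_tail]
          exact bern_le_const h0 h1 fun _ _ => ind_le_one _
        simpa using this
      gcongr
    have e6 : (Ω.card : ℝ) * ∑ v ∈ S₀, (1 - binTail (δ v) p k) ≤ Ω.card * (S₀.card * ε) := by gcongr
    have e7 : 0 ≤ ε * N * Ω.card := by positivity
    linarith
  have : (∑ G ∈ Ω, bern (edges G) p B) / (η * (S₀.card + N)) ≤ 2 * ε / η * Ω.card := by
    rw [div_le_iff₀ hpos]
    refine hEB.trans (le_of_eq ?_)
    field_simp
  linarith

end Component


/-! ### Extracting a dense core from the degree sequence. -/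

section Construction

variable {V : Type*} [Fintype V] [DecidableEq V]

/-- Simplicity of the graph enters here: `S` spans at most #S² arcs, and the remaining ones use
degrees outside `S`. So a core carrying nearly all of the degree sum cannot be small. -/
lemma sum_deg_le_sq_add {δ : V → ℕ} {G : SimpleGraph V} (hG : ∀ v, (nbr G v).card = δ v)
    (S : Finset V) : ∑ v ∈ S, δ v ≤ S.card ^ 2 + ∑ v ∈ Sᶜ, δ v := by
  have h1 : ∑ v ∈ S, δ v = (arcs G S S).card + (arcs G S Sᶜ).card := by
    rw [card_arcs, card_arcs, ← Finset.sum_add_distrib]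
    refine Finset.sum_congr rfl fun v _ => ?_
    rw [← hG v, ← Finset.sdiff_eq_inter_compl, Finset.card_inter_add_card_sdiff]
  have h2 : (arcs G S Sᶜ).card ≤ ∑ v ∈ Sᶜ, δ v := by
    rw [card_arcs_comm, card_arcs]
    refine Finset.sum_le_sum fun v _ => ?_
    rw [← hG v]
    exact Finset.card_le_card Finset.inter_subset_left
  have h3 : (arcs G S S).card ≤ S.card ^ 2 := by
    rw [card_arcs, sq, ← smul_eq_mul]
    exact Finset.sum_le_card_nsmul _ _ _ fun v _ => Finset.card_le_card Finset.inter_subset_right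
  omega

lemma delDeg_le (δ : V → ℕ) (v : V) (N : Finset V) (w : V) : delDeg δ v N w ≤ δ w := by
  unfold delDeg; split_ifs <;> omega

lemma delDeg_self (δ : V → ℕ) (v : V) (N : Finset V) : delDeg δ v N v = 0 := by
  simp [delDeg]

lemma le_delDeg_add (δ : V → ℕ) (v : V) (N : Finset V) {w : V} (h : w ≠ v) :
    δ w ≤ delDeg δ v N w + if w ∈ N then 1 else 0 := by
  by_cases hw : w ∈ N
  · simp only [delDeg, if_neg h, if_pos hw]; omega
  · simp [delDeg, h, hw]

/-- The hypotheses are stronger than `DenseCore` by just enough to survive a deletion. Removing `v`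
lowers other degrees by at most one, absorbed by θ ≥ 25 and d ≥ 100, and costs the gap at most 2 δ v
≤ M/25, absorbed between 12/25 and 2/5. -/
lemma DenseCore.delete {δ : V → ℕ} {T S : Finset V} {M θ d : ℝ} (hTS : T ⊆ S) (hM : 0 < M)
    (hsum : ∑ v, (δ v : ℝ) = M) (hgap : 12 / 25 * M ≤ ∑ v ∈ T, (δ v : ℝ) - ∑ v ∈ Tᶜ, (δ v : ℝ))
    (hT : ∀ v, v ∈ T ↔ θ ≤ δ v) (hS : ∀ v ∈ S, d / 4 ≤ δ v) (hsq : θ ^ 2 ≤ M / 10)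
    (hMS : M ≤ 4 * θ * S.card) (hdθ : d ≤ 4 * θ) (hd : 100 ≤ d) (hS4 : 4 ≤ S.card)
    (hmax : ∀ v, (δ v : ℝ) ≤ M / 50) :
    DenseCore δ T S M θ d ∧ ∀ v N, N.card = δ v →
      DenseCore (delDeg δ v N) (T.erase v) (S.erase v) M θ d := by
  have hθ : 25 ≤ θ := by linarith
  constructor
  · exact ⟨hTS, hM, by linarith, hsum.le, by linarith,
      fun v hv => (not_le.1 fun h => hv ((hT v).2 h)).le,
      fun v hv => by linarith [(hT v).1 hv], fun v hv => by linarith [hS v hv], hsq,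
      by nlinarith [Nat.cast_nonneg (α := ℝ) S.card], hdθ⟩
  · intro v N hN
    have hle : ∀ w, (delDeg δ v N w : ℝ) ≤ δ w := fun w => by exact_mod_cast delDeg_le δ v N w
    have hge : ∀ w, w ≠ v → (δ w : ℝ) ≤ delDeg δ v N w + 1 := fun w hw => by
      have := le_delDeg_add δ v N hw
      have h2 : δ w ≤ delDeg δ v N w + 1 := by split_ifs at this <;> omega
      exact_mod_cast h2
    have hcard : (S.card : ℝ) ≤ (S.erase v).card + 1 := by
      have := Finset.pred_card_le_card_erase (s := S) (a := v)
      have : S.card ≤ (S.erase v).card + 1 := by omega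
      exact_mod_cast this
    refine ⟨Finset.erase_subset_erase v hTS, hM, by linarith,
      (Finset.sum_le_sum fun w _ => hle w).trans hsum.le, ?_, ?_, ?_, ?_, hsq, ?_, hdθ⟩
    · have h1 : ∑ w ∈ T, (δ w : ℝ) ≤ ∑ w ∈ T.erase v, (delDeg δ v N w : ℝ) + 2 * δ v := by
        have a : ∑ w ∈ T, (δ w : ℝ) ≤ ∑ w ∈ T.erase v, (δ w : ℝ) + δ v := by
          by_cases hv : v ∈ T
          · rw [← Finset.sum_erase_add _ _ hv]
          · rw [Finset.erase_eq_of_notMem hv]; linarith [Nat.cast_nonneg (α := ℝ) (δ v)]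
        have b : ∑ w ∈ T.erase v, δ w ≤
            ∑ w ∈ T.erase v, (delDeg δ v N w + if w ∈ N then 1 else 0) :=
          Finset.sum_le_sum fun w hw => le_delDeg_add δ v N (Finset.ne_of_mem_erase hw)
        have c : ∑ w ∈ T.erase v, (if w ∈ N then 1 else 0) ≤ δ v := by
          rw [← Finset.card_filter, ← hN]
          exact Finset.card_le_card fun w hw => (Finset.mem_filter.1 hw).2
        rw [Finset.sum_add_distrib] at b
        have e : (∑ w ∈ T.erase v, (δ w : ℝ)) ≤ ∑ w ∈ T.erase v, (delDeg δ v N w : ℝ) + δ v := by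
          exact_mod_cast b.trans (by omega)
        linarith
      have h2 : ∑ w ∈ (T.erase v)ᶜ, (delDeg δ v N w : ℝ) ≤ ∑ w ∈ Tᶜ, (δ w : ℝ) := by
        rw [Finset.compl_erase]
        by_cases hv : v ∈ Tᶜ
        · rw [Finset.insert_eq_of_mem hv]; exact Finset.sum_le_sum fun w _ => hle w
        · rw [Finset.sum_insert hv, delDeg_self]
          push_cast
          rw [zero_add]; exact Finset.sum_le_sum fun w _ => hle w
      linarith [hmax v]
    · intro w hw
      by_cases hwv : w = v
      · rw [hwv, delDeg_self]; push_cast; linarith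
      · refine (hle w).trans (not_le.1 fun h => hw (Finset.mem_erase.2 ⟨hwv, (hT w).2 h⟩)).le
    · intro w hw
      linarith [hge w (Finset.ne_of_mem_erase hw), (hT w).1 (Finset.mem_of_mem_erase hw)]
    · intro w hw
      linarith [hge w (Finset.ne_of_mem_erase hw), hS w (Finset.mem_of_mem_erase hw)]
    · have : (4 : ℝ) ≤ S.card := by exact_mod_cast hS4
      nlinarith

/-- A degree sequence whose vertices of degree at least `d` carry nearly all of the total degree has
a dense core containing those vertices. -/
lemma exists_denseCore {δ : V → ℕ} {d : ℕ} {S₀ : Finset V} (hS₀ : ∀ v, v ∈ S₀ ↔ d ≤ δ v)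
    (hne : (degGraphs δ).Nonempty) (hpos : ∀ v, 1 ≤ δ v) (hs : 0 < S₀.card) (hd : 100 ≤ d)
    (hU : 100 * ∑ v ∈ S₀ᶜ, δ v ≤ ∑ v ∈ S₀, δ v) :
    (d : ℝ) / 2 ≤ (S₀.card : ℝ) ∧ ∃ (T S : Finset V) (M θ : ℝ), S₀.card ≤ S.card ∧ (d : ℝ) ≤ 4 * θ ∧
      DenseCore δ T S M θ d ∧ ∀ v N, N.card = δ v →
        DenseCore (delDeg δ v N) (T.erase v) (S.erase v) M θ d := by
  obtain ⟨G, hG⟩ := hne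
  rw [mem_degGraphs] at hG
  set A := ∑ v ∈ S₀, (δ v : ℝ) with hA
  set B := ∑ v ∈ S₀ᶜ, (δ v : ℝ) with hB
  set s : ℝ := (S₀.card : ℝ) with hsdef
  have hs0 : 0 < s := by rw [hsdef]; exact_mod_cast hs
  have hd' : (100 : ℝ) ≤ d := by exact_mod_cast hd
  have hAB : 100 * B ≤ A := by rw [hA, hB]; exact_mod_cast hU
  have hB0 : 0 ≤ B := Finset.sum_nonneg fun _ _ => Nat.cast_nonneg _
  have hAs : A ≤ s ^ 2 + B := by rw [hA, hB, hsdef]; exact_mod_cast sum_deg_le_sq_add hG S₀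
  have hsA : s * d ≤ A := by
    rw [hA, hsdef, ← nsmul_eq_mul]
    exact Finset.card_nsmul_le_sum _ _ _ fun v hv => by exact_mod_cast (hS₀ v).1 hv
  -- Degrees are at least 1, so there are at most `B` vertices outside the core. Since s ≤ A/100 and
  -- B ≤ A/100, this yields δ v ≤ M/50.
  have hmax : ∀ v, (δ v : ℝ) ≤ s + B := by
    intro v
    have h1 : δ v ≤ S₀.card + ∑ v ∈ S₀ᶜ, δ v := by
      calc δ v = (nbr G v).card := (hG v).symm
        _ ≤ (S₀ ∪ S₀ᶜ).card := Finset.card_le_card (by simp)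
        _ ≤ S₀.card + S₀ᶜ.card := Finset.card_union_le _ _
        _ ≤ S₀.card + ∑ v ∈ S₀ᶜ, δ v := by
          gcongr
          rw [Finset.card_eq_sum_ones]
          exact Finset.sum_le_sum fun v _ => hpos v
    rw [hB, hsdef]; exact_mod_cast h1
  have hsum : ∑ v, (δ v : ℝ) = A + B := (Finset.sum_add_sum_compl S₀ _).symm
  have hds : (d : ℝ) / 2 ≤ s := by
    by_contra hc
    push Not at hc
    nlinarith
  set M := A + B with hM
  -- The core vertices of degree below θ carry at most sθ = M/4. Hence `T` carries at least 3M/4 -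
  -- B, and the gap is at least M/2 - 2B ≥ 12M/25. `T` may contain vertices outside `S₀`, so the
  -- working core is the union.
  set θ := M / (4 * s) with hθ
  have hθM : 4 * θ * s = M := by rw [hθ]; field_simp
  have hMpos : 0 < M := by nlinarith
  have hdθ : (d : ℝ) ≤ 4 * θ := by
    have : s * d ≤ s * (4 * θ) := by nlinarith
    exact le_of_mul_le_mul_left this hs0
  have hθ0 : 0 ≤ θ := by linarith
  let T := Finset.univ.filter fun v => θ ≤ δ v
  have hT : ∀ v, v ∈ T ↔ θ ≤ δ v := fun v => by simp [T]
  have hle : S₀.card ≤ (S₀ ∪ T).card := Finset.card_le_card Finset.subset_union_left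
  refine ⟨hds, T, S₀ ∪ T, M, θ, hle, hdθ, ?_⟩
  refine DenseCore.delete Finset.subset_union_right hMpos hsum ?_ hT ?_ ?_ ?_ hdθ hd' ?_ ?_
  · have h1 : ∑ v ∈ Tᶜ, (δ v : ℝ) ≤ B + s * θ := by
      calc ∑ v ∈ Tᶜ, (δ v : ℝ) ≤ ∑ v ∈ S₀ᶜ ∪ (Tᶜ ∩ S₀), (δ v : ℝ) := by
            refine Finset.sum_le_sum_of_subset_of_nonneg ?_ fun _ _ _ => Nat.cast_nonneg _
            intro v hv
            by_cases h : v ∈ S₀ <;> simp_all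
        _ ≤ B + ∑ v ∈ Tᶜ ∩ S₀, (δ v : ℝ) := by
            rw [Finset.sum_union]
            exact Finset.disjoint_left.2 fun v h1 h2 =>
              Finset.mem_compl.1 h1 (Finset.mem_inter.1 h2).2
        _ ≤ B + (Tᶜ ∩ S₀).card * θ := by
            gcongr
            rw [← nsmul_eq_mul]
            refine Finset.sum_le_card_nsmul _ _ _ fun v hv => ?_
            have := Finset.mem_compl.1 (Finset.mem_inter.1 hv).1
            rw [hT] at this
            exact (not_le.1 this).le
        _ ≤ B + s * θ := by
            gcongr
            rw [hsdef]
            exact_mod_cast Finset.card_le_card Finset.inter_subset_right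
    have h2 : ∑ v ∈ T, (δ v : ℝ) + ∑ v ∈ Tᶜ, (δ v : ℝ) = M := by
      rw [Finset.sum_add_sum_compl, hsum]
    nlinarith
  · intro v hv
    rcases Finset.mem_union.1 hv with h | h
    · have : (d : ℝ) ≤ δ v := by exact_mod_cast (hS₀ v).1 h
      linarith
    · have := (hT v).1 h
      linarith
  -- From A ≤ s² + B. Since θ = M/(4s), this is exactly θ² ≤ M/10.
  · have h1 : M ≤ 8 / 5 * s ^ 2 := by nlinarith
    have h2 : θ ^ 2 * (16 * s ^ 2) = M * M := by rw [← hθM]; ring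
    have h3 : M * M ≤ M / 10 * (16 * s ^ 2) := by nlinarith
    exact le_of_mul_le_mul_right (h2.le.trans h3) (by positivity)
  · rw [← hθM]
    have : s ≤ ((S₀ ∪ T).card : ℝ) := by rw [hsdef]; exact_mod_cast hle
    gcongr
  · have : (4 : ℝ) ≤ S₀.card := by linarith
    have : 4 ≤ S₀.card := by exact_mod_cast this
    omega
  · intro v
    have h1 := hmax v
    nlinarith

end Construction


/-! ### Choice of constants. -/

section Constants

lemma exists_exp_neg_le {c : ℝ} (hc : 0 < c) : ∃ X : ℝ, 1 ≤ X ∧ ∀ x, X ≤ x → Real.exp (-x) ≤ c := by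
  refine ⟨max 1 (-Real.log c), le_max_left _ _, fun x hx => ?_⟩
  rw [← Real.le_log_iff_exp_le hc]
  linarith [le_max_right 1 (-Real.log c)]

lemma one_half_le_exp : (1 / 2 : ℝ) ≤ Real.exp (-(1 / 2)) := by
  have := Real.add_one_le_exp (-(1 / 2) : ℝ)
  linarith

lemma two_le_exp_one : (2 : ℝ) ≤ Real.exp 1 := by
  have := Real.add_one_le_exp (1 : ℝ)
  linarith

/-- The scales are q = κ₂ r and r = κ₁ d up to rounding, with κ₁ and κ₂ small constants. Because p d
is large, p q is large too, and k ≈ r m/4096 satisfies p k ≥ 2m, which beats the 2^m cuts in both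
union bounds. -/
lemma exists_coreErr_le {ε : ℝ} (hε : 0 < ε) (hε1 : ε ≤ 1) :
    ∃ D : ℝ, ∀ d p : ℝ, D ≤ d → D ≤ p * d → 0 ≤ p → p ≤ 1 → ∃ r q : ℕ, 0 < r ∧
      1280 * (r : ℝ) ≤ d ∧ 32 * q ≤ r ∧ ∀ m : ℕ, d / 4 ≤ m → ∀ p₂ : ℝ, p / 2 ≤ p₂ → p₂ ≤ 1 →
        coreErr d (p / 2) p₂ m r (r * m / 4096) q ≤ ε := by
  obtain ⟨X, hX1, hX⟩ := exists_exp_neg_le (c := ε / 300) (by positivity)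
  -- 327680 = 8 · 40960 and 32768 = 8 · 4096, so that the terms 40960 r/d and 4096 q/r are each at
  -- most ε/8.
  set κ₁ : ℝ := ε / 327680 with hκ₁
  set κ₂ : ℝ := ε / 32768 with hκ₂
  have hκ₁0 : 0 < κ₁ := by positivity
  have hκ₂0 : 0 < κ₂ := by positivity
  have hκ₁1 : 327680 * κ₁ ≤ 1 := by rw [hκ₁]; linarith
  have hκ₂1 : 32768 * κ₂ ≤ 1 := by rw [hκ₂]; linarith
  refine ⟨65536 * X / (κ₁ * κ₂), fun d p hd hpd h0 h1 => ?_⟩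
  rw [div_le_iff₀ (by positivity)] at hd hpd
  have hd0 : 0 < d := by
    by_contra hc
    push Not at hc
    have : d * (κ₁ * κ₂) ≤ 0 := mul_nonpos_of_nonpos_of_nonneg hc (by positivity)
    linarith
  have hκd : 65536 * X ≤ κ₁ * d := by
    calc 65536 * X ≤ (κ₁ * d) * κ₂ := by linarith
      _ ≤ (κ₁ * d) * 1 := by gcongr; linarith
      _ = κ₁ * d := mul_one _
  set r := ⌊κ₁ * d⌋₊ with hr
  set q := ⌊κ₂ * r⌋₊ with hq
  have hr1 : (r : ℝ) ≤ κ₁ * d := Nat.floor_le (by positivity)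
  have hr2 : κ₁ * d < r + 1 := Nat.lt_floor_add_one _
  have hq1 : (q : ℝ) ≤ κ₂ * r := Nat.floor_le (by positivity)
  have hq2 : κ₂ * r < q + 1 := Nat.lt_floor_add_one _
  have hr3 : κ₁ * d / 2 ≤ r := by linarith
  have hr0 : (0 : ℝ) < r := by linarith
  have hpr : 32768 * X ≤ κ₂ * (p * r) := by
    calc 32768 * X ≤ κ₂ * (p * (κ₁ * d / 2)) := by linarith
      _ ≤ κ₂ * (p * r) := by gcongr
  have hpr0 : 0 ≤ p * r := by positivity
  have hpr' : 32768 * X ≤ p * r := by nlinarith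
  have hpq : 2 * X ≤ p * q := by
    have : p * (κ₂ * r) ≤ p * (q + 1) := by gcongr
    nlinarith
  refine ⟨r, q, by exact_mod_cast hr0, by nlinarith, ?_, fun m hm p₂ hp₂ hp₂1 => ?_⟩
  · have : (32 : ℝ) * q ≤ r := by nlinarith
    exact_mod_cast this
  set k := r * m / 4096 with hk
  have hk1 : (r : ℝ) * m ≤ 4096 * (k + 1) := by
    have : r * m ≤ 4096 * (k + 1) := (Nat.lt_mul_div_succ (r * m) (by norm_num)).le
    exact_mod_cast this
  have hdX : 65536 * X ≤ d := by nlinarith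
  have hm1 : 2 * X ≤ m := by linarith
  have hpk : 2 * (m : ℝ) ≤ p * k := by
    have h2 : p * (r * m) ≤ p * (4096 * (k + 1)) := by gcongr
    have h3 : 32768 * X * m ≤ p * r * m := by gcongr
    have h4 : (1 : ℝ) * m ≤ X * m := by gcongr
    nlinarith
  have hk2 : 2 * (m : ℝ) ≤ k := by
    have : p * k ≤ 1 * k := by gcongr
    linarith
  have t1 : 40960 * r / d ≤ ε / 8 := by
    rw [div_le_iff₀ hd0]
    have : 40960 * (κ₁ * d) = ε / 8 * d := by rw [hκ₁]; ring
    linarith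
  have t2 : 33 * (4 / 5 : ℝ) ^ (8 * r) ≤ ε / 8 := by
    have e : (4 / 5 : ℝ) ^ 8 ≤ Real.exp (-1) := by
      calc (4 / 5 : ℝ) ^ 8 ≤ (1 / 2) ^ 2 := by norm_num
        _ ≤ Real.exp (-(1 / 2)) ^ 2 := by gcongr; exact one_half_le_exp
        _ = Real.exp (-1) := by rw [← Real.exp_nat_mul]; norm_num
    have : (4 / 5 : ℝ) ^ (8 * r) ≤ ε / 300 := by
      calc (4 / 5 : ℝ) ^ (8 * r) = ((4 / 5) ^ 8) ^ r := pow_mul _ _ _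
        _ ≤ Real.exp (-1) ^ r := by gcongr
        _ = Real.exp (-r) := by rw [← Real.exp_nat_mul]; congr 1; ring
        _ ≤ ε / 300 := hX _ (by linarith)
    linarith
  have t3 : (2 : ℝ) ^ m / 2 ^ k ≤ ε / 8 := by
    have hk3 : 2 * m ≤ k := by exact_mod_cast hk2
    calc (2 : ℝ) ^ m / 2 ^ k ≤ 2 ^ m / 2 ^ (2 * m) := by gcongr; norm_num
      _ = (1 / 2) ^ m := by rw [two_mul, pow_add, one_div, inv_pow]; field_simp
      _ ≤ Real.exp (-(1 / 2)) ^ m := by gcongr; exact one_half_le_exp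
      _ = Real.exp (-(m / 2)) := by rw [← Real.exp_nat_mul]; congr 1; ring
      _ ≤ ε / 300 := hX _ (by linarith)
      _ ≤ ε / 8 := by linarith
  have t4 : (2 : ℝ) ^ m * (1 - p / 2) ^ (2 * k) ≤ ε / 8 := by
    calc (2 : ℝ) ^ m * (1 - p / 2) ^ (2 * k) ≤
          Real.exp 1 ^ m * Real.exp (-(p / 2 * (2 * k : ℕ))) := by
          gcongr
          · exact pow_nonneg (by linarith) _
          · exact two_le_exp_one
          · exact one_sub_pow_le_exp (by linarith) _
      _ = Real.exp (-(p * k - m)) := by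
          rw [← Real.exp_nat_mul, ← Real.exp_add]; congr 1; push_cast; ring
      _ ≤ ε / 300 := hX _ (by linarith)
      _ ≤ ε / 8 := by linarith
  have t5 : 4096 * q / r ≤ ε / 8 := by
    rw [div_le_iff₀ hr0]
    have : 4096 * (κ₂ * r) = ε / 8 * r := by rw [hκ₂]; ring
    linarith
  have t6 : 2 * (1 - p₂) ^ q ≤ ε / 8 := by
    have : (1 - p₂) ^ q ≤ ε / 300 := by
      refine (one_sub_pow_le_exp hp₂1 q).trans (hX _ ?_)
      have : p / 2 * q ≤ p₂ * q := by gcongr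
      linarith
    linarith
  unfold coreErr
  linarith

/-- Uniformly over all degree sequences with a dense core, once `k`, `d` and `p * d` are large. -/
lemma exists_not_inBig_bound {ε : ℝ} (hε : 0 < ε) (hε1 : ε ≤ 1) :
    ∃ (k : ℕ) (D : ℝ), ∀ {n : ℕ} {δ : Fin n → ℕ} {d : ℕ} {S₀ : Finset (Fin n)} {p : ℝ},
      (∀ v, v ∈ S₀ ↔ d ≤ δ v) → (degGraphs δ).Nonempty → (∀ v, 1 ≤ δ v) → 0 < S₀.card →
      100 * ∑ v ∈ S₀ᶜ, δ v ≤ ∑ v ∈ S₀, δ v → D ≤ d → D ≤ p * d → 0 ≤ p → p ≤ 1 →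
      (d : ℝ) / 2 ≤ (S₀.card : ℝ) ∧ (∀ v ∈ S₀, 1 - binTail (δ v) p k ≤ ε) ∧
      ∃ S : Finset (Fin n), ∀ v, ∑ G ∈ degGraphs δ, bern (edges G) p
        (fun F => ind (k ≤ (nbr (gr F) v).card ∧ ¬ InBig (gr F) S v)) ≤
          ε * binTail (δ v) p k * (degGraphs δ).card := by
  set ρ := ε / 320 with hρ
  have hρ0 : 0 < ρ := by positivity
  have hρ1 : 320 * ρ ≤ 1 := by rw [hρ]; linarith
  obtain ⟨X, hX1, hX⟩ := exists_exp_neg_le (c := ε / 4) (by positivity)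
  obtain ⟨k, hk⟩ := exists_nat_ge (2 * X / ρ)
  obtain ⟨Y, hY1, hY⟩ := exists_exp_neg_le (c := ε / 2 ^ k) (by positivity)
  obtain ⟨D₀, hD₀⟩ := exists_coreErr_le (ε := ε / 8) (by positivity) (by linarith)
  rw [div_le_iff₀ hρ0] at hk
  refine ⟨k, max (max 100 D₀) (max (2 * Y) (2 * X / ρ)), ?_⟩
  intro n δ d S₀ p hS₀ hne hpos hs hU hd hpd h0 h1
  obtain ⟨⟨hd100, hdD⟩, hdY, hdX⟩ := by simpa only [max_le_iff] using hd
  obtain ⟨⟨-, hpD⟩, hpY, hpX⟩ := by simpa only [max_le_iff] using hpd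
  rw [div_le_iff₀ hρ0] at hdX hpX
  obtain ⟨hds, T, S, M, θ, hSS, hdθ, hcore, hdel⟩ :=
    exists_denseCore hS₀ hne hpos hs (by exact_mod_cast hd100) hU
  refine ⟨hds, fun v hv => ?_, S, fun v => ?_⟩
  · refine (one_sub_binTail_le h0 h1 _ _).trans ?_
    have hdv : (d : ℝ) ≤ δ v := by exact_mod_cast (hS₀ v).1 hv
    have : Real.exp (-(p * δ v / 2)) ≤ ε / 2 ^ k := by
      apply hY
      have : p * d ≤ p * δ v := by gcongr
      linarith
    calc 2 ^ k * Real.exp (-(p * δ v / 2)) ≤ 2 ^ k * (ε / 2 ^ k) := by gcongr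
      _ = ε := by field_simp
  -- A vertex of degree below `k` never keeps `k` edges. Excluding it leaves ρ δ v ≥ 1, so that
  -- rounding ℓ up at most doubles it.
  by_cases hkv : δ v < k
  · have hz : ∑ G ∈ degGraphs δ, bern (edges G) p
        (fun F => ind (k ≤ (nbr (gr F) v).card ∧ ¬ InBig (gr F) S v)) ≤ 0 := by
      refine Finset.sum_nonpos fun G hG => bern_le_const h0 h1 fun F hF => ?_
      rw [ind_false]
      rintro ⟨h, -⟩
      have : (nbr (gr F) v).card ≤ (nbr G v).card := by
        refine Finset.card_le_card fun w hw => ?_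
        rw [mem_nbr, gr_adj] at hw
        rw [mem_nbr]
        exact mem_edges.1 (hF hw.1)
      rw [mem_degGraphs.1 hG v] at this
      omega
    have := binTail_nonneg h0 h1 (δ v) k
    exact hz.trans (by positivity)
  push Not at hkv
  have hkv' : (k : ℝ) ≤ δ v := by exact_mod_cast hkv
  obtain ⟨r, q, hr, hrd, hqr, hm⟩ := hD₀ d p hdD hpD h0 h1
  -- ℓ is a small fraction ρ of the degree, capped at ρ d because `few_core_nbrs` needs 40 ℓ ≤ θ.
  -- With ρ = ε/320 the probability 20ℓ/δ v is at most ε/8.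
  set μ : ℝ := min (δ v : ℝ) d with hμ
  have hμ1 : 1 ≤ ρ * μ := by
    rw [hμ, mul_min_of_nonneg _ _ hρ0.le, le_min_iff]
    constructor <;> nlinarith
  have hμd : μ ≤ d := min_le_right _ _
  have hμδ : μ ≤ δ v := min_le_left _ _
  set ℓ := ⌈ρ * μ⌉₊ with hℓ
  have hℓ1 : ρ * μ ≤ ℓ := Nat.le_ceil _
  have hℓ2 : (ℓ : ℝ) ≤ 2 * (ρ * μ) := by
    have := Nat.ceil_lt_add_one (a := ρ * μ) (by linarith)
    linarith
  have hδ0 : (0 : ℝ) < δ v := by exact_mod_cast hpos v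
  have hq0 : 0 < 1 - p / 2 := by linarith
  have hp₂ : p / 2 ≤ p / 2 / (1 - p / 2) := by
    rw [le_div_iff₀ hq0]; nlinarith
  have hp₂1 : p / 2 / (1 - p / 2) ≤ 1 := by
    rw [div_le_one hq0]; linarith
  have hSc : (S₀.card : ℝ) ≤ (S.erase v).card + 1 := by
    have := Finset.pred_card_le_card_erase (s := S) (a := v)
    have : S₀.card ≤ (S.erase v).card + 1 := by omega
    exact_mod_cast this
  -- If δ v ≤ d, then ℓ/(2 δ v) ≥ ρ/2 and the large constant `k` does the work. If δ v ≥ d, then ℓ ≥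
  -- ρ d and p d is large.
  have hη : (1 - p) ^ ((ℓ + 1) / 2) ≤ ε / 4 ∨ (1 - (ℓ : ℝ) / (2 * δ v)) ^ k ≤ ε / 4 := by
    rcases le_total (δ v : ℝ) d with h | h
    · right
      rw [min_eq_left h] at hμ
      have h3 : (ℓ : ℝ) / (2 * δ v) ≤ 1 := by
        rw [div_le_one (by positivity)]
        have : 320 * ρ * δ v ≤ 1 * δ v := by gcongr
        rw [hμ] at hℓ2
        linarith
      refine (one_sub_pow_le_exp h3 k).trans (hX _ ?_)
      have h4 : ρ / 2 ≤ (ℓ : ℝ) / (2 * δ v) := by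
        rw [le_div_iff₀ (by positivity)]
        rw [hμ] at hℓ1
        linarith
      have : ρ / 2 * k ≤ (ℓ : ℝ) / (2 * δ v) * k := by gcongr
      linarith
    · left
      rw [min_eq_right h] at hμ
      refine (one_sub_pow_le_exp h1 _).trans (hX _ ?_)
      have h5 : (ℓ : ℝ) / 2 ≤ ((ℓ + 1) / 2 : ℕ) := by
        have : ℓ ≤ 2 * ((ℓ + 1) / 2) := by omega
        have : (ℓ : ℝ) ≤ 2 * ((ℓ + 1) / 2 : ℕ) := by exact_mod_cast this
        linarith
      calc X ≤ p * (ρ * d / 2) := by linarith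
        _ ≤ p * ((ℓ + 1) / 2 : ℕ) := by
          rw [hμ] at hℓ1
          gcongr
          linarith
  have hsplit : 1 - p = (1 - p / 2) * (1 - p / 2 / (1 - p / 2)) := by
    rw [mul_sub, mul_div_cancel₀ _ hq0.ne']; ring
  have hρd : ρ * μ ≤ ρ * d := by gcongr
  have hρδ : ρ * μ ≤ ρ * δ v := by gcongr
  have hρd' : 320 * ρ * d ≤ 1 * d := by gcongr
  have hρδ' : 320 * ρ * δ v ≤ 1 * δ v := by gcongr
  refine (sum_not_inBig_le hcore v (hdel v) ?_ hr hrd hqr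
    (Nat.mul_div_le (r * (S.erase v).card) 4096) h0 h1 (by linarith) (by linarith)
    (by linarith) hp₂1 hsplit (η := ε / 4) (by positivity) hη ?_ ?_ (hpos v)).trans ?_
  · have : (4 : ℝ) ≤ S₀.card := by linarith
    have : 4 ≤ S₀.card := by exact_mod_cast this
    omega
  · linarith
  · have : 2 * (ℓ : ℝ) ≤ δ v := by linarith
    exact_mod_cast this
  · have hb := binTail_nonneg h0 h1 (δ v) k
    have h6 : 20 * ℓ / δ v ≤ ε / 8 := by
      rw [div_le_iff₀ hδ0]
      have : ε / 8 * δ v = 40 * (ρ * δ v) := by rw [hρ]; ring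
      rw [this]
      linarith
    have h7 := hm (S.erase v).card (by linarith) _ hp₂ hp₂1
    gcongr
    linarith

end Constants


/-! ### Identifying the probability law with finite averages. -/

section Law

variable {n : ℕ}

instance : MeasurableSingletonClass (SimpleGraph (Fin n)) where
  measurableSet_singleton G := by
    have : ({G} : Set (SimpleGraph (Fin n))) = SimpleGraph.edgeSet ⁻¹' {G.edgeSet} := by
      ext H; simp
    rw [this]
    exact SimpleGraph.measurable_edgeSet (measurableSet_singleton _)

lemma graphsWithDegrees_eq (δ : Fin n → ℕ) : graphsWithDegrees δ = degGraphs δ := by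
  ext G
  simp [graphsWithDegrees, ncard_neighborSet]

lemma percolation_real (G : SimpleGraph (Fin n)) (p : I) (P : SimpleGraph (Fin n) → Prop) :
    (percolation G p).real {H | P H} = bern (edges G) p (fun F => ind (P (gr F))) := by
  rw [percolation, measureReal_def, Measure.map_apply (by fun_prop) .of_discrete,
    ← measureReal_def, ← coe_edges]
  exact setBernoulli_real_eq_bern (edges G) p fun s => P (SimpleGraph.fromEdgeSet s)

instance (G : SimpleGraph (Fin n)) (p : I) : IsProbabilityMeasure (percolation G p) :=
  Measure.isProbabilityMeasure_map (by fun_prop)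

/-- Feasibility is not needed: without any admissible graph, the uniform measure and the quotient
are both zero. -/
lemma percolatedLaw_real (δ : Fin n → ℕ) (p : I) (P : SimpleGraph (Fin n) → Prop) :
    (percolatedLaw δ p).real {H | P H} =
      (∑ G ∈ degGraphs δ, bern (edges G) p (fun F => ind (P (gr F)))) / (degGraphs δ).card := by
  classical
  have h1 : ∀ G, (uniformOn (graphsWithDegrees δ)).real {G} =
      if G ∈ degGraphs δ then ((degGraphs δ).card : ℝ)⁻¹ else 0 := by
    intro G
    rw [graphsWithDegrees_eq, ← Finset.coe_singleton, measureReal_def, uniformOn_apply_finset]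
    split_ifs with h
    · rw [Finset.inter_singleton_of_mem h]; simp
    · rw [Finset.inter_singleton_of_notMem h]; simp
  rw [percolatedLaw, measureReal_def,
    Measure.bind_apply .of_discrete (Measurable.of_discrete).aemeasurable, lintegral_fintype,
    ENNReal.toReal_sum fun G _ => ENNReal.mul_ne_top (measure_ne_top _ _) (measure_ne_top _ _),
    Finset.sum_div, ← Finset.sum_subset (Finset.subset_univ (degGraphs δ))]
  · refine Finset.sum_congr rfl fun G hG => ?_
    rw [ENNReal.toReal_mul, ← measureReal_def, ← measureReal_def, h1, if_pos hG, percolation_real,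
      div_eq_mul_inv]
  · intro G _ hG
    rw [ENNReal.toReal_mul, ← measureReal_def, ← measureReal_def, h1, if_neg hG, mul_zero]

lemma percolatedLaw_real_le_one {δ : Fin n → ℕ} (p : I) (P : SimpleGraph (Fin n) → Prop) :
    (percolatedLaw δ p).real {H | P H} ≤ 1 := by
  rw [percolatedLaw_real]
  refine div_le_one_of_le₀ ?_ (Nat.cast_nonneg _)
  rw [← nsmul_one]
  exact Finset.sum_le_card_nsmul _ _ _ fun G _ => bern_le_const p.2.1 p.2.2 fun F _ => ind_le_one _

lemma one_sub_le_percolatedLaw_real {δ : Fin n → ℕ} (hne : (degGraphs δ).Nonempty) (p : I)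
    (P : SimpleGraph (Fin n) → Prop) {c : ℝ}
    (h : ∑ G ∈ degGraphs δ, bern (edges G) p (fun F => ind (¬ P (gr F))) ≤
      c * (degGraphs δ).card) :
    1 - c ≤ (percolatedLaw δ p).real {H | P H} := by
  have h0 : (0 : ℝ) < (degGraphs δ).card := by exact_mod_cast hne.card_pos
  rw [percolatedLaw_real, le_div_iff₀ h0]
  simp only [ind_not, bern_sub, bern_const, Finset.sum_sub_distrib, Finset.sum_const,
    nsmul_eq_mul, mul_one] at h
  linarith

lemma expectedAttached_eq (δ : Fin n → ℕ) (d : ℕ) (p : I) (k : ℝ) :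
    expectedAttached δ d p k = ∑ v ∈ (core δ d)ᶜ, binTail (δ v) p ⌈k⌉₊ :=
  Finset.sum_congr rfl fun _ _ => binomial_real_tail _ _ _

end Law

/-! ### From fixed ε to a sequence tending to zero. -/

section Asymptotic

/-- A diagonal argument: ε n = 1/(m + 1) for the largest m ≤ n whose threshold `N m` has been passed
by n. -/
lemma exists_seq_tendsto_of_forall {f : ℕ → ℝ → ℝ} (hle : ∀ n ε, f n ε ≤ 1)
    (h : ∀ ε, 0 < ε → ε ≤ 1 → ∀ᶠ n in atTop, 1 - ε ≤ f n ε) :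
    ∃ ε : ℕ → ℝ, Tendsto ε atTop (𝓝 0) ∧ Tendsto (fun n => f n (ε n)) atTop (𝓝 1) := by
  have h' : ∀ m : ℕ, ∃ N, ∀ n ≥ N, 1 - 1 / ((m : ℝ) + 1) ≤ f n (1 / ((m : ℝ) + 1)) := fun m =>
    eventually_atTop.1 (h _ Nat.one_div_pos_of_nat
      (div_le_one_of_le₀ (by linarith [Nat.cast_nonneg (α := ℝ) m]) (by positivity)))
  choose N hN using h'
  let u : ℕ → ℕ := fun n => Nat.findGreatest (fun m => N m ≤ n) n
  have hu : Tendsto u atTop atTop := tendsto_atTop.2 fun m => by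
    filter_upwards [eventually_ge_atTop m, eventually_ge_atTop (N m)] with n h1 h2
    exact Nat.le_findGreatest h1 h2
  have hε : Tendsto (fun n => 1 / ((u n : ℝ) + 1)) atTop (𝓝 0) :=
    tendsto_one_div_add_atTop_nhds_zero_nat.comp hu
  refine ⟨fun n => 1 / ((u n : ℝ) + 1), hε, ?_⟩
  refine tendsto_of_tendsto_of_tendsto_of_le_of_le' (g := fun n => 1 - 1 / ((u n : ℝ) + 1))
    (by simpa using hε.const_sub 1) tendsto_const_nhds ?_ (.of_forall fun n => hle _ _)
  filter_upwards [eventually_ge_atTop (N 0)] with n hn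
  exact hN _ _ (Nat.findGreatest_spec (P := fun m => N m ≤ n) (Nat.zero_le n) hn)

lemma eventually_div_card_le {s : ℕ → ℕ} (hs : Tendsto s atTop atTop) (a : ℝ) {b c : ℝ}
    (hc : 0 < c) : ∀ᶠ n in atTop, a / (b * s n) ≤ c := by
  have h : Tendsto (fun n => a / b / (s n : ℝ)) atTop (𝓝 0) :=
    (tendsto_natCast_atTop_atTop.comp hs).const_div_atTop _
  filter_upwards [h.eventually (ge_mem_nhds hc)] with n hn
  rwa [← div_div]

end Asymptotic

end DensePercolation

open DensePercolation
theorem theorem6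
    (D : ∀ n : ℕ, Fin n → ℕ)
    (hfeasible : ∀ᶠ n in atTop, (graphsWithDegrees (D n)).Nonempty)
    (hpos : ∀ᶠ n in atTop, ∀ v, 1 ≤ D n v)
    (d : ℕ → ℕ) :
    (Tendsto (fun n => (core (D n) (d n)).card) atTop atTop →
      ∀ p : ℕ → I,
        ∃ ε : ℕ → ℝ, Tendsto ε atTop (𝓝 0) ∧
          Tendsto (fun n => (percolatedLaw (D n) (p n)).real
            {H | (largestComponent H : ℝ) ≤
              (1 + ε n) * ((core (D n) (d n)).card +
                expectedAttached (D n) (d n) (p n) 1)}) atTop (𝓝 1)) ∧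
    ((∀ᶠ n in atTop, 1 ≤ d n) →
      (fun n => (degreeSum (D n) (core (D n) (d n))ᶜ : ℝ))
        =o[atTop]
        (fun n => (degreeSum (D n) (core (D n) (d n)) : ℝ)) →
      ∀ p : ℕ → I, (fun n => 1 / (d n : ℝ)) =o[atTop] (fun n => (p n : ℝ)) →
      ∀ ω : ℕ → ℝ, Tendsto ω atTop atTop →
        ∃ ε : ℕ → ℝ, Tendsto ε atTop (𝓝 0) ∧
          Tendsto (fun n => (percolatedLaw (D n) (p n)).real
            {H | (1 - ε n) * ((core (D n) (d n)).card +
                expectedAttached (D n) (d n) (p n) (ω n)) ≤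
              (largestComponent H : ℝ)}) atTop (𝓝 1)) := by
  have hne : ∀ᶠ n in atTop, (degGraphs (D n)).Nonempty := by
    filter_upwards [hfeasible] with n hn
    rwa [graphsWithDegrees_eq, Finset.coe_nonempty] at hn
  refine ⟨fun hs p => ?_, fun hd hvol p hp ω hω => ?_⟩
  · refine exists_seq_tendsto_of_forall (f := fun n ε => (percolatedLaw (D n) (p n)).real
      {H | (largestComponent H : ℝ) ≤ (1 + ε) * ((core (D n) (d n)).card +
        expectedAttached (D n) (d n) (p n) 1)})
      (fun n ε => percolatedLaw_real_le_one _ _) fun ε hε _ => ?_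
    filter_upwards [hne, eventually_div_card_le hs 2 (b := ε ^ 2) hε,
      hs.eventually (eventually_gt_atTop 0)] with n hn hsn hs0
    refine (sub_le_sub_left hsn 1).trans (one_sub_le_percolatedLaw_real hn _ _ ?_)
    rw [mul_comm (2 / _), ← nsmul_eq_mul]
    refine Finset.sum_le_card_nsmul _ _ _ fun G hG => ?_
    refine bern_large_component_le G (p n).2.1 (p n).2.2 hs0 ?_ hε
    rw [expectedAttached_eq, Nat.ceil_one]
    exact Finset.sum_congr rfl fun v _ => by rw [mem_degGraphs.1 hG]
  -- The assumption on `p` says that p d tends to infinity, and p ≤ 1 then forces d to infinity as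
  -- well.
  · have hlarge : ∀ C : ℝ, ∀ᶠ n in atTop, C ≤ d n ∧ C ≤ p n * d n := fun C => by
      have hC : 0 < max C 1 := by positivity
      filter_upwards [hd, hp.bound (inv_pos.2 hC)] with n h1 h2
      have hd0 : (0 : ℝ) < d n := by exact_mod_cast h1
      have hp0 := (p n).2.1
      rw [Real.norm_of_nonneg (by positivity), Real.norm_of_nonneg hp0,
        div_le_iff₀ hd0, mul_assoc, inv_mul_eq_div, le_div_iff₀ hC, one_mul] at h2
      have h3 : (p n : ℝ) * d n ≤ 1 * d n := by gcongr; exact (p n).2.2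
      have := le_max_left C 1
      constructor <;> linarith
    have hvol' : ∀ᶠ n in atTop, 100 * ∑ v ∈ (core (D n) (d n))ᶜ, D n v ≤
        ∑ v ∈ core (D n) (d n), D n v := by
      filter_upwards [hvol.bound (c := 1 / 100) (by norm_num)] with n hn
      rw [Real.norm_of_nonneg (Nat.cast_nonneg _), Real.norm_of_nonneg (Nat.cast_nonneg _)] at hn
      have : 100 * (degreeSum (D n) (core (D n) (d n))ᶜ : ℝ) ≤
        degreeSum (D n) (core (D n) (d n)) := by linarith
      exact_mod_cast this
    have hs0 : ∀ᶠ n in atTop, 0 < (core (D n) (d n)).card := by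
      filter_upwards [hvol', hpos, eventually_gt_atTop 0] with n h1 h2 h3
      by_contra hc
      have hc : core (D n) (d n) = ∅ := Finset.card_eq_zero.1 (by omega)
      rw [hc] at h1
      have : D n ⟨0, h3⟩ ≤ ∑ v ∈ (∅ : Finset (Fin n))ᶜ, D n v :=
        Finset.single_le_sum (fun _ _ => Nat.zero_le _) (by simp)
      have := h2 ⟨0, h3⟩
      simp only [Finset.sum_empty] at h1
      omega
    have hcore : ∀ n v, v ∈ core (D n) (d n) ↔ d n ≤ D n v := fun n v => by simp [core]
    -- The core has at least d/2 vertices, and d tends to infinity.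
    have hs : Tendsto (fun n => (core (D n) (d n)).card) atTop atTop := by
      obtain ⟨k, C, hC⟩ := exists_not_inBig_bound one_pos le_rfl
      refine tendsto_natCast_atTop_iff (R := ℝ).1 (tendsto_atTop.2 fun b => ?_)
      filter_upwards [hlarge C, hlarge (2 * b), hne, hpos, hs0, hvol'] with n h1 h2 h3 h4 h5 h6
      have := (hC (hcore n) h3 h4 h5 h6 h1.1 h1.2 (p n).2.1 (p n).2.2).1
      linarith [h2.1]
    refine exists_seq_tendsto_of_forall (f := fun n ε => (percolatedLaw (D n) (p n)).real
      {H | (1 - ε) * ((core (D n) (d n)).card + expectedAttached (D n) (d n) (p n) (ω n)) ≤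
        (largestComponent H : ℝ)})
      (fun n ε => percolatedLaw_real_le_one _ _) fun ε hε hε1 => ?_
    have hε2 : ε ^ 2 / 8 ≤ 1 := by nlinarith
    -- With deviation parameter η = ε/2, the error ε²/8 turns the Markov term 2(ε²/8)/η into ε/2.
    -- The Chebyshev term supplies the other ε/2, since `k` is fixed and the core grows.
    obtain ⟨k, C, hC⟩ := exists_not_inBig_bound (ε := ε ^ 2 / 8) (by positivity) hε2
    filter_upwards [hlarge C, hne, hpos, hs0, hvol',
      eventually_div_card_le hs (2 * k) (b := (ε / 2) ^ 2) (half_pos hε),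
      hω.eventually (eventually_ge_atTop (k : ℝ))] with n h1 h2 h3 h4 h5 h6 h7
    obtain ⟨-, hcr, S, hS⟩ := hC (hcore n) h2 h3 h4 h5 h1.1 h1.2 (p n).2.1 (p n).2.2
    refine one_sub_le_percolatedLaw_real h2 _ _ ?_
    have hmain := sum_small_component_le h4 (p n).2.1 (p n).2.2 (half_pos hε)
      (by positivity) rfl hcr hS
    have hle : expectedAttached (D n) (d n) (p n) (ω n) ≤
        ∑ v ∈ (core (D n) (d n))ᶜ, binTail (D n v) (p n) k := by
      rw [expectedAttached_eq]
      refine Finset.sum_le_sum fun v _ => binTail_anti (p n).2.1 (p n).2.2 _ ?_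
      exact_mod_cast h7.trans (Nat.le_ceil _)
    calc _ ≤ _ := Finset.sum_le_sum fun G _ => bern_mono (p n).2.1 (p n).2.2 fun F _ =>
          ind_mono fun h h' => h (le_trans ?_ h')
      _ ≤ _ := hmain
      _ ≤ ε * (degGraphs (D n)).card := by
        gcongr
        have : 2 * (ε ^ 2 / 8) / (ε / 2) = ε / 2 := by field_simp; ring
        linarith
    rw [show 1 - 2 * (ε / 2) = 1 - ε by ring]
    have : 0 ≤ 1 - ε := by linarith
    gcongr
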